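/- **Conventions.** For a simple undirected graph $G$ with root $v_0$, a \emph{Pascal $(G,v_0)$-array} is a family of sets $Y(m;v)$ ($m\in\mathbb N$, $v$ a vertex of $G$) such that $Y(0;v)$ is in bijection with the set of paths of length $0$ from $v_0$ to $v$, together with injective edge maps $\phi_{m;v,w}:Y(m;v)\hookrightarrow Y(m+1;w)$, one for each pair of adjacent vertices $v,w$, such that $Y(m+1;w)=\bigsqcup_{v\sim w}\phi_{m;v,w}(Y(m;v))$ for all $m,w$. It \emph{underlies} a sequence of sets $(\mathcal C(m))_m$ via $\Phi$ (and the sequence is then a Catalan $(G,v_0)$-sequence) if $\Phi$ is a bijection from $\mathcal C(m)$ onto $\bigsqcup_v Y(m;v)\times Y(m;v)$ for each $m$. The \emph{double Young graph} $\mathcal Y^+$ has as vertices the integer partitions $\lambda$ and a second copy $\lambda+$ of each of them; its edges join $\lambda$ and $\nu+$ whenever $\lambda=\nu$ or $\lambda$ is obtained from $\nu$ by adding one box. Its root $0$ is the empty partition $\varnothing$. A \emph{half-partition} of $\underline n=\{1,\dots,n\}$ is a set partition of $\underline n$ together with a splitting of its set of parts into non-propagating and propagating components. Propagating components are ordered by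 their lowest elements. For $\lambda\vdash l$, let $Y_p(2n;\lambda)$ be the set of pairs $(\sigma,T)$ with $\sigma$ a half-partition of $\underline n$ with $l$ propagating components and $T$ a standard tableau of shape $\lambda$; let $Y_p(2n+1;\lambda+)$ be the set of pairs $(\sigma,T)$ with $\sigma$ a half-partition of $\underline{n+1}$ with $l+1$ propagating components, one of which contains $n+1$, and $T$ a standard tableau of shape $\lambda$. Let $Y_p(2n;\lambda+)=Y_p(2n+1;\lambda)=\varnothing$. For each integer partition $\nu\vdash l-1$ choose a bijection $\beta_\nu$ between the set of pairs $(\lambda,T)$, where $\lambda$ is obtained from $\nu$ by adding one box and $T$ is a standard tableau of shape $\lambda$, and the set of pairs $(k,U)$, where $1\le k\le l$ and $U$ is a standard tableau of shape $\nu$. (These sets index a basis of $\mathrm{Ind}_{S_{l-1}}^{S_l}V_\nu$ compatible with a composition series, and the basis of elements $\pi_k\otimes U$.) Define edge maps as follows. * $Y_p(2n;\lambda)\to Y_p(2n+1;\lambda+)$: add the propagating component $\{n+1\}$ and keep $T$. * $Y_p(2n;\lambda)\to Y_p(2n+1;\nu+)$, where $\lambda$ is $\nu$ plus one box: if $\beta_\nu(\lambda,T)=(k,U)$,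 add $n+1$ to the $k$-th propagating component and replace $T$ by $U$. * $Y_p(2n+1;\lambda+)\to Y_p(2n+2;\lambda)$: turn the propagating component containing $n+1$ into a non-propagating one and keep $T$. * $Y_p(2n+1;\lambda+)\to Y_p(2n+2;\mu)$, where $\mu$ is $\lambda$ plus one box: keep $\sigma$ and label the new box of $T$ with $|\lambda|+1$. Let $\mathcal C_p(n)$ be the set of set partitions of $\underline n\cup\underline n'=\{1,\dots,n\}\cup\{1',\dots,n'\}$, and $\mathcal C_p(n+)$ the set of those set partitions of $\underline{n+1}\cup\underline{n+1}'$ in which $n+1$ and $(n+1)'$ lie in the same part. The \emph{bra-ket decomposition} of $p\in\mathcal C_p(n)$ is the following element of some $Y_p(2n;\lambda)\times Y_p(2n;\lambda)$. The first half-partition $\sigma$ has as non-propagating components the parts of $p$ contained in $\underline n$, and as propagating components the intersections with $\underline n$ of the parts of $p$ that meet both $\underline n$ and $\underline n'$; the second one, $\sigma'$, is obtained in the same way from $\underline n'$ (with primes removed). The parts of $p$ match the ordered propagating components of $\sigma$ with those of $\sigma'$ and so define a permutation $\pi$, with $\pi(i)=j$ if the $i$-th component of $\sigma$ and the $j$-th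 component of $\sigma'$ come from the same part. If $(P,Q)$ is the pair formed by the insertion tableau $P$ and the recording tableau $Q$ of $\pi$ under the Robinson--Schensted correspondence, and $\lambda$ is their shape, then $p\mapsto((\sigma,P),(\sigma',Q))$ at the vertex $\lambda$. For $p\in\mathcal C_p(n+)$ the decomposition is defined in the same way, with $n$ replaced by $n+1$ in forming the half-partitions, and with the part containing $n+1$ and $(n+1)'$ left out in forming $\pi$; it gives an element of $Y_p(2n+1;\lambda+)\times Y_p(2n+1;\lambda+)$. **Proposition.** 1. Bijections $\beta_\nu$ as above exist for all $\nu$, and for every choice of them the sets $Y_p(m;v)$ with the edge maps above form a Pascal $(\mathcal Y^+,0)$-array. 2. $p\mapsto p\cup\{\{n+1,(n+1)'\}\}$ is an injection of $\mathcal C_p(n)$ into $\mathcal C_p(n+)$, and $\mathcal C_p(n+)\subseteq\mathcal C_p(n+1)$. The array $Y_p$ underlies the sequence $\mathcal C_p(0)\subseteq\mathcal C_p(0+)\subseteq\mathcal C_p(1)\subseteq\mathcal C_p(1+)\subseteq\cdots$ (numbered by $m=0,1,2,3,\dots$) via the bra-ket decomposition. 3. For every $n\ge 0$, the number of closed walks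 of length $2n$ on $\mathcal Y^+$ from the empty partition to itself is the Bell number $b(n)$, the number of set partitions of an $n$-element set. -/

import Mathlib

/-! ### Pascal arrays and Catalan sequences on simple undirected graphs -/

/-- An array of sets `Y n v`, indexed by `n : ℕ` and the vertices `v` of `G`, is a Pascal
`(G, v₀)`-array with edge maps `edge n v w : Y n v → Y (n + 1) w`, one for each directed edge
`v → w` of `G`. The sets `Y n v` are subsets of one ambient type `α`, so that an edge map is a
map `α → α` of which only the restriction to `Y n v` matters. -/
structure IsPascalArray {V α : Type*} (G : SimpleGraph V) (v₀ : V) (Y : ℕ → V → Set α)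
    (edge : ℕ → V → V → α → α) : Prop where
  /-- Layer `0` is in pointwise bijection with the paths of length `0` starting at `v₀`. -/
  layer_zero : ∀ v, Nonempty (Y 0 v ≃ {p : G.Walk v₀ v // p.length = 0})
  /-- Each edge map maps into the right set of the next layer. -/
  mapsTo : ∀ n v w, G.Adj v w → Set.MapsTo (edge n v w) (Y n v) (Y (n + 1) w)
  /-- Each edge map is injective. -/
  injOn : ∀ n v w, G.Adj v w → Set.InjOn (edge n v w) (Y n v)
  /-- The images of different edge maps ending at the same vertex are disjoint. -/
  disjoint : ∀ n v v' w, G.Adj v w → G.Adj v' w → v ≠ v' →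
    Disjoint (edge n v w '' Y n v) (edge n v' w '' Y n v')
  /-- The images of the edge maps ending at `w` cover the set at `w` in the next layer. -/
  cover : ∀ n w, Y (n + 1) w = ⋃ v, ⋃ _ : G.Adj v w, edge n v w '' Y n v

/-- `C` is a Catalan `(G, v₀)`-sequence via `Φ`, with underlying Pascal array `Y` (and second
Pascal array `Y'`): `Φ n` is a bijection from `C n` onto the disjoint union over the vertices `v`
of the sets `Y n v × Y' n v`. Since `G` is undirected, `Y'` is an array for `G` as well. -/
structure IsCatalanSequenceVia {V α γ : Type*} (G : SimpleGraph V) (v₀ : V)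
    (Y : ℕ → V → Set α) (edge : ℕ → V → V → α → α)
    (Y' : ℕ → V → Set α) (edge' : ℕ → V → V → α → α)
    (C : ℕ → Set γ) (Φ : ℕ → γ → V × α × α) : Prop where
  isPascalArray : IsPascalArray G v₀ Y edge
  isPascalArray' : IsPascalArray G v₀ Y' edge'
  bijOn : ∀ n, Set.BijOn (Φ n) (C n) {x | x.2.1 ∈ Y n x.1 ∧ x.2.2 ∈ Y' n x.1}

/-! ### The double Young graph -/

/-- `lam - nu` is of the form `(0, …, 0, 1, 0, …)`, as sequences of row lengths. -/
def AddsBox (nu lam : YoungDiagram) : Prop :=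
  ∃ r, ∀ i, lam.rowLen i = nu.rowLen i + if i = r then 1 else 0

/-- The vertices of the double Young graph: `inl lam` is the integer partition `lam`, and
`inr lam` is its copy `lam+`. -/
abbrev DoubleYoungVertex : Type := YoungDiagram ⊕ YoungDiagram

/-- The double Young graph: `lam` and `nu+` are adjacent if `lam = nu` or if `lam` is obtained
from `nu` by adding one box. -/
def doubleYoungGraph : SimpleGraph DoubleYoungVertex where
  Adj
    | Sum.inl lam, Sum.inr nu => lam = nu ∨ AddsBox nu lam
    | Sum.inr nu, Sum.inl lam => lam = nu ∨ AddsBox nu lam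
    | _, _ => False
  symm := ⟨by rintro (a | a) (b | b) h <;> exact h⟩
  loopless := ⟨by rintro (a | a) h <;> exact h⟩

/-- The root of the double Young graph: the empty integer partition. -/
def emptyVertex : DoubleYoungVertex := Sum.inl ⊥

/-! ### Half-partitions and standard tableaux -/

/-- The data of a half-partition: the non-propagating and the propagating components. -/
structure HalfPartition where
  nonprop : Finset (Finset ℕ)
  propagating : Finset (Finset ℕ)

/-- `s` is a half-partition of `{1, …, n}`: a set partition of `{1, …, n}` together with a
splitting of its set of parts into two sets of parts (possibly empty). -/
def IsHalfPartition (n : ℕ) (s : HalfPartition) : Prop :=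
  Disjoint s.nonprop s.propagating ∧
    ∃ Q : Finpartition (Finset.Icc 1 n), Q.parts = s.nonprop ∪ s.propagating

/-- A filling of a Young diagram by natural numbers: `T i j` is the entry in row `i` and
column `j` (both counted from `0`), and `T i j = 0` outside of the diagram. -/
abbrev Filling : Type := ℕ → ℕ → ℕ

/-- `T` is a standard tableau of shape `lam`, with entries `1, …, |lam|`. -/
structure IsStandardTableau (lam : YoungDiagram) (T : Filling) : Prop where
  zeros : ∀ i j, (i, j) ∉ lam → T i j = 0
  bijOn : Set.BijOn (fun c : ℕ × ℕ => T c.1 c.2) lam.cells (Set.Icc 1 lam.card)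
  row_strict : ∀ i j₁ j₂, j₁ < j₂ → (i, j₂) ∈ lam → T i j₁ < T i j₂
  col_strict : ∀ i₁ i₂ j, i₁ < i₂ → (i₂, j) ∈ lam → T i₁ j < T i₂ j

/-- The array `Y_p`. At `m = 2n` and `lam`: pairs of a half-partition of `{1, …, n}` with
`|lam|` propagating components and a standard tableau of shape `lam`. At `m = 2n + 1` and `lam+`:
pairs of a half-partition of `{1, …, n + 1}` with `|lam| + 1` propagating components, one of
which contains `n + 1`, and a standard tableau of shape `lam`. All other sets are empty. -/
def Yp (m : ℕ) : DoubleYoungVertex → Set (HalfPartition × Filling)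
  | Sum.inl lam => {x | Even m ∧ IsHalfPartition (m / 2) x.1 ∧
      x.1.propagating.card = lam.card ∧ IsStandardTableau lam x.2}
  | Sum.inr lam => {x | Odd m ∧ IsHalfPartition (m / 2 + 1) x.1 ∧
      x.1.propagating.card = lam.card + 1 ∧ (∃ A ∈ x.1.propagating, m / 2 + 1 ∈ A) ∧
      IsStandardTableau lam x.2}

/-! ### Edge maps -/

/-- The position (counted from `1`) of `A` among the members of `F`, ordered by their lowest
elements. -/
def position (F : Finset (Finset ℕ)) (A : Finset ℕ) : ℕ :=
  (F.filter fun B => B.min ≤ A.min).card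

/-- Add the new propagating component `{a}`. -/
def HalfPartition.addPropagating (a : ℕ) (s : HalfPartition) : HalfPartition where
  nonprop := s.nonprop
  propagating := insert {a} s.propagating

/-- Add the element `a` to the `k`-th propagating component. -/
def HalfPartition.addToPropagating (a k : ℕ) (s : HalfPartition) : HalfPartition where
  nonprop := s.nonprop
  propagating := s.propagating.image fun A =>
    if position s.propagating A = k then insert a A else A

/-- Turn the propagating component containing `a` into a non-propagating one. -/
def HalfPartition.stopPropagating (a : ℕ) (s : HalfPartition) : HalfPartition where
  nonprop := s.nonprop ∪ s.propagating.filter fun A => a ∈ A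
  propagating := s.propagating.filter fun A => a ∉ A

/-- Extend a filling of `lam` to `mu ≥ lam` by the entry `a` in the new boxes. -/
def Filling.addLabel (lam mu : YoungDiagram) (a : ℕ) (T : Filling) : Filling := fun i j =>
  if (i, j) ∈ mu ∧ (i, j) ∉ lam then a else T i j

/-- `b` is a bijection from the pairs `(lam, T)`, where `lam` is `nu` with one box added and `T`
is a standard tableau of shape `lam`, to the pairs `(k, U)`, where `1 ≤ k ≤ l := |nu| + 1` and `U`
is a standard tableau of shape `nu`. The first set labels the bases of `Ind V_nu` (from the
symmetric group `S_(l-1)` to `S_l`) compatible with a composition series, whose factors are the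
modules `V_lam`; the second one labels the basis `π_k ⊗ U`. -/
def IsInductionBijection (nu : YoungDiagram) (b : YoungDiagram × Filling → ℕ × Filling) : Prop :=
  Set.BijOn b {x | AddsBox nu x.1 ∧ IsStandardTableau x.1 x.2}
    {y | y.1 ∈ Set.Icc 1 (nu.card + 1) ∧ IsStandardTableau nu y.2}

open Classical in
/-- The edge maps of `Yp`, for a choice `b nu` of the bijections of the induced modules.
With `m = 2n`, the map along `lam → lam+` adds the propagating component `{n + 1}`, and the map
along `lam → nu+` for `lam ≠ nu` adds `n + 1` to the `k`-th propagating component and replaces `T`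
by `U`, where `(k, U)` corresponds to `(lam, T)`. With `m = 2n + 1`, the map along `lam+ → lam`
turns the component containing `n + 1` into a non-propagating one, and the map along `lam+ → mu`
for `mu ≠ lam` labels the new box of `mu` by `|lam| + 1`. -/
noncomputable def edgeMap (b : YoungDiagram → YoungDiagram × Filling → ℕ × Filling) (m : ℕ) :
    DoubleYoungVertex → DoubleYoungVertex → HalfPartition × Filling → HalfPartition × Filling
  | Sum.inl lam, Sum.inr nu, (s, T) =>
      if lam = nu then (s.addPropagating (m / 2 + 1), T)
      else (s.addToPropagating (m / 2 + 1) (b nu (lam, T)).1, (b nu (lam, T)).2)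
  | Sum.inr lam, Sum.inl mu, (s, T) =>
      if mu = lam then (s.stopPropagating (m / 2 + 1), T)
      else (s, T.addLabel lam mu (lam.card + 1))
  | _, _, x => x

/-! ### The sequence of sets of set partitions -/

/-- `C_p(n)`: the set partitions of `{1, …, n} ∪ {1', …, n'}`, with `inl i` for `i` and `inr i`
for `i'`; a set partition is given by its set of parts. -/
def Cp (n : ℕ) : Set (Finset (Finset (ℕ ⊕ ℕ))) :=
  {p | ∃ Q : Finpartition ((Finset.Icc 1 n).disjSum (Finset.Icc 1 n)), Q.parts = p}

/-- `C_p(n+)`: the set partitions of `{1, …, n + 1} ∪ {1', …, (n + 1)'}` in which `n + 1` and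
`(n + 1)'` lie in the same part. -/
def CpPlus (n : ℕ) : Set (Finset (Finset (ℕ ⊕ ℕ))) :=
  {p | p ∈ Cp (n + 1) ∧ ∃ B ∈ p, Sum.inl (n + 1) ∈ B ∧ Sum.inr (n + 1) ∈ B}

/-- The map `p ↦ p ∪ {{n + 1, (n + 1)'}}`, the canonical inclusion of `C_p(n)` in `C_p(n+)`. -/
def addPair (n : ℕ) (p : Finset (Finset (ℕ ⊕ ℕ))) : Finset (Finset (ℕ ⊕ ℕ)) :=
  p ∪ {{Sum.inl (n + 1), Sum.inr (n + 1)}}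

/-- The sequence `C_p(0), C_p(0+), C_p(1), C_p(1+), …`. -/
def partitionSequence (m : ℕ) : Set (Finset (Finset (ℕ ⊕ ℕ))) :=
  if Even m then Cp (m / 2) else CpPlus (m / 2)

/-! ### The Robinson-Schensted correspondence (row insertion) -/

/-- Insert `x` into an increasing row: `x` replaces the first entry greater than `x`, which is
returned as the bumped entry; if there is none, then `x` is appended. -/
def rowInsert : List ℕ → ℕ → List ℕ × Option ℕ
  | [], x => ([x], none)
  | y :: ys, x =>
    if x < y then (x :: ys, some y) else (y :: (rowInsert ys x).1, (rowInsert ys x).2)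

/-- Insert `x` into the tableau with the given rows: a bumped entry is inserted into the next
row. The second component is the index of the row in which the new box appears. -/
def tableauInsert : List (List ℕ) → ℕ → List (List ℕ) × ℕ
  | [], x => ([[x]], 0)
  | r :: rs, x =>
    match rowInsert r x with
    | (r', none) => (r' :: rs, 0)
    | (r', some y) => (r' :: (tableauInsert rs y).1, (tableauInsert rs y).2 + 1)

/-- Append the entry `k` to the row with index `i`. -/
def appendToRow : List (List ℕ) → ℕ → ℕ → List (List ℕ)
  | [], _, k => [[k]]
  | r :: rs, 0, k => (r ++ [k]) :: rs
  | r :: rs, i + 1, k => r :: appendToRow rs i k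

/-- The Robinson-Schensted correspondence: the rows of the insertion tableau and of the
recording tableau of the word `w`. -/
def robinsonSchensted (w : List ℕ) : List (List ℕ) × List (List ℕ) :=
  (w.zipIdx 1).foldl
    (fun t x => ((tableauInsert t.1 x.1).1, appendToRow t.2 (tableauInsert t.1 x.1).2 x.2))
    ([], [])

/-- The filling with the given rows. -/
def fillingOfRows (rows : List (List ℕ)) : Filling := fun i j => (rows.getD i []).getD j 0

/-- The Young diagram of the given rows (whose lengths are always weakly decreasing when they are
the rows of a Robinson-Schensted tableau). -/
def shapeOfRows (rows : List (List ℕ)) : YoungDiagram :=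
  if h : (rows.map List.length).SortedGE then YoungDiagram.ofRowLens _ h else ⊥

/-! ### Bra-ket decomposition -/

/-- The parts which contain both unprimed and primed numbers. -/
def propagatingParts (p : Finset (Finset (ℕ ⊕ ℕ))) : Finset (Finset (ℕ ⊕ ℕ)) :=
  p.filter fun B => B.toLeft ≠ ∅ ∧ B.toRight ≠ ∅

/-- The half-partition of `{1, …, n}` obtained from a set partition. -/
def leftHalf (p : Finset (Finset (ℕ ⊕ ℕ))) : HalfPartition where
  nonprop := (p.filter fun B => B.toRight = ∅).image Finset.toLeft
  propagating := (propagatingParts p).image Finset.toLeft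

/-- The half-partition of `{1', …, n'}` obtained from a set partition, with the primes removed. -/
def rightHalf (p : Finset (Finset (ℕ ⊕ ℕ))) : HalfPartition where
  nonprop := (p.filter fun B => B.toLeft = ∅).image Finset.toRight
  propagating := (propagatingParts p).image Finset.toRight

/-- The permutation `π` defined by a set `s` of parts containing both unprimed and primed numbers,
as the word `π(1) π(2) ⋯ π(l)`: the unprimed halves of the parts are ordered by their lowest
numbers, and so are the primed halves, and `π(i) = j` if the `i`-th unprimed half and the `j`-th
primed half belong to the same part. The pairs `(i, π(i))` are sorted by `i`. -/
def matchingWord (s : Finset (Finset (ℕ ⊕ ℕ))) : List ℕ :=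
  ((s.image fun B => toLex (position (s.image Finset.toLeft) B.toLeft,
    position (s.image Finset.toRight) B.toRight)).sort (· ≤ ·)).map fun x => (ofLex x).2

/-- The parts that are matched by the permutation in the bra-ket decomposition of an element of
the `m`-th set of the sequence: all propagating parts if `m = 2n`, and all of them except for the
part containing `n + 1` and `(n + 1)'` if `m = 2n + 1`. -/
def matchedParts (m : ℕ) (p : Finset (Finset (ℕ ⊕ ℕ))) : Finset (Finset (ℕ ⊕ ℕ)) :=
  if Even m then propagatingParts p
  else (propagatingParts p).filter fun B => Sum.inl (m / 2 + 1) ∉ B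

/-- The bra-ket decomposition: the two half-partitions of a set partition, with the insertion
tableau and the recording tableau of the permutation which matches their propagating components,
and the vertex `lam` (for even `m`) or `lam+` (for odd `m`), where `lam` is the shape of the
tableaux. -/
def braKet (m : ℕ) (p : Finset (Finset (ℕ ⊕ ℕ))) :
    DoubleYoungVertex × (HalfPartition × Filling) × (HalfPartition × Filling) :=
  let t := robinsonSchensted (matchingWord (matchedParts m p))
  (if Even m then Sum.inl (shapeOfRows t.1) else Sum.inr (shapeOfRows t.1),
    (leftHalf p, fillingOfRows t.1), (rightHalf p, fillingOfRows t.2))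

/-- The Bell number: the number of partitions of a set of `n` elements. -/
def bellNumber (n : ℕ) : ℕ :=
  Fintype.card (Finpartition (Finset.univ : Finset (Fin n)))

/-!
The edge maps from odd layers only add a largest label to a standard tableau, or change the
status of one part, so they are injective and cover the next layer for elementary reasons. After
an edge map from an even layer, the part containing `n + 1` is either `{n + 1}`, which comes from
`nu → nu+`, or it is an older part enlarged by `n + 1`. In the second case the older part has some
position `k`, and the pair of `k` and the tableau `U` of shape `nu` is the image under the
bijection `b nu` of exactly one pair of a diagram `lam` and a tableau of shape `lam`. Hence every
member of the next layer has exactly one preimage along exactly one edge (`edgeMap_injective`,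
`exists_edgeMap_eq`), for every choice of `b`.

The other input is row insertion. Inserting a number `x` into a semistandard tableau `t` of shape
`nu` gives a tableau of a shape `lam` with one box more, and this is a bijection from the pairs
`(t, x)` onto the tableaux of all such shapes (`tableauInsert_injective`,
`exists_tableauInsert_eq`). Both facts are proved for arbitrary entries, with weakly increasing
rows, where no distinctness has to be carried along. They are used twice. Relabelling the entries
of `t` turns the bijection into a choice of `b nu` (`bijOn_insertInto`). Iterating it, and
recording the new boxes, gives the Robinson-Schensted correspondence between words and pairs of
tableaux (`robinsonSchensted_injective`, `exists_robinsonSchensted_eq`). Recording a step is the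
same operation on fillings, `Filling.addLabel`, as the one used by the edge maps, so the facts on
removing the largest label serve for both.

A set partition of `{1, …, n} ∪ {1', …, n'}` is the same as its two half-partitions together with
its propagating parts (`gluedParts_halves`, `isSetPartition_gluedParts`), and the propagating
parts are a matching of two families of sets of the same size, that is, a permutation
(`IsMatching.ext`, `exists_isMatching`). With the Robinson-Schensted correspondence this makes
the bra-ket decomposition bijective.

Finally, in any Pascal array the set at layer `m` and vertex `v` has as many members as there are
walks of length `m` from the root to `v` (`IsPascalArray.nonempty_equiv`). At layer `2n` and the
empty partition, the members are the half-partitions without propagating components, which are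
just the set partitions of `{1, …, n}`.
-/

/-! ### Row insertion -/

/-- The row `s` fits below the row `r` in a tableau: it is not longer than `r`, and each of its
entries is greater than the entry of `r` above it. -/
def FitsBelow : List ℕ → List ℕ → Prop
  | _, [] => True
  | [], _ :: _ => False
  | a :: r, b :: s => a < b ∧ FitsBelow r s

@[simp] lemma fitsBelow_nil (r : List ℕ) : FitsBelow r [] := by cases r <;> trivial

@[simp] lemma not_fitsBelow_nil_cons (b : ℕ) (s : List ℕ) : ¬ FitsBelow [] (b :: s) := id

@[simp] lemma fitsBelow_cons (a b : ℕ) (r s : List ℕ) :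
    FitsBelow (a :: r) (b :: s) ↔ a < b ∧ FitsBelow r s := Iff.rfl

lemma FitsBelow.length_le {r s : List ℕ} (h : FitsBelow r s) : s.length ≤ r.length := by
  induction r generalizing s with
  | nil => cases s <;> simp_all
  | cons a r ih => cases s with
    | nil => simp
    | cons b s => simpa using ih h.2

lemma FitsBelow.of_append {r u s : List ℕ} (h : FitsBelow (r ++ u) s)
    (hs : s.length ≤ r.length) : FitsBelow r s := by
  induction r generalizing s with
  | nil => cases s <;> simp_all
  | cons a r ih => cases s with
    | nil => simp
    | cons b s => exact ⟨h.1, ih h.2 (by simpa using hs)⟩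

lemma FitsBelow.exists_lt {r s : List ℕ} (h : FitsBelow r s) {y : ℕ} (hy : y ∈ s) :
    ∃ x ∈ r, x < y := by
  induction r generalizing s with
  | nil => cases s <;> simp_all
  | cons a r ih => cases s with
    | nil => simp at hy
    | cons b s =>
      rcases List.mem_cons.1 hy with rfl | hy
      · exact ⟨a, by simp, h.1⟩
      · obtain ⟨x, hx, hxy⟩ := ih h.2 hy
        exact ⟨x, by simp [hx], hxy⟩

lemma fitsBelow_iff {r s : List ℕ} : FitsBelow r s ↔
    s.length ≤ r.length ∧ ∀ j < s.length, r.getD j 0 < s.getD j 0 := by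
  induction r generalizing s with
  | nil => cases s <;> simp
  | cons a r ih => cases s with
    | nil => simp
    | cons b s =>
      simp only [fitsBelow_cons, ih, List.length_cons, Nat.add_le_add_iff_right]
      constructor
      · rintro ⟨h1, h2, h3⟩
        refine ⟨h2, fun j hj => ?_⟩
        cases j with
        | zero => simpa using h1
        | succ j => simpa using h3 j (by omega)
      · rintro ⟨h2, h3⟩
        refine ⟨by simpa using h3 0 (by omega), h2, fun j hj => ?_⟩
        simpa using h3 (j + 1) (by omega)

lemma rowInsert_perm (r : List ℕ) (x : ℕ) :
    ((rowInsert r x).2.toList ++ (rowInsert r x).1).Perm (x :: r) := by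
  induction r with
  | nil => simp [rowInsert]
  | cons a r ih =>
    rw [rowInsert]
    split
    · simpa using List.Perm.swap x a r
    · refine (List.perm_middle).trans ?_
      exact (ih.cons a).trans (List.Perm.swap x a r)

lemma rowInsert_ne_nil (r : List ℕ) (x : ℕ) : (rowInsert r x).1 ≠ [] := by
  cases r with
  | nil => simp [rowInsert]
  | cons a r => rw [rowInsert]; split <;> simp

lemma rowInsert_none {r : List ℕ} {x : ℕ} (h : (rowInsert r x).2 = none) :
    (rowInsert r x).1 = r ++ [x] := by
  induction r with
  | nil => simp [rowInsert]
  | cons a r ih =>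
    rw [rowInsert] at h ⊢
    split at h
    · simp at h
    · rename_i hx
      simp [hx, ih h]

lemma rowInsert_append_singleton {r : List ℕ} {x : ℕ} (h : (r ++ [x]).Pairwise (· ≤ ·)) :
    rowInsert r x = (r ++ [x], none) := by
  induction r with
  | nil => simp [rowInsert]
  | cons a r ih =>
    have h' := List.pairwise_cons.1 h
    have : ¬ x < a := not_lt.2 (h'.1 x (by simp))
    simp [rowInsert, this, ih h'.2]

lemma lt_of_rowInsert_some {r : List ℕ} {x y : ℕ} (h : (rowInsert r x).2 = some y) : x < y := by
  induction r with
  | nil => simp [rowInsert] at h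
  | cons a r ih =>
    rw [rowInsert] at h
    split at h
    · simp_all
    · exact ih h

lemma mem_of_rowInsert_some {r : List ℕ} {x y : ℕ} (h : (rowInsert r x).2 = some y) :
    x ∈ (rowInsert r x).1 := by
  induction r with
  | nil => simp [rowInsert] at h
  | cons a r ih =>
    rw [rowInsert] at h ⊢
    split at h
    · simp_all
    · rename_i hx
      simp [hx, ih h]

lemma mem_rowInsert (r : List ℕ) (x : ℕ) : x ∈ (rowInsert r x).1 := by
  rcases h : (rowInsert r x).2 with _ | y
  · simp [rowInsert_none h]
  · exact mem_of_rowInsert_some h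

lemma mem_rowInsert_subset {r : List ℕ} {x z : ℕ} (h : z ∈ (rowInsert r x).1) :
    z = x ∨ z ∈ r := by
  have := (rowInsert_perm r x).subset (List.mem_append_right _ h)
  simpa using this

lemma rowInsert_sorted {r : List ℕ} (hr : r.Pairwise (· ≤ ·)) (x : ℕ) :
    (rowInsert r x).1.Pairwise (· ≤ ·) := by
  induction r with
  | nil => simp [rowInsert]
  | cons a r ih =>
    obtain ⟨h1, h2⟩ := List.pairwise_cons.1 hr
    rw [rowInsert]
    split
    · rename_i hx
      exact List.pairwise_cons.2 ⟨fun b hb => hx.le.trans (h1 b hb), h2⟩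
    · rename_i hx
      refine List.pairwise_cons.2 ⟨fun b hb => ?_, ih h2⟩
      rcases mem_rowInsert_subset hb with rfl | hb
      · omega
      · exact h1 b hb

/-- Insertion only lowers the existing entries of a row. -/
lemma FitsBelow.rowInsert {r s : List ℕ} (h : FitsBelow r s) (x : ℕ) :
    FitsBelow (rowInsert r x).1 s := by
  induction r generalizing s with
  | nil => cases s <;> simp_all
  | cons a r ih => cases s with
    | nil => simp
    | cons b s =>
      rw [_root_.rowInsert]
      split
      · rename_i hx
        exact ⟨hx.trans h.1, h.2⟩
      · exact ⟨h.1, ih h.2⟩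

/-- The bumping route moves weakly to the left, so that columns stay increasing. -/
lemma FitsBelow.rowInsert_bump {r s : List ℕ} (h : FitsBelow r s) {x y : ℕ}
    (hy : (_root_.rowInsert r x).2 = some y) :
    FitsBelow (_root_.rowInsert r x).1 (_root_.rowInsert s y).1 := by
  induction r generalizing s with
  | nil => simp [_root_.rowInsert] at hy
  | cons a r ih =>
    have hlt := lt_of_rowInsert_some hy
    rw [_root_.rowInsert] at hy ⊢
    split at hy
    · rename_i hx
      obtain rfl : a = y := by simpa using hy
      cases s with
      | nil => simp [_root_.rowInsert, hx]
      | cons b s => simp [_root_.rowInsert, hx, h.1, h.2]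
    · rename_i hx
      simp only [hx, if_false]
      cases s with
      | nil => simp [_root_.rowInsert]; omega
      | cons b s =>
        rw [_root_.rowInsert]
        split
        · exact ⟨by omega, h.2.rowInsert x⟩
        · exact ⟨h.1, ih h.2 hy⟩

lemma rowInsert_injective {r r' : List ℕ} {x x' : ℕ} (hr : r.Pairwise (· ≤ ·))
    (hr' : r'.Pairwise (· ≤ ·)) (h : rowInsert r x = rowInsert r' x') : r = r' ∧ x = x' := by
  rcases hy : (rowInsert r x).2 with _ | y
  · have h1 := rowInsert_none hy
    have h2 := rowInsert_none (h ▸ hy)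
    rw [← h, h1] at h2
    simpa using List.append_inj' h2 rfl
  · have hy' : (rowInsert r' x').2 = some y := h ▸ hy
    replace h := congrArg Prod.fst h
    induction r generalizing r' with
    | nil => simp [rowInsert] at hy
    | cons a r ih => cases r' with
      | nil => simp [rowInsert] at hy'
      | cons c r' =>
        obtain ⟨h1, h2⟩ := List.pairwise_cons.1 hr
        obtain ⟨h1', h2'⟩ := List.pairwise_cons.1 hr'
        have hlt := lt_of_rowInsert_some hy
        have hlt' := lt_of_rowInsert_some hy'
        rw [rowInsert] at hy hy'
        simp only [rowInsert] at h
        split at hy <;> split at hy' <;> rename_i hx hx'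
        · simp_all
        · -- the row `r` would contain the entry `x'`, which is less than `y`
          simp only [hx, hx', if_true, if_false, List.cons.injEq] at h
          have := h1 x' (h.2 ▸ mem_rowInsert r' x')
          simp at hy; omega
        · simp only [hx, hx', if_true, if_false, List.cons.injEq] at h
          have := h1' x (h.2 ▸ mem_rowInsert r x)
          simp at hy'; omega
        · simp only [hx, hx', if_false, List.cons.injEq] at h
          obtain ⟨rfl, rfl⟩ := ih h2 h2' hy hy' h.2
          exact ⟨by rw [h.1], rfl⟩

/-- Reverse row insertion: an entry `y` that was inserted into the row `s` can be pushed back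
into the row above. -/
lemma exists_rowInsert_eq {r' s : List ℕ} {y : ℕ} (hr' : r'.Pairwise (· ≤ ·))
    (hs : s.Pairwise (· ≤ ·)) (h : FitsBelow r' (rowInsert s y).1) :
    ∃ r x, r.Pairwise (· ≤ ·) ∧ rowInsert r x = (r', some y) ∧ FitsBelow r s := by
  induction r' generalizing s with
  | nil =>
    obtain ⟨b, u, hu⟩ := List.exists_cons_of_ne_nil (rowInsert_ne_nil s y)
    simp [hu] at h
  | cons a r' ih =>
    obtain ⟨h1, h2⟩ := List.pairwise_cons.1 hr'
    by_cases hex : ∃ z ∈ r', z < y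
    · -- the replaced entry lies further to the right
      obtain ⟨z, hz, hzy⟩ := hex
      have key : FitsBelow r' (rowInsert s.tail y).1 := by
        obtain ⟨c, u, rfl⟩ := List.exists_cons_of_ne_nil (List.ne_nil_of_mem hz)
        have hcy : c < y := by
          rcases List.mem_cons.1 hz with rfl | hz
          · exact hzy
          · exact ((List.pairwise_cons.1 h2).1 z hz).trans_lt hzy
        cases s with
        | nil => simp [rowInsert, hcy]
        | cons b s =>
          rw [rowInsert] at h
          split at h
          · rename_i hyb
            cases s with
            | nil => simp [rowInsert, hcy]
            | cons d s =>
              have hbd := (List.pairwise_cons.1 hs).1 d (by simp)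
              have : y < d := by omega
              simp only [fitsBelow_cons] at h
              simp [rowInsert, this, hcy, h.2.2]
          · exact h.2
      obtain ⟨r, x, hr, hrx, hrs⟩ := ih h2 hs.tail key
      have hxy : x < y := lt_of_rowInsert_some (congrArg Prod.snd hrx)
      have hx : x ∈ r' := by
        have := mem_rowInsert r x
        rwa [hrx] at this
      have hax := h1 x hx
      refine ⟨a :: r, x, List.pairwise_cons.2 ⟨fun b hb => ?_, hr⟩, ?_, ?_⟩
      · have := (rowInsert_perm r x).symm.subset (List.mem_cons_of_mem _ hb)
        rw [hrx] at this
        simp only [Option.toList_some, List.cons_append, List.nil_append, List.mem_cons] at this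
        rcases this with rfl | hb
        · omega
        · exact h1 b hb
      · simp [rowInsert, not_lt.2 hax, hrx]
      · cases s with
        | nil => simp
        | cons b s =>
          refine ⟨?_, hrs⟩
          rw [rowInsert] at h
          split at h
          · exact lt_trans h.1 ‹_›
          · exact h.1
    · push Not at hex
      have hay : a < y := by
        obtain ⟨z, hz, hzy⟩ := h.exists_lt (mem_rowInsert s y)
        rcases List.mem_cons.1 hz with rfl | hz
        · exact hzy
        · exact absurd (hex z hz) (by omega)
      refine ⟨y :: r', a, List.pairwise_cons.2 ⟨hex, h2⟩, by simp [rowInsert, hay], ?_⟩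
      cases s with
      | nil => simp
      | cons b s =>
        rw [rowInsert] at h
        split at h
        · exact ⟨‹_›, h.2⟩
        · obtain ⟨z, hz, hzy⟩ := h.2.exists_lt (mem_rowInsert s y)
          exact absurd (hex z hz) (by omega)

/-! ### Insertion into tableaux -/

/-- The list of rows of a semistandard tableau: no row is empty, rows increase weakly, and columns
increase strictly. An empty row stands for the one below the last row, and it fits below every
row. -/
def IsTableau : List (List ℕ) → Prop
  | [] => True
  | r :: rs => r ≠ [] ∧ r.Pairwise (· ≤ ·) ∧ FitsBelow r (rs.headD []) ∧ IsTableau rs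

lemma tableauInsert_cons_none {r : List ℕ} {x : ℕ} (rs : List (List ℕ))
    (h : (rowInsert r x).2 = none) :
    tableauInsert (r :: rs) x = ((rowInsert r x).1 :: rs, 0) := by
  rcases hr : rowInsert r x with ⟨r', _ | y⟩
  · simp [tableauInsert, hr]
  · simp [hr] at h

lemma tableauInsert_cons_some {r : List ℕ} {x y : ℕ} (rs : List (List ℕ))
    (h : (rowInsert r x).2 = some y) :
    tableauInsert (r :: rs) x =
      ((rowInsert r x).1 :: (tableauInsert rs y).1, (tableauInsert rs y).2 + 1) := by
  rcases hr : rowInsert r x with ⟨r', _ | z⟩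
  · simp [hr] at h
  · obtain rfl : z = y := by simpa [hr] using h
    simp [tableauInsert, hr]

lemma headD_tableauInsert (t : List (List ℕ)) (x : ℕ) :
    (tableauInsert t x).1.headD [] = (rowInsert (t.headD []) x).1 := by
  cases t with
  | nil => simp [tableauInsert, rowInsert]
  | cons r rs =>
    rcases h : (rowInsert r x).2 with _ | y
    · simp [tableauInsert_cons_none rs h]
    · simp [tableauInsert_cons_some rs h]

lemma IsTableau.headD_sorted {t : List (List ℕ)} (h : IsTableau t) :
    (t.headD []).Pairwise (· ≤ ·) := by
  cases t with
  | nil => simp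
  | cons r rs => exact h.2.1

lemma IsTableau.tableauInsert {t : List (List ℕ)} (h : IsTableau t) (x : ℕ) :
    IsTableau (tableauInsert t x).1 := by
  induction t generalizing x with
  | nil => simp [_root_.tableauInsert, IsTableau]
  | cons r rs ih =>
    obtain ⟨h1, h2, h3, h4⟩ := h
    rcases hy : (rowInsert r x).2 with _ | y
    · rw [tableauInsert_cons_none rs hy]
      exact ⟨rowInsert_ne_nil r x, rowInsert_sorted h2 x, h3.rowInsert x, h4⟩
    · rw [tableauInsert_cons_some rs hy]
      refine ⟨rowInsert_ne_nil r x, rowInsert_sorted h2 x, ?_, ih h4 y⟩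
      rw [headD_tableauInsert]
      exact h3.rowInsert_bump hy

lemma tableauInsert_flatten_perm (t : List (List ℕ)) (x : ℕ) :
    (tableauInsert t x).1.flatten.Perm (x :: t.flatten) := by
  induction t generalizing x with
  | nil => simp [tableauInsert]
  | cons r rs ih =>
    have hp := rowInsert_perm r x
    rcases hy : (rowInsert r x).2 with _ | y
    · rw [tableauInsert_cons_none rs hy]
      simp only [hy, Option.toList_none, List.nil_append] at hp
      simpa using hp.append_right rs.flatten
    · rw [tableauInsert_cons_some rs hy]
      simp only [hy, Option.toList_some, List.cons_append, List.nil_append] at hp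
      simp only [List.flatten_cons]
      refine ((ih y).append_left _).trans ?_
      refine List.perm_middle.trans ?_
      simpa using hp.append_right rs.flatten

lemma length_getD_tableauInsert (t : List (List ℕ)) (x i : ℕ) :
    ((tableauInsert t x).1.getD i []).length =
      (t.getD i []).length + if i = (tableauInsert t x).2 then 1 else 0 := by
  induction t generalizing x i with
  | nil => cases i <;> simp [tableauInsert]
  | cons r rs ih =>
    have hp := (rowInsert_perm r x).length_eq
    rcases hy : (rowInsert r x).2 with _ | y
    · rw [tableauInsert_cons_none rs hy]
      cases i <;> simp_all
    · rw [tableauInsert_cons_some rs hy]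
      cases i with
      | zero => simp_all
      | succ i => simpa using ih y i

lemma length_getD_appendToRow (t : List (List ℕ)) (x i k : ℕ) (hk : k ≤ t.length) :
    ((appendToRow t k x).getD i []).length =
      (t.getD i []).length + if i = k then 1 else 0 := by
  induction t generalizing k i with
  | nil =>
    obtain rfl : k = 0 := by simpa using hk
    cases i <;> simp [appendToRow]
  | cons r rs ih =>
    cases k with
    | zero => cases i <;> simp [appendToRow]
    | succ k => cases i with
      | zero => simp [appendToRow]
      | succ i => simpa [appendToRow] using ih i k (by simpa using hk)

lemma tableauInsert_snd_le (t : List (List ℕ)) (x : ℕ) : (tableauInsert t x).2 ≤ t.length := by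
  induction t generalizing x with
  | nil => simp [tableauInsert]
  | cons r rs ih =>
    rcases hy : (rowInsert r x).2 with _ | y
    · simp [tableauInsert_cons_none rs hy]
    · simpa [tableauInsert_cons_some rs hy] using ih y

lemma tableauInsert_injective {t t' : List (List ℕ)} {x x' : ℕ} (ht : IsTableau t)
    (ht' : IsTableau t') (h : tableauInsert t x = tableauInsert t' x') : t = t' ∧ x = x' := by
  have hnil : ∀ {r : List ℕ} {rs : List (List ℕ)} {x x' : ℕ}, r ≠ [] →
      tableauInsert [] x ≠ tableauInsert (r :: rs) x' := by
    intro r rs x x' hr h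
    rcases hy : (rowInsert r x').2 with _ | y
    · rw [tableauInsert_cons_none rs hy, rowInsert_none hy] at h
      cases r <;> simp_all [tableauInsert]
    · rw [tableauInsert_cons_some rs hy] at h
      simp [tableauInsert] at h
  induction t generalizing t' x x' with
  | nil => cases t' with
    | nil => simpa [tableauInsert] using h
    | cons r' rs' => exact absurd h (hnil ht'.1)
  | cons r rs ih => cases t' with
    | nil => exact absurd h.symm (hnil ht.1)
    | cons r' rs' =>
      rcases hy : (rowInsert r x).2 with _ | y <;> rcases hy' : (rowInsert r' x').2 with _ | y'
      · rw [tableauInsert_cons_none rs hy, tableauInsert_cons_none rs' hy'] at h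
        simp only [Prod.mk.injEq, List.cons.injEq, and_true] at h
        obtain ⟨rfl, rfl⟩ := rowInsert_injective ht.2.1 ht'.2.1 (Prod.ext h.1 (hy.trans hy'.symm))
        exact ⟨by rw [h.2], rfl⟩
      · rw [tableauInsert_cons_none rs hy, tableauInsert_cons_some rs' hy'] at h
        simp at h
      · rw [tableauInsert_cons_some rs hy, tableauInsert_cons_none rs' hy'] at h
        simp at h
      · rw [tableauInsert_cons_some rs hy, tableauInsert_cons_some rs' hy'] at h
        simp only [Prod.mk.injEq, List.cons.injEq, Nat.add_right_cancel_iff] at h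
        obtain ⟨rfl, rfl⟩ := ih ht.2.2.2 ht'.2.2.2 (Prod.ext h.1.2 h.2)
        obtain ⟨rfl, rfl⟩ :=
          rowInsert_injective ht.2.1 ht'.2.1 (Prod.ext h.1.1 (hy.trans hy'.symm))
        exact ⟨rfl, rfl⟩

/-- Reverse insertion, starting from the end of a row which is longer than the next one. -/
lemma exists_tableauInsert_eq {t' : List (List ℕ)} (ht' : IsTableau t') {i : ℕ}
    (hi : (t'.getD (i + 1) []).length < (t'.getD i []).length) :
    ∃ t x, IsTableau t ∧ tableauInsert t x = (t', i) := by
  induction t' generalizing i with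
  | nil => simp at hi
  | cons r' rs' ih =>
    obtain ⟨h1, h2, h3, h4⟩ := ht'
    cases i with
    | zero =>
      obtain ⟨r, x, rfl⟩ : ∃ r x, r' = r ++ [x] :=
        ⟨_, _, (List.dropLast_append_getLast h1).symm⟩
      have hlen : (rs'.headD []).length ≤ r.length := by
        cases rs' <;> simp_all
      by_cases hr : r = []
      · subst hr
        refine ⟨[], x, trivial, ?_⟩
        cases rs' with
        | nil => simp [tableauInsert]
        | cons s rs' => exact absurd (by simpa using hlen) h4.1
      · refine ⟨r :: rs', x, ⟨hr, (List.pairwise_append.1 h2).1, h3.of_append hlen, h4⟩, ?_⟩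
        have := rowInsert_append_singleton h2
        rw [tableauInsert_cons_none rs' (by rw [this]), this]
    | succ i =>
      obtain ⟨rs, y, hrs, hy⟩ := ih h4 (by simpa using hi)
      have hh := headD_tableauInsert rs y
      rw [hy] at hh
      obtain ⟨r, x, hr, hrx, hf⟩ := exists_rowInsert_eq h2 hrs.headD_sorted (hh ▸ h3)
      refine ⟨r :: rs, x, ⟨?_, hr, hf, hrs⟩, ?_⟩
      · rintro rfl
        simp [rowInsert] at hrx
      · rw [tableauInsert_cons_some rs (by rw [hrx]), hy, hrx]

/-! ### Young diagrams with one box added -/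

lemma YoungDiagram.ext_rowLen {mu nu : YoungDiagram} (h : ∀ i, mu.rowLen i = nu.rowLen i) :
    mu = nu := by
  ext ⟨i, j⟩
  rw [mem_cells, mem_cells, mem_iff_lt_rowLen, mem_iff_lt_rowLen, h]

/-- Adding one to one row length is the same as adding one cell. -/
lemma addsBox_iff {nu lam : YoungDiagram} :
    AddsBox nu lam ↔ ∃ c, c ∉ nu ∧ lam.cells = insert c nu.cells := by
  constructor
  · rintro ⟨r, hr⟩
    refine ⟨(r, nu.rowLen r), by simp [YoungDiagram.mem_iff_lt_rowLen], ?_⟩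
    ext ⟨i, j⟩
    have := hr i
    simp only [YoungDiagram.mem_cells, Finset.mem_insert, Prod.mk.injEq,
      YoungDiagram.mem_iff_lt_rowLen, hr i]
    split_ifs with h
    · subst h; omega
    · simp [h]
  · rintro ⟨⟨r, s⟩, hc, h⟩
    refine ⟨r, fun i => ?_⟩
    rw [YoungDiagram.rowLen_eq_card, YoungDiagram.rowLen_eq_card, YoungDiagram.row,
      YoungDiagram.row, h, Finset.filter_insert]
    split_ifs with h1 h2 h2
    · rw [Finset.card_insert_of_notMem]
      simp [hc]
    · exact absurd h1.symm h2
    · exact absurd h2.symm h1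
    · rfl

lemma AddsBox.card_eq {nu lam : YoungDiagram} (h : AddsBox nu lam) : lam.card = nu.card + 1 := by
  obtain ⟨c, hc, h⟩ := addsBox_iff.1 h
  rw [YoungDiagram.card, h, Finset.card_insert_of_notMem (by simpa using hc)]

lemma AddsBox.ne {nu lam : YoungDiagram} (h : AddsBox nu lam) : lam ≠ nu := by
  rintro rfl
  have := h.card_eq
  omega

/-! ### Adding and removing the largest entry of a standard tableau -/

lemma IsStandardTableau.le_card {lam : YoungDiagram} {T : Filling} (h : IsStandardTableau lam T)
    (i j : ℕ) : T i j ≤ lam.card := by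
  by_cases hc : (i, j) ∈ lam
  · exact (h.bijOn.mapsTo (show (i, j) ∈ (lam.cells : Set (ℕ × ℕ)) by simpa using hc)).2
  · simp [h.zeros i j hc]

lemma Filling.addLabel_of_mem {lam mu : YoungDiagram} {a i j : ℕ} {T : Filling}
    (h : (i, j) ∈ lam) : T.addLabel lam mu a i j = T i j := by
  simp [addLabel, h]

/-- A cell belongs to the smaller diagram exactly when its label is not the new one. -/
lemma IsStandardTableau.addLabel_le_card_iff {lam mu : YoungDiagram} {T : Filling}
    (h : IsStandardTableau lam T) {i j : ℕ} (hc : (i, j) ∈ mu) :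
    T.addLabel lam mu (lam.card + 1) i j ≤ lam.card ↔ (i, j) ∈ lam := by
  by_cases h' : (i, j) ∈ lam <;> simp [Filling.addLabel, hc, h', h.le_card]

lemma IsStandardTableau.addLabel {lam mu : YoungDiagram} {T : Filling}
    (h : IsStandardTableau lam T) (hb : AddsBox lam mu) :
    IsStandardTableau mu (T.addLabel lam mu (lam.card + 1)) := by
  obtain ⟨c, hc, hcells⟩ := addsBox_iff.1 hb
  have hmem : ∀ d, d ∈ mu ↔ d = c ∨ d ∈ lam := fun d => by
    rw [← YoungDiagram.mem_cells, hcells]; simp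
  have hnew : ∀ d : ℕ × ℕ, d = c → T.addLabel lam mu (lam.card + 1) d.1 d.2 = lam.card + 1 := by
    rintro d rfl
    simp [Filling.addLabel, hmem, hc]
  have hold : ∀ d : ℕ × ℕ, d ≠ c → T.addLabel lam mu (lam.card + 1) d.1 d.2 = T d.1 d.2 := by
    rintro ⟨i, j⟩ hd
    simp only [Filling.addLabel, hmem]
    split_ifs with h'
    · tauto
    · rfl
  -- a cell strictly above or to the left of a cell of `mu` lies in `lam`
  have hlt : ∀ d e : ℕ × ℕ, d ≤ e → d ≠ e → e ∈ mu → d ≠ c := by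
    rintro d e hde hne he rfl
    rcases (hmem e).1 he with rfl | he
    · exact hne rfl
    · exact hc (lam.isLowerSet hde he)
  have hstrict : ∀ d e : ℕ × ℕ, d ≤ e → d ≠ e → e ∈ mu →
      (e ∈ lam → T d.1 d.2 < T e.1 e.2) →
      T.addLabel lam mu (lam.card + 1) d.1 d.2 < T.addLabel lam mu (lam.card + 1) e.1 e.2 := by
    intro d e hde hne he hT
    rw [hold d (hlt d e hde hne he)]
    by_cases hec : e = c
    · rw [hnew e hec]
      exact Nat.lt_succ_of_le (h.le_card _ _)
    · rw [hold e hec]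
      exact hT (((hmem e).1 he).resolve_left hec)
  refine ⟨fun i j hij => ?_, ?_, fun i j₁ j₂ hj hm => ?_, fun i₁ i₂ j hi hm => ?_⟩
  · have : (i, j) ∉ lam := fun h' => hij ((hmem _).2 (Or.inr h'))
    simp [Filling.addLabel, hij, h.zeros i j this]
  · have h1 : Set.BijOn (fun d : ℕ × ℕ => T.addLabel lam mu (lam.card + 1) d.1 d.2) lam.cells
        (Set.Icc 1 lam.card) :=
      h.bijOn.congr fun d hd => (hold d fun h' => hc (by simpa [h'] using hd)).symm
    have h2 := h1.insert (a := c) (by rw [hnew c rfl]; simp)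
    rw [hnew c rfl] at h2
    have e1 : (mu.cells : Set (ℕ × ℕ)) = insert c (lam.cells : Set (ℕ × ℕ)) := by
      rw [hcells]; simp
    have e2 : Set.Icc 1 mu.card = insert (lam.card + 1) (Set.Icc 1 lam.card) := by
      rw [hb.card_eq]; ext x; simp only [Set.mem_Icc, Set.mem_insert_iff]; omega
    rw [e1, e2]; exact h2
  · exact hstrict (i, j₁) (i, j₂) ⟨le_rfl, hj.le⟩ (by simp [hj.ne]) hm (h.row_strict i j₁ j₂ hj)
  · exact hstrict (i₁, j) (i₂, j) ⟨hi.le, le_rfl⟩ (by simp [hi.ne]) hm (h.col_strict i₁ i₂ j hi)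

/-- The new label marks the added box, so that the smaller diagram and its tableau can be
recovered. -/
lemma addLabel_injective {lam lam' mu : YoungDiagram} {T T' : Filling}
    (h : IsStandardTableau lam T) (h' : IsStandardTableau lam' T') (hb : AddsBox lam mu)
    (hb' : AddsBox lam' mu)
    (he : T.addLabel lam mu (lam.card + 1) = T'.addLabel lam' mu (lam'.card + 1)) :
    lam = lam' ∧ T = T' := by
  have hcard : lam.card = lam'.card := by have := hb.card_eq; have := hb'.card_eq; omega
  have hsub : ∀ {nu c}, AddsBox nu mu → c ∈ nu → c ∈ mu := fun hb hc => by
    obtain ⟨d, -, hd⟩ := addsBox_iff.1 hb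
    rw [← YoungDiagram.mem_cells, hd]; simp [hc]
  have hlam : lam = lam' := by
    ext ⟨i, j⟩
    simp only [YoungDiagram.mem_cells]
    constructor <;> intro hc
    · rw [← h'.addLabel_le_card_iff (hsub hb hc), ← he, ← hcard,
        h.addLabel_le_card_iff (hsub hb hc)]
      exact hc
    · rw [← h.addLabel_le_card_iff (hsub hb' hc), he, hcard,
        h'.addLabel_le_card_iff (hsub hb' hc)]
      exact hc
  subst hlam
  refine ⟨rfl, ?_⟩
  ext i j
  by_cases hc : (i, j) ∈ lam
  · rw [← Filling.addLabel_of_mem (T := T) (mu := mu) (a := lam.card + 1) hc, he,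
      Filling.addLabel_of_mem hc]
  · rw [h.zeros i j hc, h'.zeros i j hc]

/-- Removal of the box with the largest label. -/
lemma IsStandardTableau.exists_addLabel {mu : YoungDiagram} {T : Filling}
    (h : IsStandardTableau mu T) (hpos : 0 < mu.card) :
    ∃ lam T', AddsBox lam mu ∧ IsStandardTableau lam T' ∧
      T = Filling.addLabel lam mu (lam.card + 1) T' := by
  obtain ⟨c, hc, hcT⟩ := h.bijOn.surjOn (show mu.card ∈ Set.Icc 1 mu.card from ⟨hpos, le_rfl⟩)
  simp only [Finset.mem_coe, YoungDiagram.mem_cells] at hc hcT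
  have hmax : ∀ d ∈ mu, c ≤ d → d = c := by
    rintro ⟨i, j⟩ hd hle
    obtain ⟨k, l⟩ := c
    have hle' : k ≤ i ∧ l ≤ j := hle
    have h1 : T k l ≤ T k j := by
      rcases hle'.2.eq_or_lt with rfl | hl
      · rfl
      · exact (h.row_strict k l j hl (mu.up_left_mem hle'.1 le_rfl hd)).le
    have h2 : T k j ≤ T i j := by
      rcases hle'.1.eq_or_lt with rfl | hl
      · rfl
      · exact (h.col_strict k i j hl hd).le
    have h3 := h.le_card i j
    refine h.bijOn.injOn (by simpa using hd) (by simpa using hc) ?_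
    simp only at hcT ⊢
    omega
  let lam : YoungDiagram := ⟨mu.cells.erase c, by
    intro d e hed hd
    simp only [Finset.coe_erase, Set.mem_sdiff, Finset.mem_coe, YoungDiagram.mem_cells,
      Set.mem_singleton_iff] at hd ⊢
    refine ⟨mu.isLowerSet hed hd.1, ?_⟩
    rintro rfl
    exact hd.2 (hmax d hd.1 hed)⟩
  have hmem : ∀ d, d ∈ lam ↔ d ≠ c ∧ d ∈ mu := fun d => by
    rw [← YoungDiagram.mem_cells]; simp [lam]
  have hb : AddsBox lam mu := addsBox_iff.2 ⟨c, by simp [hmem],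
    (Finset.insert_erase (by simpa using hc)).symm⟩
  have hT' : ∀ d ∈ lam, (fun i j => if (i, j) ∈ lam then T i j else 0 : Filling) d.1 d.2 =
      T d.1 d.2 := fun d hd => by simp [hd]
  refine ⟨lam, fun i j => if (i, j) ∈ lam then T i j else 0, hb, ⟨?_, ?_, ?_, ?_⟩, ?_⟩
  · intro i j hij
    simp [hij]
  · have h1 := h.bijOn.sdiff_singleton (a := c) (by simpa using hc)
    have e1 : (mu.cells : Set (ℕ × ℕ)) \ {c} = lam.cells := by simp [lam]
    have e2 : Set.Icc 1 mu.card \ {T c.1 c.2} = Set.Icc 1 lam.card := by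
      rw [hcT, hb.card_eq]
      ext x
      simp only [Set.mem_sdiff, Set.mem_Icc, Set.mem_singleton_iff]
      omega
    rw [e1, e2] at h1
    exact h1.congr fun d hd => (hT' d (by simpa using hd)).symm
  · intro i j₁ j₂ hj hm
    have hm' := lam.up_left_mem le_rfl hj.le hm
    simpa [hm, hm'] using h.row_strict i j₁ j₂ hj ((hmem _).1 hm).2
  · intro i₁ i₂ j hi hm
    have hm' := lam.up_left_mem hi.le le_rfl hm
    simpa [hm, hm'] using h.col_strict i₁ i₂ j hi ((hmem _).1 hm).2
  · ext i j
    simp only [Filling.addLabel]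
    by_cases hij : (i, j) = c
    · have h1 : (i, j) ∉ lam := by simp [hmem, hij]
      have h2 : (i, j) ∈ mu := hij ▸ hc
      simp only [h1, h2, not_false_eq_true, and_self, if_true]
      rw [← hb.card_eq, ← hcT, ← hij]
    · by_cases hm : (i, j) ∈ mu
      · have h1 : (i, j) ∈ lam := (hmem _).2 ⟨hij, hm⟩
        simp [h1]
      · simp [hm, h.zeros i j hm, hmem]

/-! ### Lists of rows and fillings -/

lemma IsTableau.of_mem {t : List (List ℕ)} (h : IsTableau t) {r : List ℕ} (hr : r ∈ t) :
    r ≠ [] ∧ r.Pairwise (· ≤ ·) := by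
  induction t with
  | nil => simp at hr
  | cons s t ih =>
    rcases List.mem_cons.1 hr with rfl | hr
    · exact ⟨h.1, h.2.1⟩
    · exact ih h.2.2.2 hr

lemma IsTableau.fitsBelow {t : List (List ℕ)} (h : IsTableau t) (i : ℕ) :
    FitsBelow (t.getD i []) (t.getD (i + 1) []) := by
  induction t generalizing i with
  | nil => simp
  | cons s t ih =>
    cases i with
    | zero =>
      have := h.2.2.1
      cases t <;> simp_all
    | succ i => simpa using ih h.2.2.2 i

lemma isTableau_of_getD {t : List (List ℕ)} (h1 : ∀ r ∈ t, r ≠ [] ∧ r.Pairwise (· ≤ ·))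
    (h2 : ∀ i, FitsBelow (t.getD i []) (t.getD (i + 1) [])) : IsTableau t := by
  induction t with
  | nil => trivial
  | cons s t ih =>
    refine ⟨(h1 s (by simp)).1, (h1 s (by simp)).2, ?_,
      ih (fun r hr => h1 r (by simp [hr])) fun i => by simpa using h2 (i + 1)⟩
    have := h2 0
    cases t <;> simp_all

lemma IsTableau.sortedGE {t : List (List ℕ)} (h : IsTableau t) :
    (t.map List.length).SortedGE := by
  rw [List.sortedGE_iff_isChain]
  induction t with
  | nil => simp
  | cons s t ih =>
    have h3 := h.2.2.1.length_le
    have := ih h.2.2.2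
    cases t <;> simp_all

lemma IsTableau.mem_shapeOfRows {t : List (List ℕ)} (h : IsTableau t) {i j : ℕ} :
    (i, j) ∈ shapeOfRows t ↔ j < (t.getD i []).length := by
  rw [shapeOfRows, dif_pos h.sortedGE, YoungDiagram.mem_ofRowLens]
  by_cases hi : i < t.length <;> simp [hi]

lemma IsTableau.rowLen_shapeOfRows {t : List (List ℕ)} (h : IsTableau t) (i : ℕ) :
    (shapeOfRows t).rowLen i = (t.getD i []).length :=
  eq_of_forall_lt_iff fun j => by rw [← YoungDiagram.mem_iff_lt_rowLen, h.mem_shapeOfRows]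

lemma IsTableau.length_eq {t : List (List ℕ)} (h : IsTableau t) :
    t.length = (shapeOfRows t).colLen 0 := by
  refine eq_of_forall_lt_iff fun i => ?_
  rw [← YoungDiagram.mem_iff_lt_colLen, h.mem_shapeOfRows]
  by_cases hi : i < t.length
  · have := (h.of_mem (List.getElem_mem hi)).1
    simpa [hi, List.length_pos_iff] using this
  · simp [hi]

/-- The cells of a Young diagram, row by row. -/
def cellList (lam : YoungDiagram) : List (ℕ × ℕ) :=
  ((List.range (lam.colLen 0)).map fun i => (List.range (lam.rowLen i)).map (Prod.mk i)).flatten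

lemma mem_cellList {lam : YoungDiagram} {c : ℕ × ℕ} : c ∈ cellList lam ↔ c ∈ lam := by
  obtain ⟨i, j⟩ := c
  simp only [cellList, List.mem_flatten, List.mem_map, List.mem_range, exists_exists_and_eq_and,
    Prod.mk.injEq]
  constructor
  · rintro ⟨a, -, b, hb, rfl, rfl⟩
    exact YoungDiagram.mem_iff_lt_rowLen.2 hb
  · intro h
    exact ⟨i, YoungDiagram.mem_iff_lt_colLen.1 (lam.up_left_mem le_rfl (Nat.zero_le j) h), j,
      YoungDiagram.mem_iff_lt_rowLen.1 h, rfl, rfl⟩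

lemma nodup_cellList (lam : YoungDiagram) : (cellList lam).Nodup := by
  rw [cellList, List.nodup_flatten]
  constructor
  · intro l hl
    obtain ⟨i, -, rfl⟩ := List.mem_map.1 hl
    exact List.nodup_range.map (Prod.mk_right_injective i)
  · rw [List.pairwise_map]
    refine List.nodup_range.imp fun {a b} hab => ?_
    rw [List.disjoint_left]
    intro c hc hc'
    obtain ⟨x, -, rfl⟩ := List.mem_map.1 hc
    obtain ⟨y, -, h⟩ := List.mem_map.1 hc'
    exact hab (congrArg Prod.fst h).symm

lemma length_cellList (lam : YoungDiagram) : (cellList lam).length = lam.card := by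
  have : (cellList lam).toFinset = lam.cells := by ext; simp [mem_cellList]
  rw [YoungDiagram.card, ← this, List.toFinset_card_of_nodup (nodup_cellList lam)]

/-- The rows of a filling of a Young diagram. -/
def rowsOfFilling (lam : YoungDiagram) (T : Filling) : List (List ℕ) :=
  (List.range (lam.colLen 0)).map fun i => (List.range (lam.rowLen i)).map (T i)

lemma flatten_rowsOfFilling (lam : YoungDiagram) (T : Filling) :
    (rowsOfFilling lam T).flatten = (cellList lam).map fun c => T c.1 c.2 := by
  simp [rowsOfFilling, cellList, List.map_flatten, Function.comp_def]

lemma getD_rowsOfFilling (lam : YoungDiagram) (T : Filling) (i : ℕ) :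
    (rowsOfFilling lam T).getD i [] = (List.range (lam.rowLen i)).map (T i) := by
  by_cases hi : i < lam.colLen 0
  · simp [rowsOfFilling, hi]
  · have : lam.rowLen i = 0 := by
      by_contra h
      exact hi (YoungDiagram.mem_iff_lt_colLen.1
        (YoungDiagram.mem_iff_lt_rowLen.2 (Nat.pos_of_ne_zero h)))
    simp [rowsOfFilling, hi, this]

lemma isTableau_rowsOfFilling {lam : YoungDiagram} {T : Filling}
    (hrow : ∀ i j₁ j₂, j₁ < j₂ → (i, j₂) ∈ lam → T i j₁ ≤ T i j₂)
    (hcol : ∀ i₁ i₂ j, i₁ < i₂ → (i₂, j) ∈ lam → T i₁ j < T i₂ j) :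
    IsTableau (rowsOfFilling lam T) := by
  refine isTableau_of_getD (fun r hr => ?_) fun i => ?_
  · obtain ⟨i, hi, rfl⟩ := List.mem_map.1 hr
    have h0 : 0 < lam.rowLen i := YoungDiagram.mem_iff_lt_rowLen.1
      (YoungDiagram.mem_iff_lt_colLen.2 (List.mem_range.1 hi))
    refine ⟨by simpa using h0.ne', ?_⟩
    rw [List.pairwise_map]
    refine List.pairwise_lt_range.imp_of_mem fun {a b} _ hb hab => ?_
    exact hrow i a b hab (YoungDiagram.mem_iff_lt_rowLen.2 (List.mem_range.1 hb))
  · have hle := lam.rowLen_anti i (i + 1) (Nat.le_succ i)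
    rw [getD_rowsOfFilling, getD_rowsOfFilling, fitsBelow_iff]
    simp only [List.length_map, List.length_range]
    refine ⟨hle, fun j hj => ?_⟩
    simpa [hj, hj.trans_le hle] using
      hcol i (i + 1) j (Nat.lt_succ_self i) (YoungDiagram.mem_iff_lt_rowLen.2 hj)

lemma shapeOfRows_rowsOfFilling {lam : YoungDiagram} {T : Filling}
    (h : IsTableau (rowsOfFilling lam T)) : shapeOfRows (rowsOfFilling lam T) = lam :=
  YoungDiagram.ext_rowLen fun i => by rw [h.rowLen_shapeOfRows, getD_rowsOfFilling]; simp

lemma fillingOfRows_rowsOfFilling {lam : YoungDiagram} {T : Filling}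
    (hT : ∀ i j, (i, j) ∉ lam → T i j = 0) : fillingOfRows (rowsOfFilling lam T) = T := by
  ext i j
  rw [fillingOfRows, getD_rowsOfFilling]
  by_cases hj : j < lam.rowLen i
  · simp [hj]
  · simp [hj, hT i j fun h => hj (YoungDiagram.mem_iff_lt_rowLen.1 h)]

lemma IsTableau.rowsOfFilling_eq {t : List (List ℕ)} (h : IsTableau t) :
    rowsOfFilling (shapeOfRows t) (fillingOfRows t) = t := by
  apply List.ext_getElem
  · simp [rowsOfFilling, h.length_eq]
  · intro i h1 h2
    have : (rowsOfFilling (shapeOfRows t) (fillingOfRows t)).getD i [] = t.getD i [] := by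
      rw [getD_rowsOfFilling, h.rowLen_shapeOfRows]
      apply List.ext_getElem
      · simp
      · intro j h3 h4
        simp only [List.getElem_map, List.getElem_range, fillingOfRows]
        rw [List.getD_eq_getElem _ _ h4]
    rwa [List.getD_eq_getElem _ _ h1, List.getD_eq_getElem _ _ h2] at this

lemma IsTableau.fillingOfRows_eq_zero {t : List (List ℕ)} (h : IsTableau t) {i j : ℕ}
    (hc : (i, j) ∉ shapeOfRows t) : fillingOfRows t i j = 0 := by
  rw [h.mem_shapeOfRows] at hc
  rw [fillingOfRows, List.getD_eq_default _ _ (by omega)]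

lemma IsTableau.flatten_eq {t : List (List ℕ)} (h : IsTableau t) :
    t.flatten = (cellList (shapeOfRows t)).map fun c => fillingOfRows t c.1 c.2 := by
  conv_lhs => rw [← h.rowsOfFilling_eq]
  rw [flatten_rowsOfFilling]

lemma IsTableau.card_shapeOfRows {t : List (List ℕ)} (h : IsTableau t) :
    (shapeOfRows t).card = t.flatten.length := by
  rw [h.flatten_eq, List.length_map, length_cellList]

lemma IsTableau.row_strict {t : List (List ℕ)} (h : IsTableau t) (hn : t.flatten.Nodup)
    (i j₁ j₂ : ℕ) (hj : j₁ < j₂) (hm : (i, j₂) ∈ shapeOfRows t) :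
    fillingOfRows t i j₁ < fillingOfRows t i j₂ := by
  rw [h.mem_shapeOfRows] at hm
  have hi : i < t.length := by
    by_contra hi
    simp [hi] at hm
  rw [List.getD_eq_getElem _ _ hi] at hm
  rw [fillingOfRows, fillingOfRows, List.getD_eq_getElem _ _ hi,
    List.getD_eq_getElem _ _ (hj.trans hm), List.getD_eq_getElem _ _ hm]
  refine lt_of_le_of_ne
    (List.pairwise_iff_getElem.1 (h.of_mem (List.getElem_mem hi)).2 _ _ _ _ hj) fun he => ?_
  have hnd := (List.nodup_flatten.1 hn).1 _ (List.getElem_mem hi)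
  exact hj.ne ((hnd.getElem_inj_iff).1 he)

lemma IsTableau.col_strict {t : List (List ℕ)} (h : IsTableau t) (i₁ i₂ j : ℕ) (hi : i₁ < i₂)
    (hm : (i₂, j) ∈ shapeOfRows t) : fillingOfRows t i₁ j < fillingOfRows t i₂ j := by
  induction i₂, hi using Nat.le_induction with
  | base =>
    rw [h.mem_shapeOfRows] at hm
    exact (fitsBelow_iff.1 (h.fitsBelow i₁)).2 j hm
  | succ i₂ hi ih =>
    refine (ih ((shapeOfRows t).up_left_mem (Nat.le_succ i₂) le_rfl hm)).trans ?_
    rw [h.mem_shapeOfRows] at hm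
    exact (fitsBelow_iff.1 (h.fitsBelow i₂)).2 j hm

/-- The entries are `1, …, |lam|`, each of them once, in terms of lists. -/
lemma bijOn_cells_iff {lam : YoungDiagram} {T : Filling} :
    Set.BijOn (fun c : ℕ × ℕ => T c.1 c.2) lam.cells (Set.Icc 1 lam.card) ↔
      ((cellList lam).map fun c => T c.1 c.2).Perm (List.range' 1 lam.card) := by
  constructor
  · intro h
    refine (List.perm_ext_iff_of_nodup ?_ List.nodup_range').2 fun a => ?_
    · exact (nodup_cellList lam).map_on fun x hx y hy hxy =>
        h.injOn (by simpa [mem_cellList] using hx) (by simpa [mem_cellList] using hy) hxy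
    · have := Set.ext_iff.1 h.image_eq a
      simp only [List.mem_map, mem_cellList, List.mem_range'_1]
      simp only [Set.mem_image, Finset.mem_coe, YoungDiagram.mem_cells, Set.mem_Icc] at this
      rw [this]; omega
  · intro h
    have hmem : ∀ a, (∃ c ∈ lam, T c.1 c.2 = a) ↔ a ∈ Set.Icc 1 lam.card := fun a => by
      have := h.mem_iff (a := a)
      simp only [List.mem_map, mem_cellList, List.mem_range'_1] at this
      rw [this, Set.mem_Icc]; omega
    refine ⟨fun c hc => (hmem _).1 ⟨c, by simpa using hc, rfl⟩, fun x hx y hy hxy => ?_,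
      fun a ha => ?_⟩
    · exact List.inj_on_of_nodup_map (h.nodup_iff.2 List.nodup_range')
        (by simpa [mem_cellList] using hx) (by simpa [mem_cellList] using hy) hxy
    · obtain ⟨c, hc, rfl⟩ := (hmem a).2 ha
      exact ⟨c, by simpa using hc, rfl⟩

lemma IsStandardTableau.isTableau {lam : YoungDiagram} {T : Filling}
    (h : IsStandardTableau lam T) : IsTableau (rowsOfFilling lam T) :=
  isTableau_rowsOfFilling (fun i j₁ j₂ hj hm => (h.row_strict i j₁ j₂ hj hm).le) h.col_strict

lemma IsStandardTableau.flatten_perm {lam : YoungDiagram} {T : Filling}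
    (h : IsStandardTableau lam T) :
    (rowsOfFilling lam T).flatten.Perm (List.range' 1 lam.card) := by
  rw [flatten_rowsOfFilling]
  exact bijOn_cells_iff.1 h.bijOn

lemma IsTableau.isStandardTableau {t : List (List ℕ)} (h : IsTableau t) {n : ℕ}
    (hp : t.flatten.Perm (List.range' 1 n)) :
    IsStandardTableau (shapeOfRows t) (fillingOfRows t) := by
  have hn : (shapeOfRows t).card = n := by
    rw [h.card_shapeOfRows, hp.length_eq, List.length_range']
  refine ⟨fun i j hc => h.fillingOfRows_eq_zero hc, ?_,
    h.row_strict (hp.nodup_iff.2 List.nodup_range'), h.col_strict⟩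
  rw [bijOn_cells_iff, ← h.flatten_eq, hn]
  exact hp

/-! ### The Robinson-Schensted correspondence as a bijection -/

lemma IsTableau.addsBox_tableauInsert {t : List (List ℕ)} (h : IsTableau t) (x : ℕ) :
    AddsBox (shapeOfRows t) (shapeOfRows (_root_.tableauInsert t x).1) :=
  ⟨(_root_.tableauInsert t x).2, fun i => by
    rw [(h.tableauInsert x).rowLen_shapeOfRows, h.rowLen_shapeOfRows, length_getD_tableauInsert]⟩

/-- The result of an insertion, together with the shape of the original tableau, determines the
original tableau and the inserted entry. -/
lemma IsTableau.tableauInsert_fst_injective {t t' : List (List ℕ)} {x x' : ℕ} (ht : IsTableau t)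
    (ht' : IsTableau t') (hs : shapeOfRows t = shapeOfRows t')
    (h : (_root_.tableauInsert t x).1 = (_root_.tableauInsert t' x').1) : t = t' ∧ x = x' := by
  refine tableauInsert_injective ht ht' (Prod.ext h ?_)
  have h1 := length_getD_tableauInsert t x (_root_.tableauInsert t x).2
  have h2 := length_getD_tableauInsert t' x' (_root_.tableauInsert t x).2
  rw [← h, h1, ← ht.rowLen_shapeOfRows, ← ht'.rowLen_shapeOfRows, hs] at h2
  by_contra hne
  simp [hne] at h2

/-- Every tableau arises by insertion from a tableau of any shape with one box less. -/
lemma IsTableau.exists_tableauInsert {t' : List (List ℕ)} (ht' : IsTableau t')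
    {lam : YoungDiagram} (h : AddsBox lam (shapeOfRows t')) :
    ∃ t x, IsTableau t ∧ shapeOfRows t = lam ∧ (_root_.tableauInsert t x).1 = t' := by
  obtain ⟨r, hr⟩ := h
  simp only [ht'.rowLen_shapeOfRows] at hr
  have hlt : (t'.getD (r + 1) []).length < (t'.getD r []).length := by
    have := lam.rowLen_anti r (r + 1) (Nat.le_succ r)
    have h1 := hr r
    have h2 := hr (r + 1)
    simp only [if_true, Nat.succ_ne_self, if_false] at h1 h2
    omega
  obtain ⟨t, x, ht, hx⟩ := exists_tableauInsert_eq ht' hlt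
  refine ⟨t, x, ht, YoungDiagram.ext_rowLen fun i => ?_, by rw [hx]⟩
  have := length_getD_tableauInsert t x i
  rw [hx, hr i] at this
  rw [ht.rowLen_shapeOfRows]
  simp only at this
  omega

lemma length_tableauInsert (t : List (List ℕ)) (x : ℕ) :
    (tableauInsert t x).1.length = max t.length ((tableauInsert t x).2 + 1) := by
  induction t generalizing x with
  | nil => simp [tableauInsert]
  | cons r rs ih =>
    rcases hy : (rowInsert r x).2 with _ | y
    · simp [tableauInsert_cons_none rs hy]
    · simp [tableauInsert_cons_some rs hy, ih]

lemma length_appendToRow (t : List (List ℕ)) (i k : ℕ) (hi : i ≤ t.length) :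
    (appendToRow t i k).length = max t.length (i + 1) := by
  induction t generalizing i with
  | nil => simp_all [appendToRow]
  | cons r rs ih =>
    cases i with
    | zero => simp [appendToRow]
    | succ i => simp [appendToRow, ih i (by simpa using hi)]

lemma fillingOfRows_appendToRow (t : List (List ℕ)) (k x : ℕ) (hk : k ≤ t.length) (i j : ℕ) :
    fillingOfRows (appendToRow t k x) i j =
      if i = k ∧ j = (t.getD k []).length then x else fillingOfRows t i j := by
  have hrow : ∀ (r : List ℕ) (j : ℕ),
      (r ++ [x]).getD j 0 = if j = r.length then x else r.getD j 0 := by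
    intro r j
    rcases lt_trichotomy j r.length with h | h | h
    · simp [List.getElem?_append_left h, h.ne]
    · simp [h]
    · simp [List.getElem?_eq_none h.le, h.ne',
        List.getElem?_eq_none (show (r ++ [x]).length ≤ j by simpa using h)]
  unfold fillingOfRows
  induction t generalizing k i with
  | nil =>
    obtain rfl : k = 0 := by simpa using hk
    cases i <;> cases j <;> simp [appendToRow]
  | cons r rs ih =>
    cases k with
    | zero => cases i with
      | zero => simpa [appendToRow] using hrow r j
      | succ i => simp [appendToRow]
    | succ k => cases i with
      | zero => simp [appendToRow]
      | succ i => simpa [appendToRow] using ih k (by simpa using hk) i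

lemma robinsonSchensted_concat (w : List ℕ) (x : ℕ) : robinsonSchensted (w ++ [x]) =
    ((tableauInsert (robinsonSchensted w).1 x).1,
      appendToRow (robinsonSchensted w).2 (tableauInsert (robinsonSchensted w).1 x).2
        (w.length + 1)) := by
  simp [robinsonSchensted, List.zipIdx_append, add_comm]

lemma isTableau_robinsonSchensted (w : List ℕ) : IsTableau (robinsonSchensted w).1 := by
  induction w using List.reverseRecOn with
  | nil => simp [robinsonSchensted, IsTableau]
  | append_singleton w x ih =>
    rw [robinsonSchensted_concat]
    exact ih.tableauInsert x

lemma robinsonSchensted_flatten_perm (w : List ℕ) :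
    (robinsonSchensted w).1.flatten.Perm w := by
  induction w using List.reverseRecOn with
  | nil => simp [robinsonSchensted]
  | append_singleton w x ih =>
    rw [robinsonSchensted_concat]
    exact (tableauInsert_flatten_perm _ x).trans
      ((ih.cons x).trans (List.perm_append_singleton x w).symm)

lemma card_shapeOfRows_robinsonSchensted (w : List ℕ) :
    (shapeOfRows (robinsonSchensted w).1).card = w.length := by
  rw [(isTableau_robinsonSchensted w).card_shapeOfRows,
    (robinsonSchensted_flatten_perm w).length_eq]

lemma robinsonSchensted_length_eq (w : List ℕ) :
    (robinsonSchensted w).2.length = (robinsonSchensted w).1.length ∧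
      ∀ i, ((robinsonSchensted w).2.getD i []).length =
        ((robinsonSchensted w).1.getD i []).length := by
  induction w using List.reverseRecOn with
  | nil => simp [robinsonSchensted]
  | append_singleton w x ih =>
    have hle := tableauInsert_snd_le (robinsonSchensted w).1 x
    rw [← ih.1] at hle
    rw [robinsonSchensted_concat]
    refine ⟨?_, fun i => ?_⟩
    · rw [length_appendToRow _ _ _ hle, length_tableauInsert, ih.1]
    · rw [length_getD_appendToRow _ _ _ _ hle, length_getD_tableauInsert, ih.2]

/-- The recording tableau grows by the label of the new box of the insertion tableau. -/
lemma fillingOfRows_robinsonSchensted_concat (w : List ℕ) (x : ℕ) :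
    fillingOfRows (robinsonSchensted (w ++ [x])).2 =
      Filling.addLabel (shapeOfRows (robinsonSchensted w).1)
        (shapeOfRows (robinsonSchensted (w ++ [x])).1)
        ((shapeOfRows (robinsonSchensted w).1).card + 1)
        (fillingOfRows (robinsonSchensted w).2) := by
  have hlen := robinsonSchensted_length_eq w
  have hle := tableauInsert_snd_le (robinsonSchensted w).1 x
  rw [← hlen.1] at hle
  have h := isTableau_robinsonSchensted w
  have h' := isTableau_robinsonSchensted (w ++ [x])
  ext i j
  simp only [Filling.addLabel, h.mem_shapeOfRows, h'.mem_shapeOfRows,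
    card_shapeOfRows_robinsonSchensted]
  simp only [robinsonSchensted_concat]
  rw [fillingOfRows_appendToRow _ _ _ hle, length_getD_tableauInsert, hlen.2]
  refine if_congr ?_ rfl rfl
  split_ifs with hi
  · subst hi; omega
  · simp [hi]

lemma isStandardTableau_recording (w : List ℕ) :
    IsStandardTableau (shapeOfRows (robinsonSchensted w).1)
      (fillingOfRows (robinsonSchensted w).2) := by
  induction w using List.reverseRecOn with
  | nil =>
    have h : IsTableau [] := trivial
    exact h.isStandardTableau (n := 0) (by simp)
  | append_singleton w x ih =>
    rw [fillingOfRows_robinsonSchensted_concat]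
    refine ih.addLabel ?_
    rw [robinsonSchensted_concat]
    exact (isTableau_robinsonSchensted w).addsBox_tableauInsert x

lemma addsBox_robinsonSchensted_concat (w : List ℕ) (x : ℕ) :
    AddsBox (shapeOfRows (robinsonSchensted w).1)
      (shapeOfRows (robinsonSchensted (w ++ [x])).1) := by
  rw [robinsonSchensted_concat]
  exact (isTableau_robinsonSchensted w).addsBox_tableauInsert x

/-- A word is determined by its insertion tableau and its recording tableau. -/
theorem robinsonSchensted_injective {w w' : List ℕ}
    (hP : (robinsonSchensted w).1 = (robinsonSchensted w').1)
    (hQ : fillingOfRows (robinsonSchensted w).2 = fillingOfRows (robinsonSchensted w').2) :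
    w = w' := by
  have hlen : w.length = w'.length := by
    rw [← card_shapeOfRows_robinsonSchensted, hP, card_shapeOfRows_robinsonSchensted]
  induction w using List.reverseRecOn generalizing w' with
  | nil => exact (List.length_eq_zero_iff.1 hlen.symm).symm
  | append_singleton w x ih =>
    rcases List.eq_nil_or_concat' w' with rfl | ⟨w', x', rfl⟩
    · simp at hlen
    have hb := addsBox_robinsonSchensted_concat w x
    have hb' := addsBox_robinsonSchensted_concat w' x'
    rw [fillingOfRows_robinsonSchensted_concat, fillingOfRows_robinsonSchensted_concat,
      ← hP] at hQ
    rw [← hP] at hb'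
    obtain ⟨hs, hQ'⟩ := addLabel_injective (isStandardTableau_recording w)
      (isStandardTableau_recording w') hb hb' hQ
    rw [robinsonSchensted_concat, robinsonSchensted_concat] at hP
    obtain ⟨hP', rfl⟩ := (isTableau_robinsonSchensted w).tableauInsert_fst_injective
      (isTableau_robinsonSchensted w') hs hP
    rw [ih hP' hQ' (by simpa using hlen)]

/-- Every pair of a semistandard insertion tableau and a standard recording tableau of the same
shape comes from a word. -/
theorem exists_robinsonSchensted_eq {P : List (List ℕ)} {T : Filling} (hP : IsTableau P)
    (hT : IsStandardTableau (shapeOfRows P) T) :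
    ∃ w, (robinsonSchensted w).1 = P ∧ fillingOfRows (robinsonSchensted w).2 = T := by
  induction hn : (shapeOfRows P).card generalizing P T with
  | zero =>
    have hmem : ∀ i j, (i, j) ∉ shapeOfRows P := fun i j h => by
      rw [YoungDiagram.card, Finset.card_eq_zero] at hn
      simp [← YoungDiagram.mem_cells, hn] at h
    refine ⟨[], ?_, ?_⟩
    · cases P with
      | nil => rfl
      | cons r P =>
        have := hmem 0 0
        rw [hP.mem_shapeOfRows] at this
        exact absurd (by simpa using this) hP.1
    · ext i j
      rw [hT.zeros i j (hmem i j)]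
      simp [robinsonSchensted, fillingOfRows]
  | succ n ih =>
    obtain ⟨lam, T₀, hb, hT₀, rfl⟩ := hT.exists_addLabel (by omega)
    obtain ⟨P₀, x, hP₀, rfl, hx⟩ := hP.exists_tableauInsert hb
    obtain ⟨w, rfl, rfl⟩ := ih hP₀ hT₀ (by have := hb.card_eq; omega)
    have h1 : (robinsonSchensted (w ++ [x])).1 = P := by rw [robinsonSchensted_concat, hx]
    refine ⟨w ++ [x], h1, ?_⟩
    rw [fillingOfRows_robinsonSchensted_concat, h1]

/-! ### Bijections for the induced modules -/

/-- Make room for the entry `k`. -/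
def raiseFrom (k z : ℕ) : ℕ := if k ≤ z then z + 1 else z

/-- Close the gap left by the entry `k`. -/
def lowerAbove (k z : ℕ) : ℕ := if k < z then z - 1 else z

lemma raiseFrom_strictMono (k : ℕ) : StrictMono (raiseFrom k) := fun a b h => by
  unfold raiseFrom; split_ifs <;> omega

lemma raiseFrom_lowerAbove {k z : ℕ} (h : z ≠ k) : raiseFrom k (lowerAbove k z) = z := by
  unfold raiseFrom lowerAbove; split_ifs <;> omega

lemma lowerAbove_lt {k a b : ℕ} (ha : a ≠ k) (h : a < b) :
    lowerAbove k a < lowerAbove k b := by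
  unfold lowerAbove; split_ifs <;> omega

lemma cons_map_raiseFrom_perm {k n : ℕ} (hk : k ∈ Set.Icc 1 (n + 1)) :
    (k :: (List.range' 1 n).map (raiseFrom k)).Perm (List.range' 1 (n + 1)) := by
  refine (List.perm_ext_iff_of_nodup ?_ List.nodup_range').2 fun a => ?_
  · refine List.nodup_cons.2 ⟨?_,
      List.Nodup.map (raiseFrom_strictMono k).injective List.nodup_range'⟩
    rw [List.mem_map]
    rintro ⟨a, -, ha⟩
    unfold raiseFrom at ha
    split_ifs at ha <;> omega
  · obtain ⟨h1, h2⟩ := hk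
    simp only [List.mem_cons, List.mem_map, List.mem_range'_1]
    constructor
    · rintro (rfl | ⟨b, hb, rfl⟩)
      · omega
      · unfold raiseFrom; split_ifs <;> omega
    · intro ha
      by_cases hak : a = k
      · exact Or.inl hak
      · refine Or.inr ⟨lowerAbove k a, ?_, raiseFrom_lowerAbove hak⟩
        unfold lowerAbove; split_ifs <;> omega

lemma rowsOfFilling_congr {lam : YoungDiagram} {T T' : Filling}
    (h : ∀ i j, (i, j) ∈ lam → T i j = T' i j) : rowsOfFilling lam T = rowsOfFilling lam T' :=
  List.map_congr_left fun i _ => List.map_congr_left fun j hj =>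
    h i j (YoungDiagram.mem_iff_lt_rowLen.2 (List.mem_range.1 hj))

/-- Insert `k` into the tableau `U` of shape `nu`, whose entries from `k` on are raised by one. -/
def insertInto (nu : YoungDiagram) (y : ℕ × Filling) : List (List ℕ) :=
  (tableauInsert (rowsOfFilling nu fun i j => raiseFrom y.1 (y.2 i j)) y.1).1

lemma isTableau_raise {nu : YoungDiagram} {U : Filling} (hU : IsStandardTableau nu U) (k : ℕ) :
    IsTableau (rowsOfFilling nu fun i j => raiseFrom k (U i j)) :=
  isTableau_rowsOfFilling
    (fun i j₁ j₂ hj hm => (raiseFrom_strictMono k).monotone (hU.row_strict i j₁ j₂ hj hm).le)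
    fun i₁ i₂ j hi hm => raiseFrom_strictMono k (hU.col_strict i₁ i₂ j hi hm)

/-- Row insertion is a bijection as it is used to choose bases of the induced modules; it goes in
the direction opposite to `IsInductionBijection`. -/
lemma bijOn_insertInto (nu : YoungDiagram) :
    Set.BijOn (fun y => (shapeOfRows (insertInto nu y), fillingOfRows (insertInto nu y)))
      {y | y.1 ∈ Set.Icc 1 (nu.card + 1) ∧ IsStandardTableau nu y.2}
      {x | AddsBox nu x.1 ∧ IsStandardTableau x.1 x.2} := by
  refine ⟨?_, ?_, ?_⟩
  · rintro ⟨k, U⟩ ⟨hk, hU⟩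
    have ht := isTableau_raise hU k
    refine ⟨?_, (ht.tableauInsert k).isStandardTableau (n := nu.card + 1) ?_⟩
    · have := ht.addsBox_tableauInsert k
      rwa [shapeOfRows_rowsOfFilling ht] at this
    · refine (tableauInsert_flatten_perm _ k).trans (.trans (.cons k ?_)
        (cons_map_raiseFrom_perm hk))
      rw [flatten_rowsOfFilling]
      have := (bijOn_cells_iff.1 hU.bijOn).map (raiseFrom k)
      rwa [List.map_map] at this
  · rintro ⟨k, U⟩ ⟨hk, hU⟩ ⟨k', U'⟩ ⟨hk', hU'⟩ h
    have ht := isTableau_raise hU k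
    have ht' := isTableau_raise hU' k'
    have he : insertInto nu (k, U) = insertInto nu (k', U') := by
      have h1 : IsTableau (insertInto nu (k, U)) := ht.tableauInsert k
      have h2 : IsTableau (insertInto nu (k', U')) := ht'.tableauInsert k'
      rw [← h1.rowsOfFilling_eq, ← h2.rowsOfFilling_eq]
      exact congrArg₂ rowsOfFilling (Prod.ext_iff.1 h).1 (Prod.ext_iff.1 h).2
    obtain ⟨hrows, rfl⟩ := ht.tableauInsert_fst_injective ht'
      ((shapeOfRows_rowsOfFilling ht).trans (shapeOfRows_rowsOfFilling ht').symm) he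
    refine Prod.ext rfl ?_
    ext i j
    by_cases hc : (i, j) ∈ nu
    · have := congrArg List.flatten hrows
      rw [flatten_rowsOfFilling, flatten_rowsOfFilling, List.map_inj_left] at this
      exact (raiseFrom_strictMono k).injective (this (i, j) (mem_cellList.2 hc))
    · exact (hU.zeros i j hc).trans (hU'.zeros i j hc).symm
  · rintro ⟨lam, T⟩ ⟨hb, hT⟩
    dsimp only at hb hT
    have ht' := hT.isTableau
    obtain ⟨t, k, ht, hs, hins⟩ := ht'.exists_tableauInsert (lam := nu)
      (by rwa [shapeOfRows_rowsOfFilling ht'])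
    have hp : (k :: t.flatten).Perm (List.range' 1 (nu.card + 1)) := by
      rw [← hb.card_eq]
      refine (tableauInsert_flatten_perm t k).symm.trans ?_
      rw [hins]
      exact hT.flatten_perm
    have hk : k ∈ Set.Icc 1 (nu.card + 1) := by
      have := hp.subset (List.mem_cons_self ..)
      rw [List.mem_range'_1] at this
      exact ⟨this.1, by omega⟩
    have hnd := List.nodup_cons.1 (hp.nodup_iff.2 List.nodup_range')
    have hne : ∀ i j, (i, j) ∈ nu → fillingOfRows t i j ≠ k := by
      rintro i j hc rfl
      refine hnd.1 ?_
      rw [ht.flatten_eq, hs]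
      exact List.mem_map.2 ⟨(i, j), mem_cellList.2 hc, rfl⟩
    have hU : IsStandardTableau nu fun i j => lowerAbove k (fillingOfRows t i j) := by
      refine ⟨fun i j hc => ?_, ?_, fun i j₁ j₂ hj hm => ?_, fun i₁ i₂ j hi hm => ?_⟩
      · rw [ht.fillingOfRows_eq_zero (hs ▸ hc)]
        simp [lowerAbove]
      · refine bijOn_cells_iff (T := fun i j => lowerAbove k (fillingOfRows t i j)).2 ?_
        have h1 : (t.flatten.map (lowerAbove k)).Perm (List.range' 1 nu.card) := by
          have h2 : t.flatten.Perm ((List.range' 1 nu.card).map (raiseFrom k)) :=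
            (List.perm_cons k).1 (hp.trans (cons_map_raiseFrom_perm hk).symm)
          refine (h2.map _).trans ?_
          rw [List.map_map]
          refine List.Perm.of_eq
            ((List.map_congr_left (g := id) fun a _ => ?_).trans (List.map_id _))
          simp only [Function.comp, raiseFrom, lowerAbove, id]
          split_ifs <;> omega
        rw [ht.flatten_eq, hs, List.map_map] at h1
        exact h1
      · exact lowerAbove_lt (hne _ _ (nu.up_left_mem le_rfl hj.le hm))
          (ht.row_strict hnd.2 i j₁ j₂ hj (hs ▸ hm))
      · exact lowerAbove_lt (hne _ _ (nu.up_left_mem hi.le le_rfl hm))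
          (ht.col_strict i₁ i₂ j hi (hs ▸ hm))
    refine ⟨(k, fun i j => lowerAbove k (fillingOfRows t i j)), ⟨hk, hU⟩, ?_⟩
    have hrows : rowsOfFilling nu
        (fun i j => raiseFrom k (lowerAbove k (fillingOfRows t i j))) = t := by
      conv_rhs => rw [← ht.rowsOfFilling_eq, hs]
      exact rowsOfFilling_congr fun i j hc => raiseFrom_lowerAbove (hne i j hc)
    have he : insertInto nu (k, fun i j => lowerAbove k (fillingOfRows t i j)) =
        rowsOfFilling lam T := by
      simp only [insertInto]
      rw [hrows, hins]
    simp only [he]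
    rw [shapeOfRows_rowsOfFilling ht', fillingOfRows_rowsOfFilling hT.zeros]

theorem exists_isInductionBijection (nu : YoungDiagram) : ∃ b, IsInductionBijection nu b :=
  ⟨_, (bijOn_insertInto nu).symm (bijOn_insertInto nu).invOn_invFunOn.symm⟩

/-! ### Set partitions given by their sets of parts -/

/-- `p` is the set of parts of a set partition of `S`. -/
structure IsSetPartition {α : Type*} (S : Finset α) (p : Finset (Finset α)) : Prop where
  nonempty : ∀ A ∈ p, A.Nonempty
  subset : ∀ A ∈ p, A ⊆ S
  eq_of_mem : ∀ A ∈ p, ∀ B ∈ p, ∀ x, x ∈ A → x ∈ B → A = B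
  exists_mem : ∀ x ∈ S, ∃ A ∈ p, x ∈ A

lemma exists_finpartition_iff {α : Type*} [DecidableEq α] {S : Finset α} {p : Finset (Finset α)} :
    (∃ Q : Finpartition S, Q.parts = p) ↔ IsSetPartition S p := by
  constructor
  · rintro ⟨Q, rfl⟩
    exact ⟨fun A => Q.nonempty_of_mem_parts, fun A => Q.subset,
      fun A hA B hB x => Q.eq_of_mem_parts hA hB, fun x => Q.exists_mem⟩
  · intro h
    refine ⟨Finpartition.ofExistsUnique p h.subset (fun x hx => ?_) fun h0 => ?_, rfl⟩
    · obtain ⟨A, hA, hxA⟩ := h.exists_mem x hx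
      exact ⟨A, ⟨hA, hxA⟩, fun B hB => h.eq_of_mem _ hB.1 _ hA x hB.2 hxA⟩
    · simpa using h.nonempty _ h0

lemma IsSetPartition.notMem {α : Type*} {S A : Finset α} {p : Finset (Finset α)} {a : α}
    (h : IsSetPartition S p) (ha : a ∉ S) (hA : A ∈ p) : a ∉ A := fun h' => ha (h.subset A hA h')

section Modify

variable {α : Type*} [DecidableEq α] {S : Finset α} {p : Finset (Finset α)} {a : α}

lemma IsSetPartition.insert_singleton (h : IsSetPartition S p) (ha : a ∉ S) :
    IsSetPartition (insert a S) (insert {a} p) := by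
  refine ⟨?_, ?_, ?_, ?_⟩
  · simpa using h.nonempty
  · simpa using fun A hA => (h.subset A hA).trans (Finset.subset_insert a S)
  · intro A hA B hB x hxA hxB
    rcases Finset.mem_insert.1 hA with rfl | hA <;> rcases Finset.mem_insert.1 hB with rfl | hB
    · rfl
    · rw [Finset.mem_singleton.1 hxA] at hxB
      exact absurd hxB (h.notMem ha hB)
    · rw [Finset.mem_singleton.1 hxB] at hxA
      exact absurd hxA (h.notMem ha hA)
    · exact h.eq_of_mem A hA B hB x hxA hxB
  · intro x hx
    rcases Finset.mem_insert.1 hx with rfl | hx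
    · exact ⟨{x}, by simp⟩
    · obtain ⟨A, hA, hxA⟩ := h.exists_mem x hx
      exact ⟨A, by simp [hA], hxA⟩

lemma IsSetPartition.insert_mem (h : IsSetPartition S p) (ha : a ∉ S) {A : Finset α}
    (hA : A ∈ p) : IsSetPartition (insert a S) (insert (insert a A) (p.erase A)) := by
  refine ⟨?_, ?_, ?_, ?_⟩
  · simpa using fun B _ hB => h.nonempty B hB
  · intro B hB
    rcases Finset.mem_insert.1 hB with rfl | hB
    · exact Finset.insert_subset_insert a (h.subset A hA)
    · exact (h.subset B (Finset.mem_of_mem_erase hB)).trans (Finset.subset_insert a S)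
  · have key : ∀ B ∈ p.erase A, ∀ x, x ∈ insert a A → x ∉ B := by
      intro B hB x hx hxB
      rw [Finset.mem_erase] at hB
      rcases Finset.mem_insert.1 hx with rfl | hx
      · exact h.notMem ha hB.2 hxB
      · exact hB.1 (h.eq_of_mem B hB.2 A hA x hxB hx)
    intro B hB C hC x hxB hxC
    rcases Finset.mem_insert.1 hB with rfl | hB <;> rcases Finset.mem_insert.1 hC with rfl | hC
    · rfl
    · exact absurd hxC (key C hC x hxB)
    · exact absurd hxB (key B hB x hxC)
    · exact h.eq_of_mem B (Finset.mem_of_mem_erase hB) C (Finset.mem_of_mem_erase hC) x hxB hxC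
  · intro x hx
    rcases Finset.mem_insert.1 hx with rfl | hx
    · exact ⟨insert x A, by simp⟩
    · obtain ⟨B, hB, hxB⟩ := h.exists_mem x hx
      by_cases hBA : B = A
      · exact ⟨insert a A, by simp, by simp [← hBA, hxB]⟩
      · exact ⟨B, by simp [hB, hBA], hxB⟩

lemma IsSetPartition.erase_singleton (h : IsSetPartition S p) (ha : {a} ∈ p) :
    IsSetPartition (S.erase a) (p.erase {a}) := by
  refine ⟨fun A hA => h.nonempty A (Finset.mem_of_mem_erase hA), fun A hA x hx => ?_,
    fun A hA B hB => h.eq_of_mem A (Finset.mem_of_mem_erase hA) B (Finset.mem_of_mem_erase hB),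
    fun x hx => ?_⟩
  · rw [Finset.mem_erase] at hA
    refine Finset.mem_erase.2 ⟨?_, h.subset A hA.2 hx⟩
    rintro rfl
    exact hA.1 (h.eq_of_mem A hA.2 _ ha x hx (by simp))
  · rw [Finset.mem_erase] at hx
    obtain ⟨A, hA, hxA⟩ := h.exists_mem x hx.2
    refine ⟨A, Finset.mem_erase.2 ⟨?_, hA⟩, hxA⟩
    rintro rfl
    exact hx.1 (by simpa using hxA)

lemma IsSetPartition.erase_mem (h : IsSetPartition S p) {B : Finset α} (hB : B ∈ p) (ha : a ∈ B)
    (hne : B ≠ {a}) : IsSetPartition (S.erase a) (insert (B.erase a) (p.erase B)) := by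
  have hsub : ∀ A ∈ insert (B.erase a) (p.erase B), ∃ C ∈ p, A = C.erase a := by
    intro A hA
    rcases Finset.mem_insert.1 hA with rfl | hA
    · exact ⟨B, hB, rfl⟩
    · rw [Finset.mem_erase] at hA
      refine ⟨A, hA.2, (Finset.erase_eq_of_notMem fun h' => hA.1 ?_).symm⟩
      exact h.eq_of_mem A hA.2 B hB a h' ha
  refine ⟨?_, ?_, ?_, ?_⟩
  · intro A hA
    rcases Finset.mem_insert.1 hA with rfl | hA
    · rw [Finset.nonempty_iff_ne_empty, Ne, Finset.erase_eq_empty_iff]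
      rintro (h' | h')
      · simp [h'] at ha
      · exact hne h'
    · exact h.nonempty A (Finset.mem_of_mem_erase hA)
  · intro A hA
    obtain ⟨C, hC, rfl⟩ := hsub A hA
    exact Finset.erase_subset_erase a (h.subset C hC)
  · intro A hA A' hA' x hx hx'
    obtain ⟨C, hC, rfl⟩ := hsub A hA
    obtain ⟨C', hC', rfl⟩ := hsub A' hA'
    rw [h.eq_of_mem C hC C' hC' x (Finset.mem_of_mem_erase hx) (Finset.mem_of_mem_erase hx')]
  · intro x hx
    rw [Finset.mem_erase] at hx
    obtain ⟨A, hA, hxA⟩ := h.exists_mem x hx.2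
    by_cases hAB : A = B
    · exact ⟨B.erase a, by simp, by simp [hx.1, ← hAB, hxA]⟩
    · exact ⟨A, by simp [hA, hAB], hxA⟩

end Modify

/-! ### Positions -/

lemma IsSetPartition.min_injOn {α : Type*} [LinearOrder α] {S : Finset α}
    {p : Finset (Finset α)} (h : IsSetPartition S p) :
    Set.InjOn Finset.min (p : Set (Finset α)) := by
  intro A hA B hB hAB
  obtain ⟨x, hx⟩ := Finset.min_of_nonempty (h.nonempty A hA)
  exact h.eq_of_mem A hA B hB x (Finset.mem_of_min hx) (Finset.mem_of_min (hAB ▸ hx))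

/-- Sets with different lowest elements are numbered consecutively by their positions. -/
lemma position_bijOn {F : Finset (Finset ℕ)}
    (hF : Set.InjOn Finset.min (F : Set (Finset ℕ))) :
    Set.BijOn (position F) F (Finset.Icc 1 F.card : Finset ℕ) := by
  have hmaps : Set.MapsTo (position F) F (Finset.Icc 1 F.card : Finset ℕ) := by
    intro A hA
    rw [Finset.mem_coe, Finset.mem_Icc]
    exact ⟨Finset.card_pos.2 ⟨A, Finset.mem_filter.2 ⟨hA, le_rfl⟩⟩, Finset.card_filter_le _ _⟩
  have hlt : ∀ A ∈ F, ∀ B ∈ F, A.min < B.min → position F A < position F B := by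
    intro A hA B hB h
    refine Finset.card_lt_card ⟨fun C hC => ?_, fun hsub => ?_⟩
    · rw [Finset.mem_filter] at hC ⊢
      exact ⟨hC.1, hC.2.trans h.le⟩
    · have : B ∈ F.filter fun C => C.min ≤ A.min := hsub (Finset.mem_filter.2 ⟨hB, le_rfl⟩)
      exact absurd (Finset.mem_filter.1 this).2 (not_le.2 h)
  have hinj : Set.InjOn (position F) F := by
    intro A hA B hB hAB
    refine hF hA hB ?_
    by_contra hne
    rcases lt_or_gt_of_ne hne with h | h
    · exact (hlt A hA B hB h).ne hAB
    · exact (hlt B hB A hA h).ne hAB.symm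
  exact ⟨hmaps, hinj, Finset.surjOn_of_injOn_of_card_le _ hmaps hinj (by simp)⟩

/-! ### Half-partitions -/

lemma isHalfPartition_iff {n : ℕ} {s : HalfPartition} : IsHalfPartition n s ↔
    Disjoint s.nonprop s.propagating ∧
      IsSetPartition (Finset.Icc 1 n) (s.nonprop ∪ s.propagating) := by
  rw [IsHalfPartition, exists_finpartition_iff]

lemma HalfPartition.ext' {s t : HalfPartition} (h1 : s.nonprop = t.nonprop)
    (h2 : s.propagating = t.propagating) : s = t := by
  cases s; cases t; simp_all

lemma Icc_one_succ (n : ℕ) : Finset.Icc 1 (n + 1) = insert (n + 1) (Finset.Icc 1 n) := by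
  ext x; simp only [Finset.mem_Icc, Finset.mem_insert]; omega

lemma Icc_one_succ_erase (n : ℕ) : (Finset.Icc 1 (n + 1)).erase (n + 1) = Finset.Icc 1 n := by
  ext x; simp only [Finset.mem_Icc, Finset.mem_erase]; omega

lemma succ_notMem_Icc (n : ℕ) : n + 1 ∉ Finset.Icc 1 n := by simp

section

variable {n : ℕ} {s : HalfPartition}

lemma IsHalfPartition.min_injOn (h : IsHalfPartition n s) :
    Set.InjOn Finset.min (s.propagating : Set (Finset ℕ)) :=
  (isHalfPartition_iff.1 h).2.min_injOn.mono (by simp)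

lemma IsHalfPartition.succ_notMem (h : IsHalfPartition n s) {A : Finset ℕ}
    (hA : A ∈ s.propagating) : n + 1 ∉ A :=
  (isHalfPartition_iff.1 h).2.notMem (succ_notMem_Icc n) (by simp [hA])

lemma IsHalfPartition.singleton_notMem (h : IsHalfPartition n s) :
    {n + 1} ∉ s.propagating := fun hA => h.succ_notMem hA (by simp)

lemma IsHalfPartition.addPropagating (h : IsHalfPartition n s) :
    IsHalfPartition (n + 1) (s.addPropagating (n + 1)) := by
  obtain ⟨h1, h2⟩ := isHalfPartition_iff.1 h
  rw [isHalfPartition_iff, Icc_one_succ]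
  simp only [HalfPartition.addPropagating, Finset.union_insert]
  refine ⟨Finset.disjoint_insert_right.2 ⟨fun h' => ?_, h1⟩,
    h2.insert_singleton (succ_notMem_Icc n)⟩
  exact h2.notMem (succ_notMem_Icc n) (Finset.mem_union_left _ h') (Finset.mem_singleton_self _)

/-- `addToPropagating` at the position of `A` changes `A` only. -/
lemma HalfPartition.addToPropagating_eq {A : Finset ℕ} (a : ℕ)
    (hs : Set.InjOn Finset.min (s.propagating : Set (Finset ℕ))) (hA : A ∈ s.propagating) :
    s.addToPropagating a (position s.propagating A) =
      ⟨s.nonprop, insert (insert a A) (s.propagating.erase A)⟩ := by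
  refine HalfPartition.ext' rfl ?_
  have hpos : ∀ B ∈ s.propagating,
      position s.propagating B = position s.propagating A ↔ B = A :=
    fun B hB => (position_bijOn hs).injOn.eq_iff hB hA
  have himage : ∀ f : Finset ℕ → Finset ℕ, s.propagating.image f =
      insert (f A) ((s.propagating.erase A).image f) := fun f => by
    rw [← Finset.image_insert, Finset.insert_erase hA]
  simp only [addToPropagating]
  rw [himage, if_pos rfl]
  congr 1
  refine (Finset.image_congr (g := id) fun B hB => ?_).trans Finset.image_id
  rw [Finset.mem_coe, Finset.mem_erase] at hB
  simp [hpos B hB.2, hB.1]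

lemma IsHalfPartition.addToPropagating (h : IsHalfPartition n s) {A : Finset ℕ}
    (hA : A ∈ s.propagating) :
    IsHalfPartition (n + 1) ⟨s.nonprop, insert (insert (n + 1) A) (s.propagating.erase A)⟩ := by
  obtain ⟨h1, h2⟩ := isHalfPartition_iff.1 h
  have hAN : A ∉ s.nonprop := Finset.disjoint_right.1 h1 hA
  rw [isHalfPartition_iff, Icc_one_succ]
  simp only
  constructor
  · refine Finset.disjoint_insert_right.2 ⟨fun h' => ?_,
      h1.mono_right (Finset.erase_subset _ _)⟩
    exact h2.notMem (succ_notMem_Icc n) (Finset.mem_union_left _ h') (Finset.mem_insert_self _ _)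
  · have := h2.insert_mem (succ_notMem_Icc n) (Finset.mem_union_right _ hA)
    rwa [Finset.erase_union_distrib, Finset.erase_eq_of_notMem hAN, ← Finset.union_insert] at this

lemma IsHalfPartition.eq_of_mem (h : IsHalfPartition n s) {A B : Finset ℕ}
    (hA : A ∈ s.nonprop ∪ s.propagating) (hB : B ∈ s.nonprop ∪ s.propagating) {x : ℕ}
    (hxA : x ∈ A) (hxB : x ∈ B) : A = B :=
  (isHalfPartition_iff.1 h).2.eq_of_mem A hA B hB x hxA hxB

/-- `stopPropagating` moves only the part that contains `a`. -/
lemma IsHalfPartition.stopPropagating_eq (h : IsHalfPartition n s) {a : ℕ} {B : Finset ℕ}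
    (hB : B ∈ s.propagating) (ha : a ∈ B) :
    s.stopPropagating a = ⟨insert B s.nonprop, s.propagating.erase B⟩ := by
  have key : ∀ A ∈ s.propagating, a ∈ A ↔ A = B := fun A hA =>
    ⟨fun h' => h.eq_of_mem (by simp [hA]) (by simp [hB]) h' ha, fun h' => h' ▸ ha⟩
  refine HalfPartition.ext' ?_ ?_
  · ext A
    simp only [HalfPartition.stopPropagating, Finset.mem_union, Finset.mem_filter,
      Finset.mem_insert]
    constructor
    · rintro (hA | hA)
      · exact Or.inr hA
      · exact Or.inl ((key A hA.1).1 hA.2)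
    · rintro (rfl | hA)
      · exact Or.inr ⟨hB, ha⟩
      · exact Or.inl hA
  · ext A
    simp only [HalfPartition.stopPropagating, Finset.mem_filter, Finset.mem_erase]
    constructor
    · exact fun hA => ⟨fun h' => hA.2 ((key A hA.1).2 h'), hA.1⟩
    · exact fun hA => ⟨hA.2, fun h' => hA.1 ((key A hA.2).1 h')⟩

lemma IsHalfPartition.moveToNonprop (h : IsHalfPartition n s) {B : Finset ℕ}
    (hB : B ∈ s.propagating) :
    IsHalfPartition n ⟨insert B s.nonprop, s.propagating.erase B⟩ := by
  obtain ⟨h1, h2⟩ := isHalfPartition_iff.1 h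
  rw [isHalfPartition_iff]
  simp only
  constructor
  · exact Finset.disjoint_insert_left.2
      ⟨Finset.notMem_erase _ _, h1.mono_right (Finset.erase_subset _ _)⟩
  · rwa [Finset.insert_union, ← Finset.union_insert, Finset.insert_erase hB]

lemma IsHalfPartition.moveToPropagating (h : IsHalfPartition n s) {B : Finset ℕ}
    (hB : B ∈ s.nonprop) :
    IsHalfPartition n ⟨s.nonprop.erase B, insert B s.propagating⟩ := by
  obtain ⟨h1, h2⟩ := isHalfPartition_iff.1 h
  rw [isHalfPartition_iff]
  simp only
  constructor
  · exact Finset.disjoint_insert_right.2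
      ⟨Finset.notMem_erase _ _, h1.mono_left (Finset.erase_subset _ _)⟩
  · rwa [Finset.union_insert, ← Finset.insert_union, Finset.insert_erase hB]

lemma IsHalfPartition.erase_singleton (h : IsHalfPartition (n + 1) s)
    (hB : {n + 1} ∈ s.propagating) :
    IsHalfPartition n ⟨s.nonprop, s.propagating.erase {n + 1}⟩ := by
  obtain ⟨h1, h2⟩ := isHalfPartition_iff.1 h
  rw [isHalfPartition_iff]
  simp only
  refine ⟨h1.mono_right (Finset.erase_subset _ _), ?_⟩
  have := h2.erase_singleton (Finset.mem_union_right _ hB)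
  rwa [Icc_one_succ_erase, Finset.erase_union_distrib,
    Finset.erase_eq_of_notMem (Finset.disjoint_right.1 h1 hB)] at this

lemma IsHalfPartition.erase_mem (h : IsHalfPartition (n + 1) s) {B : Finset ℕ}
    (hB : B ∈ s.propagating) (hn : n + 1 ∈ B) (hne : B ≠ {n + 1}) :
    IsHalfPartition n ⟨s.nonprop, insert (B.erase (n + 1)) (s.propagating.erase B)⟩ := by
  obtain ⟨h1, h2⟩ := isHalfPartition_iff.1 h
  rw [isHalfPartition_iff]
  simp only
  have h3 := h2.erase_mem (Finset.mem_union_right _ hB) hn hne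
  constructor
  · refine Finset.disjoint_insert_right.2 ⟨fun h' => ?_,
      h1.mono_right (Finset.erase_subset _ _)⟩
    obtain ⟨x, hx⟩ := h3.nonempty _ (Finset.mem_insert_self _ _)
    have := h.eq_of_mem (Finset.mem_union_left _ h') (Finset.mem_union_right _ hB) hx
      (Finset.mem_of_mem_erase hx)
    rw [this] at h'
    exact Finset.disjoint_right.1 h1 hB h'
  · rwa [Icc_one_succ_erase, Finset.erase_union_distrib,
      Finset.erase_eq_of_notMem (Finset.disjoint_right.1 h1 hB), ← Finset.union_insert] at h3

end

/-! ### The array `Yp` and its edge maps -/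

lemma mem_Yp_even {n : ℕ} {lam : YoungDiagram} {x : HalfPartition × Filling} :
    x ∈ Yp (2 * n) (Sum.inl lam) ↔ IsHalfPartition n x.1 ∧
      x.1.propagating.card = lam.card ∧ IsStandardTableau lam x.2 := by
  simp [Yp]

lemma mem_Yp_odd {n : ℕ} {lam : YoungDiagram} {x : HalfPartition × Filling} :
    x ∈ Yp (2 * n + 1) (Sum.inr lam) ↔ IsHalfPartition (n + 1) x.1 ∧
      x.1.propagating.card = lam.card + 1 ∧ (∃ A ∈ x.1.propagating, n + 1 ∈ A) ∧
      IsStandardTableau lam x.2 := by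
  have : (2 * n + 1) / 2 = n := by omega
  simp [Yp, this]

lemma notMem_Yp_even {n : ℕ} {lam : YoungDiagram} (x : HalfPartition × Filling) :
    x ∉ Yp (2 * n) (Sum.inr lam) := by
  simp [Yp]

lemma notMem_Yp_odd {n : ℕ} {lam : YoungDiagram} (x : HalfPartition × Filling) :
    x ∉ Yp (2 * n + 1) (Sum.inl lam) := by
  simp [Yp]

lemma isHalfPartition_zero_iff {s : HalfPartition} :
    IsHalfPartition 0 s ↔ s = ⟨∅, ∅⟩ := by
  rw [isHalfPartition_iff]
  constructor
  · rintro ⟨-, h⟩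
    have : s.nonprop ∪ s.propagating = ∅ := by
      refine Finset.eq_empty_of_forall_notMem fun A hA => ?_
      obtain ⟨x, hx⟩ := h.nonempty A hA
      simpa using h.subset A hA hx
    rw [Finset.union_eq_empty] at this
    exact HalfPartition.ext' this.1 this.2
  · rintro rfl
    exact ⟨by simp, ⟨by simp, by simp, by simp, by simp⟩⟩

lemma isStandardTableau_bot_iff {T : Filling} : IsStandardTableau ⊥ T ↔ T = fun _ _ => 0 := by
  constructor
  · intro h
    ext i j
    exact h.zeros i j (by simp)
  · rintro rfl
    exact ⟨by simp, by simp [YoungDiagram.card], by simp, by simp⟩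

lemma YoungDiagram.eq_bot_of_card_eq_zero {lam : YoungDiagram} (h : lam.card = 0) : lam = ⊥ := by
  ext c
  rw [YoungDiagram.card, Finset.card_eq_zero] at h
  simp [h]

lemma mem_Yp_zero_iff {v : DoubleYoungVertex} {x : HalfPartition × Filling} :
    x ∈ Yp 0 v ↔ v = emptyVertex ∧ x = (⟨∅, ∅⟩, fun _ _ => 0) := by
  obtain ⟨s, T⟩ := x
  rcases v with lam | lam
  · rw [← Nat.mul_zero 2, mem_Yp_even]
    simp only [isHalfPartition_zero_iff, emptyVertex, Sum.inl.injEq, Prod.mk.injEq]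
    constructor
    · rintro ⟨rfl, h, hT⟩
      obtain rfl := YoungDiagram.eq_bot_of_card_eq_zero h.symm
      exact ⟨rfl, rfl, isStandardTableau_bot_iff.1 hT⟩
    · rintro ⟨rfl, rfl, rfl⟩
      exact ⟨rfl, rfl, isStandardTableau_bot_iff.2 rfl⟩
  · simp [emptyVertex, Yp]

section

variable {b : YoungDiagram → YoungDiagram × Filling → ℕ × Filling} {n : ℕ}
  {lam lam' nu mu : YoungDiagram} {s : HalfPartition} {T : Filling}

lemma edgeMap_even_self :
    edgeMap b (2 * n) (Sum.inl nu) (Sum.inr nu) (s, T) = (s.addPropagating (n + 1), T) := by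
  simp [edgeMap]

lemma edgeMap_even_of_addsBox (h : AddsBox nu lam) :
    edgeMap b (2 * n) (Sum.inl lam) (Sum.inr nu) (s, T) =
      (s.addToPropagating (n + 1) (b nu (lam, T)).1, (b nu (lam, T)).2) := by
  simp [edgeMap, h.ne]

lemma edgeMap_odd_self :
    edgeMap b (2 * n + 1) (Sum.inr mu) (Sum.inl mu) (s, T) =
      (s.stopPropagating (n + 1), T) := by
  have : (2 * n + 1) / 2 = n := by omega
  simp [edgeMap, this]

lemma edgeMap_odd_of_addsBox (h : AddsBox lam mu) :
    edgeMap b (2 * n + 1) (Sum.inr lam) (Sum.inl mu) (s, T) =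
      (s, T.addLabel lam mu (lam.card + 1)) := by
  simp [edgeMap, h.ne]

/-- Along `lam → nu+`, where `lam` is `nu` plus one box, the element `n + 1` joins one of the
propagating components. -/
lemma exists_edgeMap_even_eq (hb : IsInductionBijection nu (b nu)) (h : AddsBox nu lam)
    (hx : (s, T) ∈ Yp (2 * n) (Sum.inl lam)) :
    ∃ A ∈ s.propagating, (b nu (lam, T)).1 = position s.propagating A ∧
      IsStandardTableau nu (b nu (lam, T)).2 ∧
      edgeMap b (2 * n) (Sum.inl lam) (Sum.inr nu) (s, T) =
        (⟨s.nonprop, insert (insert (n + 1) A) (s.propagating.erase A)⟩,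
          (b nu (lam, T)).2) := by
  obtain ⟨hs, hcard, hT⟩ := mem_Yp_even.1 hx
  obtain ⟨hk, hU⟩ := hb.mapsTo (show (lam, T) ∈ _ from ⟨h, hT⟩)
  obtain ⟨A, hA, hpos⟩ := (position_bijOn hs.min_injOn).surjOn
    (show (b nu (lam, T)).1 ∈ _ by rw [hcard, h.card_eq]; simpa using hk)
  refine ⟨A, hA, hpos.symm, hU, ?_⟩
  rw [edgeMap_even_of_addsBox h, ← hpos, HalfPartition.addToPropagating_eq _ hs.min_injOn hA]

lemma card_insert_insert_erase {s : HalfPartition} (hs : IsHalfPartition n s) {A : Finset ℕ}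
    (hA : A ∈ s.propagating) :
    (insert (insert (n + 1) A) (s.propagating.erase A)).card = s.propagating.card := by
  rw [Finset.card_insert_of_notMem, Finset.card_erase_add_one hA]
  exact fun h => hs.succ_notMem (Finset.mem_of_mem_erase h) (Finset.mem_insert_self _ _)

lemma edgeMap_even_mem (hb : IsInductionBijection nu (b nu)) (hadj : lam = nu ∨ AddsBox nu lam)
    {x : HalfPartition × Filling} (hx : x ∈ Yp (2 * n) (Sum.inl lam)) :
    edgeMap b (2 * n) (Sum.inl lam) (Sum.inr nu) x ∈ Yp (2 * n + 1) (Sum.inr nu) := by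
  obtain ⟨s, T⟩ := x
  obtain ⟨hs, hcard, hT⟩ := mem_Yp_even.1 hx
  rcases hadj with rfl | h
  · rw [edgeMap_even_self, mem_Yp_odd]
    refine ⟨hs.addPropagating, ?_, ⟨{n + 1}, by simp [HalfPartition.addPropagating]⟩, hT⟩
    simp only [HalfPartition.addPropagating]
    rw [Finset.card_insert_of_notMem hs.singleton_notMem, hcard]
  · obtain ⟨A, hA, -, hU, he⟩ := exists_edgeMap_even_eq hb h hx
    rw [he, mem_Yp_odd]
    refine ⟨hs.addToPropagating hA, ?_, ⟨insert (n + 1) A, by simp⟩, hU⟩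
    rw [card_insert_insert_erase hs hA, hcard, h.card_eq]

lemma edgeMap_odd_mem (hadj : mu = lam ∨ AddsBox lam mu)
    {x : HalfPartition × Filling} (hx : x ∈ Yp (2 * n + 1) (Sum.inr lam)) :
    edgeMap b (2 * n + 1) (Sum.inr lam) (Sum.inl mu) x ∈ Yp (2 * (n + 1)) (Sum.inl mu) := by
  obtain ⟨s, T⟩ := x
  obtain ⟨hs, hcard, ⟨A, hA, hn⟩, hT⟩ := mem_Yp_odd.1 hx
  rcases hadj with rfl | h
  · rw [edgeMap_odd_self, mem_Yp_even, hs.stopPropagating_eq hA hn]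
    refine ⟨hs.moveToNonprop hA, ?_, hT⟩
    simp only at hcard ⊢
    rw [Finset.card_erase_of_mem hA, hcard]
    rfl
  · rw [edgeMap_odd_of_addsBox h, mem_Yp_even]
    exact ⟨hs, by rw [h.card_eq]; exact hcard, hT.addLabel h⟩

/-- The enlarged part and its position are recovered from the part containing `n + 1`, and then the
diagram and its tableau from the bijection `b nu`. -/
lemma edgeMap_even_injective (hb : IsInductionBijection nu (b nu))
    (hadj : lam = nu ∨ AddsBox nu lam) (hadj' : lam' = nu ∨ AddsBox nu lam')
    {x x' : HalfPartition × Filling} (hx : x ∈ Yp (2 * n) (Sum.inl lam))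
    (hx' : x' ∈ Yp (2 * n) (Sum.inl lam'))
    (he : edgeMap b (2 * n) (Sum.inl lam) (Sum.inr nu) x =
      edgeMap b (2 * n) (Sum.inl lam') (Sum.inr nu) x') : lam = lam' ∧ x = x' := by
  obtain ⟨s, T⟩ := x
  obtain ⟨s', T'⟩ := x'
  have hs : IsHalfPartition n s := (mem_Yp_even.1 hx).1
  have hs' : IsHalfPartition n s' := (mem_Yp_even.1 hx').1
  -- the part containing `n + 1` is a singleton only along the edge `nu → nu+`
  have hmixed : ∀ {s s' : HalfPartition} {A : Finset ℕ}, IsHalfPartition n s →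
      IsHalfPartition n s' → A ∈ s'.propagating → insert {n + 1} s.propagating ≠
        insert (insert (n + 1) A) (s'.propagating.erase A) := by
    intro s s' A hs hs' hA h
    have h1 : {n + 1} ∈ insert (insert (n + 1) A) (s'.propagating.erase A) := h ▸ by simp
    rcases Finset.mem_insert.1 h1 with h1 | h1
    · obtain ⟨x, hx⟩ := (isHalfPartition_iff.1 hs').2.nonempty A (by simp [hA])
      have h2 : x ∈ ({n + 1} : Finset ℕ) := h1 ▸ Finset.mem_insert_of_mem hx
      exact hs'.succ_notMem hA (Finset.mem_singleton.1 h2 ▸ hx)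
    · exact hs'.singleton_notMem (Finset.mem_of_mem_erase h1)
  rcases hadj with rfl | h <;> rcases hadj' with rfl | h'
  · rw [edgeMap_even_self, edgeMap_even_self] at he
    simp only [HalfPartition.addPropagating, Prod.mk.injEq, HalfPartition.mk.injEq] at he
    refine ⟨rfl, Prod.ext (HalfPartition.ext' he.1.1 ?_) he.2⟩
    have := congrArg (Finset.erase · {n + 1}) he.1.2
    simpa [Finset.erase_insert, hs.singleton_notMem, hs'.singleton_notMem] using this
  · obtain ⟨A, hA, -, -, hA'⟩ := exists_edgeMap_even_eq hb h' hx'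
    rw [edgeMap_even_self, hA'] at he
    simp only [HalfPartition.addPropagating, Prod.mk.injEq, HalfPartition.mk.injEq] at he
    exact absurd he.1.2 (hmixed hs hs' hA)
  · obtain ⟨A, hA, -, -, hA'⟩ := exists_edgeMap_even_eq hb h hx
    rw [edgeMap_even_self, hA'] at he
    simp only [HalfPartition.addPropagating, Prod.mk.injEq, HalfPartition.mk.injEq] at he
    exact absurd he.1.2.symm (hmixed hs' hs hA)
  · obtain ⟨A, hA, hpos, -, hAe⟩ := exists_edgeMap_even_eq hb h hx
    obtain ⟨A', hA', hpos', -, hAe'⟩ := exists_edgeMap_even_eq hb h' hx'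
    rw [hAe, hAe'] at he
    simp only [Prod.mk.injEq, HalfPartition.mk.injEq] at he
    obtain ⟨⟨he1, he2⟩, he3⟩ := he
    have hins : insert (n + 1) A = insert (n + 1) A' := by
      have h1 : insert (n + 1) A ∈ insert (insert (n + 1) A') (s'.propagating.erase A') :=
        he2 ▸ Finset.mem_insert_self _ _
      refine (Finset.mem_insert.1 h1).resolve_right fun h2 => ?_
      exact hs'.succ_notMem (Finset.mem_of_mem_erase h2) (Finset.mem_insert_self _ _)
    obtain rfl : A = A' := by
      have := congrArg (Finset.erase · (n + 1)) hins
      simpa [Finset.erase_insert, hs.succ_notMem hA, hs'.succ_notMem hA'] using this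
    have hne : ∀ {s : HalfPartition}, IsHalfPartition n s →
        insert (n + 1) A ∉ s.propagating.erase A := fun hs h2 =>
      hs.succ_notMem (Finset.mem_of_mem_erase h2) (Finset.mem_insert_self _ _)
    have hprop : s.propagating = s'.propagating := by
      have := congrArg (Finset.erase · (insert (n + 1) A)) he2
      simp only [Finset.erase_insert (hne hs), Finset.erase_insert (hne hs')] at this
      rw [← Finset.insert_erase hA, this, Finset.insert_erase hA']
    have hbe : b nu (lam, T) = b nu (lam', T') :=
      Prod.ext (by rw [hpos, hpos', hprop]) he3
    have := hb.injOn (show (lam, T) ∈ _ from ⟨h, (mem_Yp_even.1 hx).2.2⟩)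
      (show (lam', T') ∈ _ from ⟨h', (mem_Yp_even.1 hx').2.2⟩) hbe
    rw [Prod.mk.injEq] at this
    exact ⟨this.1, Prod.ext (HalfPartition.ext' he1 hprop) this.2⟩

lemma edgeMap_odd_injective (hadj : mu = lam ∨ AddsBox lam mu) (hadj' : mu = lam' ∨ AddsBox lam' mu)
    {x x' : HalfPartition × Filling} (hx : x ∈ Yp (2 * n + 1) (Sum.inr lam))
    (hx' : x' ∈ Yp (2 * n + 1) (Sum.inr lam'))
    (he : edgeMap b (2 * n + 1) (Sum.inr lam) (Sum.inl mu) x =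
      edgeMap b (2 * n + 1) (Sum.inr lam') (Sum.inl mu) x') : lam = lam' ∧ x = x' := by
  obtain ⟨s, T⟩ := x
  obtain ⟨s', T'⟩ := x'
  obtain ⟨hs, hcard, ⟨A, hA, hn⟩, hT⟩ := mem_Yp_odd.1 hx
  obtain ⟨hs', hcard', ⟨A', hA', hn'⟩, hT'⟩ := mem_Yp_odd.1 hx'
  dsimp only at hs hs' hA hA' hT hT'
  -- along `mu+ → mu` the part containing `n + 1` stops propagating, along other edges it does not
  have hnew : ∀ t : HalfPartition, ∀ B ∈ (t.stopPropagating (n + 1)).propagating, n + 1 ∉ B := by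
    intro t B hB
    exact (Finset.mem_filter.1 hB).2
  rcases hadj with rfl | h <;> rcases hadj' with rfl | h'
  · rw [edgeMap_odd_self, edgeMap_odd_self, hs.stopPropagating_eq hA hn,
      hs'.stopPropagating_eq hA' hn'] at he
    simp only [Prod.mk.injEq, HalfPartition.mk.injEq] at he
    obtain ⟨⟨he1, he2⟩, rfl⟩ := he
    obtain rfl : A = A' := by
      have h1 : A ∈ insert A' s'.nonprop := he1 ▸ Finset.mem_insert_self _ _
      rcases Finset.mem_insert.1 h1 with h1 | h1
      · exact h1
      · exact hs'.eq_of_mem (by simp [h1]) (by simp [hA']) hn hn'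
    refine ⟨rfl, Prod.ext (HalfPartition.ext' ?_ ?_) rfl⟩
    · have := congrArg (Finset.erase · A) he1
      simpa [Finset.erase_insert, Finset.disjoint_right.1 (isHalfPartition_iff.1 hs).1 hA,
        Finset.disjoint_right.1 (isHalfPartition_iff.1 hs').1 hA'] using this
    · simp only
      rw [← Finset.insert_erase hA, he2, Finset.insert_erase hA']
  · rw [edgeMap_odd_self, edgeMap_odd_of_addsBox h', Prod.mk.injEq] at he
    exact absurd hn' (hnew s A' (he.1 ▸ hA'))
  · rw [edgeMap_odd_self, edgeMap_odd_of_addsBox h, Prod.mk.injEq] at he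
    exact absurd hn (hnew s' A (he.1 ▸ hA))
  · rw [edgeMap_odd_of_addsBox h, edgeMap_odd_of_addsBox h', Prod.mk.injEq] at he
    obtain ⟨h1, h2⟩ := addLabel_injective hT hT' h h' he.2
    exact ⟨h1, Prod.ext he.1 h2⟩

/-- Removing `n + 1` from its part gives the preimage; if another element remains, then the
position of the part and `b nu` determine the edge. -/
lemma exists_edgeMap_even (hb : IsInductionBijection nu (b nu))
    {y : HalfPartition × Filling} (hy : y ∈ Yp (2 * n + 1) (Sum.inr nu)) :
    ∃ lam, (lam = nu ∨ AddsBox nu lam) ∧ ∃ x ∈ Yp (2 * n) (Sum.inl lam),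
      edgeMap b (2 * n) (Sum.inl lam) (Sum.inr nu) x = y := by
  obtain ⟨s, U⟩ := y
  obtain ⟨hs, hcard, ⟨B, hB, hn⟩, hU⟩ := mem_Yp_odd.1 hy
  dsimp only at hs hcard hB hU
  by_cases hne : B = {n + 1}
  · subst hne
    refine ⟨nu, Or.inl rfl, (⟨s.nonprop, s.propagating.erase {n + 1}⟩, U), ?_, ?_⟩
    · refine mem_Yp_even.2 ⟨hs.erase_singleton hB, ?_, hU⟩
      simp only
      rw [Finset.card_erase_of_mem hB, hcard]
      rfl
    · rw [edgeMap_even_self]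
      exact Prod.ext (HalfPartition.ext' rfl (Finset.insert_erase hB)) rfl
  · have hs₀ := hs.erase_mem hB hn hne
    set A := B.erase (n + 1) with hA
    set s₀ : HalfPartition := ⟨s.nonprop, insert A (s.propagating.erase B)⟩ with hs₀e
    have hAs : A ∈ s₀.propagating := Finset.mem_insert_self _ _
    have hAn : A ∉ s.propagating.erase B := by
      intro h
      rw [Finset.mem_erase] at h
      obtain ⟨x, hx⟩ := (isHalfPartition_iff.1 hs₀).2.nonempty A (by simp [hAs])
      exact h.1 (hs.eq_of_mem (by simp [h.2]) (by simp [hB]) hx (Finset.mem_of_mem_erase hx))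
    have hcard₀ : s₀.propagating.card = nu.card + 1 := by
      rw [hs₀e]
      simp only
      rw [Finset.card_insert_of_notMem hAn, Finset.card_erase_add_one hB, hcard]
    have hpos := (position_bijOn hs₀.min_injOn).mapsTo hAs
    obtain ⟨⟨lam, T⟩, ⟨h, hT⟩, hbe⟩ := hb.surjOn
      (show (position s₀.propagating A, U) ∈ _ from ⟨by simpa [hcard₀] using hpos, hU⟩)
    refine ⟨lam, Or.inr h, (s₀, T), mem_Yp_even.2 ⟨hs₀, hcard₀.trans h.card_eq.symm, hT⟩, ?_⟩
    rw [edgeMap_even_of_addsBox h, hbe]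
    simp only
    rw [HalfPartition.addToPropagating_eq _ hs₀.min_injOn hAs]
    refine Prod.ext (HalfPartition.ext' rfl ?_) rfl
    simp only [hs₀e]
    rw [Finset.erase_insert hAn, hA, Finset.insert_erase hn, Finset.insert_erase hB]

/-- The edge depends on whether the part containing `n + 1` propagates; if it does, then the
largest label of the tableau is removed. -/
lemma exists_edgeMap_odd {y : HalfPartition × Filling}
    (hy : y ∈ Yp (2 * (n + 1)) (Sum.inl mu)) :
    ∃ lam, (mu = lam ∨ AddsBox lam mu) ∧ ∃ x ∈ Yp (2 * n + 1) (Sum.inr lam),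
      edgeMap b (2 * n + 1) (Sum.inr lam) (Sum.inl mu) x = y := by
  obtain ⟨s, T⟩ := y
  obtain ⟨hs, hcard, hT⟩ := mem_Yp_even.1 hy
  dsimp only at hs hcard hT
  obtain ⟨B, hB, hn⟩ := (isHalfPartition_iff.1 hs).2.exists_mem (n + 1) (by simp)
  rcases Finset.mem_union.1 hB with hB | hB
  · have hs₀ := hs.moveToPropagating hB
    have hBp := Finset.disjoint_left.1 (isHalfPartition_iff.1 hs).1 hB
    refine ⟨mu, Or.inl rfl, (⟨s.nonprop.erase B, insert B s.propagating⟩, T), ?_, ?_⟩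
    · refine mem_Yp_odd.2 ⟨hs₀, ?_, ⟨B, by simp, hn⟩, hT⟩
      simp only
      rw [Finset.card_insert_of_notMem hBp, hcard]
    · rw [edgeMap_odd_self, hs₀.stopPropagating_eq (Finset.mem_insert_self _ _) hn]
      exact Prod.ext (HalfPartition.ext' (Finset.insert_erase hB) (Finset.erase_insert hBp)) rfl
  · obtain ⟨lam, T₀, h, hT₀, rfl⟩ :=
      hT.exists_addLabel (hcard ▸ Finset.card_pos.2 ⟨B, hB⟩)
    exact ⟨lam, Or.inr h, (s, T₀), mem_Yp_odd.2 ⟨hs, hcard.trans h.card_eq, ⟨B, hB, hn⟩, hT₀⟩,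
      edgeMap_odd_of_addsBox h⟩

end

/-- The image of an edge map determines the edge and the argument. This gives both the injectivity
of the edge maps and the disjointness of their images. -/
lemma edgeMap_injective {b : YoungDiagram → YoungDiagram × Filling → ℕ × Filling}
    (hb : ∀ nu, IsInductionBijection nu (b nu)) {m : ℕ} {v v' w : DoubleYoungVertex}
    (hv : doubleYoungGraph.Adj v w) (hv' : doubleYoungGraph.Adj v' w)
    {x x' : HalfPartition × Filling} (hx : x ∈ Yp m v) (hx' : x' ∈ Yp m v')
    (he : edgeMap b m v w x = edgeMap b m v' w x') : v = v' ∧ x = x' := by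
  obtain ⟨n, rfl | rfl⟩ := Nat.even_or_odd' m
  · rcases v with lam | lam
    swap; · exact absurd hx (notMem_Yp_even x)
    rcases v' with lam' | lam'
    swap; · exact absurd hx' (notMem_Yp_even x')
    rcases w with nu | nu
    · exact hv.elim
    obtain ⟨rfl, rfl⟩ := edgeMap_even_injective (hb nu) hv hv' hx hx' he
    exact ⟨rfl, rfl⟩
  · rcases v with lam | lam
    · exact absurd hx (notMem_Yp_odd x)
    rcases v' with lam' | lam'
    · exact absurd hx' (notMem_Yp_odd x')
    rcases w with mu | mu
    swap; · exact hv.elim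
    obtain ⟨rfl, rfl⟩ := edgeMap_odd_injective hv hv' hx hx' he
    exact ⟨rfl, rfl⟩

lemma edgeMap_mem {b : YoungDiagram → YoungDiagram × Filling → ℕ × Filling}
    (hb : ∀ nu, IsInductionBijection nu (b nu)) {m : ℕ} {v w : DoubleYoungVertex}
    (hv : doubleYoungGraph.Adj v w) {x : HalfPartition × Filling} (hx : x ∈ Yp m v) :
    edgeMap b m v w x ∈ Yp (m + 1) w := by
  obtain ⟨n, rfl | rfl⟩ := Nat.even_or_odd' m
  · rcases v with lam | lam
    swap; · exact absurd hx (notMem_Yp_even x)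
    rcases w with nu | nu
    · exact hv.elim
    exact edgeMap_even_mem (hb nu) hv hx
  · rcases v with lam | lam
    · exact absurd hx (notMem_Yp_odd x)
    rcases w with mu | mu
    swap; · exact hv.elim
    exact edgeMap_odd_mem hv hx

lemma exists_edgeMap_eq {b : YoungDiagram → YoungDiagram × Filling → ℕ × Filling}
    (hb : ∀ nu, IsInductionBijection nu (b nu)) {m : ℕ} {w : DoubleYoungVertex}
    {y : HalfPartition × Filling} (hy : y ∈ Yp (m + 1) w) :
    ∃ v, doubleYoungGraph.Adj v w ∧ ∃ x ∈ Yp m v, edgeMap b m v w x = y := by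
  obtain ⟨n, rfl | rfl⟩ := Nat.even_or_odd' m
  · rcases w with nu | nu
    · exact absurd hy (notMem_Yp_odd y)
    obtain ⟨lam, hadj, h⟩ := exists_edgeMap_even (hb nu) hy
    exact ⟨Sum.inl lam, hadj, h⟩
  · rcases w with mu | mu
    · obtain ⟨lam, hadj, h⟩ := exists_edgeMap_odd (b := b) (n := n) hy
      exact ⟨Sum.inr lam, hadj, h⟩
    · exact absurd hy (notMem_Yp_even (n := n + 1) y)

theorem isPascalArray_Yp {b : YoungDiagram → YoungDiagram × Filling → ℕ × Filling}
    (hb : ∀ nu, IsInductionBijection nu (b nu)) :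
    IsPascalArray doubleYoungGraph emptyVertex Yp (edgeMap b) where
  layer_zero v := by
    have h1 : Subsingleton (Yp 0 v) := ⟨fun x y => Subtype.ext
      ((mem_Yp_zero_iff.1 x.2).2.trans (mem_Yp_zero_iff.1 y.2).2.symm)⟩
    have h2 : Subsingleton {p : doubleYoungGraph.Walk emptyVertex v // p.length = 0} := by
      refine ⟨fun ⟨p, hp⟩ ⟨q, hq⟩ => Subtype.ext ?_⟩
      obtain rfl := SimpleGraph.Walk.eq_of_length_eq_zero hp
      rw [SimpleGraph.Walk.length_eq_zero_iff] at hp hq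
      exact (SimpleGraph.Walk.eq_nil_iff_nil.2 hp).trans
        (SimpleGraph.Walk.eq_nil_iff_nil.2 hq).symm
    refine ⟨equivOfSubsingletonOfSubsingleton (fun x => ?_) fun p => ?_⟩
    · obtain rfl := (mem_Yp_zero_iff.1 x.2).1
      exact ⟨.nil, rfl⟩
    · exact ⟨_, mem_Yp_zero_iff.2 ⟨(SimpleGraph.Walk.eq_of_length_eq_zero p.2).symm, rfl⟩⟩
  mapsTo n v w h x hx := edgeMap_mem hb h hx
  injOn n v w h x hx y hy he := (edgeMap_injective hb h h hx hy he).2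
  disjoint n v v' w h h' hne := by
    rw [Set.disjoint_left]
    rintro _ ⟨x, hx, rfl⟩ ⟨x', hx', he⟩
    exact hne (edgeMap_injective hb h h' hx hx' he.symm).1
  cover n w := by
    ext y
    simp only [Set.mem_iUnion, exists_prop]
    constructor
    · exact exists_edgeMap_eq hb
    · rintro ⟨v, h, x, hx, rfl⟩
      exact edgeMap_mem hb h hx

/-! ### Closed walks -/

/-- The members of a layer of a Pascal array are in bijection with the walks from the root. -/
lemma IsPascalArray.nonempty_equiv {V α : Type*} {G : SimpleGraph V} {v₀ : V}
    {Y : ℕ → V → Set α} {edge : ℕ → V → V → α → α} (h : IsPascalArray G v₀ Y edge) (m : ℕ) (w : V) :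
    Nonempty (Y m w ≃ {p : G.Walk v₀ w // p.length = m}) := by
  induction m generalizing w with
  | zero => exact h.layer_zero w
  | succ m ih =>
    let f : (Σ v : {v // G.Adj v w}, Y m v.1) → Y (m + 1) w := fun x =>
      ⟨edge m x.1.1 w x.2.1, h.mapsTo m x.1.1 w x.1.2 x.2.2⟩
    let g : (Σ v : {v // G.Adj v w}, {p : G.Walk v₀ v.1 // p.length = m}) →
        {p : G.Walk v₀ w // p.length = m + 1} := fun x =>
      ⟨x.2.1.concat x.1.2, by rw [SimpleGraph.Walk.length_concat, x.2.2]⟩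
    have hf : Function.Bijective f := by
      constructor
      · rintro ⟨⟨v, hv⟩, x, hx⟩ ⟨⟨v', hv'⟩, x', hx'⟩ he
        have he' : edge m v w x = edge m v' w x' := congrArg Subtype.val he
        obtain rfl : v = v' := by
          by_contra hne
          exact Set.disjoint_left.1 (h.disjoint m v v' w hv hv' hne) ⟨x, hx, rfl⟩
            ⟨x', hx', he'.symm⟩
        obtain rfl := h.injOn m v w hv hx hx' he'
        rfl
      · rintro ⟨y, hy⟩
        rw [h.cover m w] at hy
        simp only [Set.mem_iUnion] at hy
        obtain ⟨v, hv, x, hx, rfl⟩ := hy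
        exact ⟨⟨⟨v, hv⟩, x, hx⟩, rfl⟩
    have hg : Function.Bijective g := by
      constructor
      · rintro ⟨⟨v, hv⟩, p, hp⟩ ⟨⟨v', hv'⟩, p', hp'⟩ he
        change G.Walk v₀ v at p
        change G.Walk v₀ v' at p'
        have he' : p.concat hv = p'.concat hv' := congrArg Subtype.val he
        obtain ⟨hvv, hpp⟩ := SimpleGraph.Walk.concat_inj he'
        subst hvv
        simp only [SimpleGraph.Walk.copy_rfl_rfl] at hpp
        subst hpp
        rfl
      · rintro ⟨p, hp⟩
        cases p with
        | nil => simp at hp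
        | cons hadj q =>
          obtain ⟨v, q', hv, hq⟩ := SimpleGraph.Walk.exists_cons_eq_concat hadj q
          refine ⟨⟨⟨v, hv⟩, q', ?_⟩, Subtype.ext hq.symm⟩
          rw [hq, SimpleGraph.Walk.length_concat] at hp
          omega
    exact ⟨(Equiv.ofBijective f hf).symm.trans
      ((Equiv.sigmaCongrRight fun v : {v // G.Adj v w} => (ih v.1).some).trans
        (Equiv.ofBijective g hg))⟩

/-- Half-partitions of `{1, …, n}` without propagating components are set partitions. -/
lemma nat_card_Yp_emptyVertex (n : ℕ) :
    Nat.card (Yp (2 * n) emptyVertex) =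
      Nat.card {p : Finset (Finset ℕ) // IsSetPartition (Finset.Icc 1 n) p} := by
  have hmem : ∀ x : HalfPartition × Filling, x ∈ Yp (2 * n) emptyVertex ↔
      IsSetPartition (Finset.Icc 1 n) x.1.nonprop ∧ x.1.propagating = ∅ ∧
        x.2 = fun _ _ => 0 := by
    intro x
    rw [emptyVertex, mem_Yp_even, isHalfPartition_iff, isStandardTableau_bot_iff]
    have h0 : (⊥ : YoungDiagram).card = 0 := by simp [YoungDiagram.card]
    rw [h0, Finset.card_eq_zero]
    constructor
    · rintro ⟨⟨-, h1⟩, h2, h3⟩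
      rw [h2, Finset.union_empty] at h1
      exact ⟨h1, h2, h3⟩
    · rintro ⟨h1, h2, h3⟩
      rw [h2, Finset.union_empty]
      exact ⟨⟨by simp, h1⟩, rfl, h3⟩
  refine Nat.card_congr ⟨fun x => ⟨x.1.1.nonprop, ((hmem _).1 x.2).1⟩,
    fun p => ⟨(⟨p.1, ∅⟩, fun _ _ => 0), (hmem _).2 ⟨p.2, rfl, rfl⟩⟩, fun x => ?_, fun p => rfl⟩
  obtain ⟨-, h2, h3⟩ := (hmem _).1 x.2
  exact Subtype.ext (Prod.ext (HalfPartition.ext' rfl h2.symm) h3.symm)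

lemma isSetPartition_map_iff {α β : Type*} [DecidableEq α] [DecidableEq β] (f : α ↪ β)
    {S : Finset α} {p : Finset (Finset α)} :
    IsSetPartition (S.map f) (p.map (Finset.mapEmbedding f).toEmbedding) ↔
      IsSetPartition S p := by
  have hmem : ∀ B, B ∈ p.map (Finset.mapEmbedding f).toEmbedding ↔ ∃ A ∈ p, A.map f = B := by
    intro B; simp
  constructor
  · intro h
    refine ⟨fun A hA => ?_, fun A hA => ?_, fun A hA B hB x hx hx' => ?_, fun x hx => ?_⟩
    · simpa using h.nonempty _ ((hmem _).2 ⟨A, hA, rfl⟩)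
    · simpa using h.subset _ ((hmem _).2 ⟨A, hA, rfl⟩)
    · exact Finset.map_injective f (h.eq_of_mem _ ((hmem _).2 ⟨A, hA, rfl⟩) _
        ((hmem _).2 ⟨B, hB, rfl⟩) (f x) (by simpa using hx) (by simpa using hx'))
    · obtain ⟨B, hB, hx'⟩ := h.exists_mem (f x) (by simpa using hx)
      obtain ⟨A, hA, rfl⟩ := (hmem _).1 hB
      exact ⟨A, hA, by simpa using hx'⟩
  · intro h
    refine ⟨fun B hB => ?_, fun B hB => ?_, fun B hB C hC y hy hy' => ?_, fun y hy => ?_⟩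
    · obtain ⟨A, hA, rfl⟩ := (hmem _).1 hB
      simpa using h.nonempty A hA
    · obtain ⟨A, hA, rfl⟩ := (hmem _).1 hB
      simpa using h.subset A hA
    · obtain ⟨A, hA, rfl⟩ := (hmem _).1 hB
      obtain ⟨A', hA', rfl⟩ := (hmem _).1 hC
      obtain ⟨x, hx, rfl⟩ := Finset.mem_map.1 hy
      rw [h.eq_of_mem A hA A' hA' x hx (by simpa using hy')]
    · obtain ⟨x, hx, rfl⟩ := Finset.mem_map.1 hy
      obtain ⟨A, hA, hx'⟩ := h.exists_mem x hx
      exact ⟨A.map f, (hmem _).2 ⟨A, hA, rfl⟩, by simpa using hx'⟩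

lemma bellNumber_eq (n : ℕ) : bellNumber n =
    Nat.card {p : Finset (Finset ℕ) // IsSetPartition (Finset.Icc 1 n) p} := by
  let f : Fin n ↪ ℕ := Fin.valEmbedding.trans ⟨Nat.succ, Nat.succ_injective⟩
  have hfi : ∀ i, f i = i.1 + 1 := fun i => rfl
  have hf : (Finset.univ : Finset (Fin n)).map f = Finset.Icc 1 n := by
    ext x
    simp only [Finset.mem_map, Finset.mem_univ, true_and, Finset.mem_Icc, hfi]
    constructor
    · rintro ⟨i, rfl⟩
      omega
    · rintro ⟨h1, h2⟩
      exact ⟨⟨x - 1, by omega⟩, Nat.sub_add_cancel h1⟩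
  rw [bellNumber, ← Nat.card_eq_fintype_card, ← hf]
  refine Nat.card_congr (Equiv.ofBijective (fun Q => ⟨Q.parts.map
    (Finset.mapEmbedding f).toEmbedding,
      (isSetPartition_map_iff f).2 (exists_finpartition_iff.1 ⟨Q, rfl⟩)⟩) ⟨?_, ?_⟩)
  · intro Q Q' h
    exact Finpartition.ext (Finset.map_injective _ (congrArg Subtype.val h))
  · rintro ⟨p, hp⟩
    -- every part is the image of its preimage
    obtain ⟨q, rfl⟩ : ∃ q : Finset (Finset (Fin n)),
        q.map (Finset.mapEmbedding f).toEmbedding = p := by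
      have : (p : Set (Finset ℕ)) ⊆ Set.range (Finset.mapEmbedding f).toEmbedding := by
        intro B hB
        obtain ⟨A, -, hA⟩ := Finset.subset_map_iff.1 (hp.subset B hB)
        exact ⟨A, hA.symm⟩
      obtain ⟨q, -, hq⟩ := Finset.subset_set_image_iff.1 (this.trans Set.image_univ.superset)
      exact ⟨q, by rw [← hq]; ext; simp⟩
    obtain ⟨Q, rfl⟩ := exists_finpartition_iff.2 ((isSetPartition_map_iff f).1 hp)
    exact ⟨Q, rfl⟩

theorem card_closedWalks (n : ℕ) :
    Nat.card {p : doubleYoungGraph.Walk emptyVertex emptyVertex // p.length = 2 * n} =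
      bellNumber n := by
  choose b hb using exists_isInductionBijection
  rw [bellNumber_eq, ← nat_card_Yp_emptyVertex,
    Nat.card_congr ((isPascalArray_Yp hb).nonempty_equiv (2 * n) emptyVertex).some]

/-! ### Matchings and permutations -/

/-- The parts in `s` are determined by the lowest elements of their unprimed halves, and also by
those of their primed halves. -/
def IsMatching (s : Finset (Finset (ℕ ⊕ ℕ))) : Prop :=
  Set.InjOn (fun B : Finset (ℕ ⊕ ℕ) => B.toLeft.min) s ∧
    Set.InjOn (fun B : Finset (ℕ ⊕ ℕ) => B.toRight.min) s

lemma bijOn_position_image {γ : Type*} [DecidableEq γ] {s : Finset γ} {f : γ → Finset ℕ}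
    (h : Set.InjOn (fun B => (f B).min) s) :
    Set.BijOn (fun B => position (s.image f) (f B)) s (Finset.Icc 1 s.card : Finset ℕ) := by
  have hf : Set.InjOn f s := fun A hA B hB hAB => h hA hB (congrArg Finset.min hAB)
  have hmin : Set.InjOn Finset.min (s.image f : Set (Finset ℕ)) := by
    intro A hA B hB hAB
    rw [Finset.coe_image] at hA hB
    obtain ⟨A, hA, rfl⟩ := hA
    obtain ⟨B, hB, rfl⟩ := hB
    rw [h hA hB hAB]
  have h1 := position_bijOn hmin
  rw [Finset.card_image_of_injOn hf, Finset.coe_image] at h1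
  exact h1.comp hf.bijOn_image

/-- The word `w` describes the matching: its entry at the position of the unprimed half of a part
is the position of the primed half. -/
def IsMatchingWord (s : Finset (Finset (ℕ ⊕ ℕ))) (w : List ℕ) : Prop :=
  w.length = s.card ∧ ∀ B ∈ s, w[position (s.image Finset.toLeft) B.toLeft - 1]? =
    some (position (s.image Finset.toRight) B.toRight)

lemma IsMatchingWord.matchingWord_eq {s : Finset (Finset (ℕ ⊕ ℕ))} {w : List ℕ}
    (hs : IsMatching s) (h : IsMatchingWord s w) : matchingWord s = w := by
  have hL := bijOn_position_image hs.1
  set L : List (ℕ ×ₗ ℕ) := (w.zipIdx 1).map fun x => toLex (x.2, x.1) with hLdef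
  have hlen : L.length = w.length := by simp [hLdef]
  have hsorted : L.Pairwise (· < ·) := by
    rw [List.pairwise_iff_getElem]
    intro i j hi hj hij
    simp only [hLdef, List.getElem_map, List.getElem_zipIdx]
    rw [Prod.Lex.toLex_lt_toLex]
    exact Or.inl (by simpa using hij)
  have himage : (s.image fun B => toLex (position (s.image Finset.toLeft) B.toLeft,
      position (s.image Finset.toRight) B.toRight)) = L.toFinset := by
    refine Finset.eq_of_subset_of_card_le (fun x hx => ?_) ?_
    · obtain ⟨B, hB, rfl⟩ := Finset.mem_image.1 hx
      have hpos := hL.mapsTo hB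
      rw [Finset.mem_coe, Finset.mem_Icc] at hpos
      obtain ⟨hlt, he⟩ := List.getElem?_eq_some_iff.1 (h.2 B hB)
      rw [List.mem_toFinset, List.mem_iff_getElem]
      refine ⟨_, hlen ▸ hlt, ?_⟩
      simp only [hLdef, List.getElem_map, List.getElem_zipIdx, he]
      rw [Nat.add_sub_cancel' hpos.1]
    · rw [Finset.card_image_of_injOn, ← h.1, ← hlen]
      · exact List.toFinset_card_le L
      · intro A hA B hB hAB
        exact hL.injOn hA hB (congrArg (fun x => (ofLex x).1) hAB)
  rw [matchingWord, himage,
    (List.toFinset_sort (· ≤ ·) (hsorted.imp fun h => h.ne)).2 (hsorted.imp fun h => h.le)]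
  simp [hLdef, Function.comp_def]

/-- The matching word of a matching is a permutation. -/
lemma IsMatching.isMatchingWord {s : Finset (Finset (ℕ ⊕ ℕ))} (hs : IsMatching s) :
    IsMatchingWord s (matchingWord s) ∧ (matchingWord s).Perm (List.range' 1 s.card) := by
  have hL := bijOn_position_image hs.1
  have hR := bijOn_position_image hs.2
  have hinv := hL.invOn_invFunOn
  have hbij := hL.symm hinv.symm
  set g := Function.invFunOn
    (fun B : Finset (ℕ ⊕ ℕ) => position (s.image Finset.toLeft) B.toLeft) s
  set f := fun i => position (s.image Finset.toRight) (g i).toRight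
  have hf : Set.BijOn f (Finset.Icc 1 s.card : Finset ℕ) (Finset.Icc 1 s.card : Finset ℕ) :=
    hR.comp hbij
  have hIcc : ∀ i, i ∈ List.range' 1 s.card ↔ i ∈ (Finset.Icc 1 s.card : Finset ℕ) := by
    intro i
    rw [List.mem_range'_1, Finset.mem_Icc]
    omega
  have hw : IsMatchingWord s ((List.range' 1 s.card).map f) := by
    refine ⟨by simp, fun B hB => ?_⟩
    have hpos := hL.mapsTo hB
    have hgB := hinv.1 hB
    simp only [Finset.mem_coe, Finset.mem_Icc] at hpos hgB
    rw [List.getElem?_map, List.getElem?_range' (by omega)]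
    simp only [Option.map_some, f]
    rw [one_mul, Nat.add_sub_cancel' hpos.1, hgB]
  rw [hw.matchingWord_eq hs]
  refine ⟨hw, (List.perm_ext_iff_of_nodup ?_ List.nodup_range').2 fun a => ?_⟩
  · exact List.Nodup.map_on (fun x hx y hy hxy =>
      hf.injOn ((hIcc x).1 hx) ((hIcc y).1 hy) hxy) List.nodup_range'
  · rw [List.mem_map]
    constructor
    · rintro ⟨i, hi, rfl⟩
      exact (hIcc _).2 (hf.mapsTo ((hIcc i).1 hi))
    · intro ha
      obtain ⟨i, hi, rfl⟩ := hf.surjOn ((hIcc a).1 ha)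
      exact ⟨i, (hIcc i).2 hi, rfl⟩

/-- A matching is determined by the two matched families and its word. -/
lemma IsMatching.ext {s s' : Finset (Finset (ℕ ⊕ ℕ))} (hs : IsMatching s) (hs' : IsMatching s')
    (hl : s.image Finset.toLeft = s'.image Finset.toLeft)
    (hr : s.image Finset.toRight = s'.image Finset.toRight)
    (hw : matchingWord s = matchingWord s') : s = s' := by
  have key : ∀ {s s' : Finset (Finset (ℕ ⊕ ℕ))}, IsMatching s → IsMatching s' →
      s.image Finset.toLeft = s'.image Finset.toLeft →
      s.image Finset.toRight = s'.image Finset.toRight →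
      matchingWord s = matchingWord s' → s ⊆ s' := by
    intro s s' hs hs' hl hr hw B hB
    have hBl := Finset.mem_image_of_mem Finset.toLeft hB
    rw [hl] at hBl
    obtain ⟨B', hB', he⟩ := Finset.mem_image.1 hBl
    have h1 := hs.isMatchingWord.1.2 B hB
    have h2 := hs'.isMatchingWord.1.2 B' hB'
    rw [he, ← hl, ← hw, h1, Option.some_inj, ← hr] at h2
    have hBr := Finset.mem_image_of_mem Finset.toRight hB
    rw [hr] at hBr
    obtain ⟨B'', hB'', he'⟩ := Finset.mem_image.1 hBr
    rw [← he', hr] at h2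
    obtain rfl := (bijOn_position_image hs'.2).injOn hB'' hB' h2
    rw [← Finset.toLeft_disjSum_toRight (u := B), ← he, ← he', Finset.toLeft_disjSum_toRight]
    exact hB'
  exact (key hs hs' hl hr hw).antisymm (key hs' hs hl.symm hr.symm hw.symm)

/-- Every permutation is the word of a matching of two given families of sets. -/
lemma exists_isMatching {F F' : Finset (Finset ℕ)}
    (hF : Set.InjOn Finset.min (F : Set (Finset ℕ)))
    (hF' : Set.InjOn Finset.min (F' : Set (Finset ℕ))) {w : List ℕ}
    (hcard : F.card = w.length) (hcard' : F'.card = w.length)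
    (hw : w.Perm (List.range' 1 w.length)) :
    ∃ s, IsMatching s ∧ s.image Finset.toLeft = F ∧ s.image Finset.toRight = F' ∧
      matchingWord s = w := by
  have hpos := position_bijOn hF
  have hpos' := position_bijOn hF'
  rw [hcard] at hpos
  rw [hcard'] at hpos'
  have hmem : ∀ i, i ∈ w ↔ i ∈ (Finset.Icc 1 w.length : Finset ℕ) := by
    intro i
    rw [hw.mem_iff, List.mem_range'_1, Finset.mem_Icc]
    omega
  set s : Finset (Finset (ℕ ⊕ ℕ)) := ((F ×ˢ F').filter fun x =>
    w[position F x.1 - 1]? = some (position F' x.2)).image fun x => x.1.disjSum x.2 with hs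
  have hmems : ∀ B, B ∈ s ↔ B.toLeft ∈ F ∧ B.toRight ∈ F' ∧
      w[position F B.toLeft - 1]? = some (position F' B.toRight) := by
    intro B
    simp only [hs, Finset.mem_image, Finset.mem_filter, Finset.mem_product, Prod.exists]
    constructor
    · rintro ⟨A, A', ⟨⟨h1, h2⟩, h3⟩, rfl⟩
      rw [Finset.toLeft_disjSum, Finset.toRight_disjSum]
      exact ⟨h1, h2, h3⟩
    · rintro ⟨h1, h2, h3⟩
      exact ⟨_, _, ⟨⟨h1, h2⟩, h3⟩, Finset.toLeft_disjSum_toRight⟩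
  have hext : ∀ {A B : Finset (ℕ ⊕ ℕ)}, A.toLeft = B.toLeft → A.toRight = B.toRight → A = B := by
    intro A B h1 h2
    rw [← Finset.toLeft_disjSum_toRight (u := A), h1, h2, Finset.toLeft_disjSum_toRight]
  have hM : IsMatching s := by
    constructor
    · intro A hA B hB hAB
      obtain ⟨h1, h2, h3⟩ := (hmems A).1 hA
      obtain ⟨h1', h2', h3'⟩ := (hmems B).1 hB
      have he := hF h1 h1' hAB
      rw [he, h3', Option.some_inj] at h3
      exact hext he (hpos'.injOn h2' h2 h3).symm
    · intro A hA B hB hAB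
      obtain ⟨h1, h2, h3⟩ := (hmems A).1 hA
      obtain ⟨h1', h2', h3'⟩ := (hmems B).1 hB
      have he := hF' h2 h2' hAB
      refine hext (hpos.injOn h1 h1' ?_) he
      rw [← he] at h3'
      obtain ⟨hlt, hi⟩ := List.getElem?_eq_some_iff.1 h3
      obtain ⟨hlt', hi'⟩ := List.getElem?_eq_some_iff.1 h3'
      have := ((hw.nodup_iff.2 List.nodup_range').getElem_inj_iff).1 (hi.trans hi'.symm)
      have p1 := hpos.mapsTo h1
      have p2 := hpos.mapsTo h1'
      rw [Finset.mem_coe, Finset.mem_Icc] at p1 p2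
      omega
  have hl : s.image Finset.toLeft = F := by
    ext A
    rw [Finset.mem_image]
    constructor
    · rintro ⟨B, hB, rfl⟩
      exact ((hmems B).1 hB).1
    · intro hA
      have hp := hpos.mapsTo hA
      rw [Finset.mem_coe, Finset.mem_Icc] at hp
      have hlt : position F A - 1 < w.length := by omega
      obtain ⟨A', hA', he⟩ := hpos'.surjOn ((hmem _).1 (List.getElem_mem hlt))
      refine ⟨A.disjSum A', (hmems _).2 ?_, Finset.toLeft_disjSum⟩
      rw [Finset.toLeft_disjSum, Finset.toRight_disjSum, List.getElem?_eq_getElem hlt, he]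
      exact ⟨hA, hA', rfl⟩
  have hr : s.image Finset.toRight = F' := by
    ext A'
    rw [Finset.mem_image]
    constructor
    · rintro ⟨B, hB, rfl⟩
      exact ((hmems B).1 hB).2.1
    · intro hA'
      obtain ⟨i, hi, he⟩ := List.mem_iff_getElem.1 ((hmem _).2 (hpos'.mapsTo hA'))
      obtain ⟨A, hA, hAi⟩ := hpos.surjOn
        (show i + 1 ∈ _ by rw [Finset.mem_coe, Finset.mem_Icc]; omega)
      refine ⟨A.disjSum A', (hmems _).2 ?_, Finset.toRight_disjSum⟩
      rw [Finset.toLeft_disjSum, Finset.toRight_disjSum, hAi, Nat.add_sub_cancel,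
        List.getElem?_eq_getElem hi, he]
      exact ⟨hA, hA', rfl⟩
  refine ⟨s, hM, hl, hr, IsMatchingWord.matchingWord_eq hM ⟨?_, fun B hB => ?_⟩⟩
  · rw [← hcard, ← hl, Finset.card_image_of_injOn fun A hA B hB hAB =>
      hM.1 hA hB (congrArg Finset.min hAB)]
  · rw [hl, hr]
    exact ((hmems B).1 hB).2.2

/-! ### Splitting set partitions into half-partitions -/

lemma Finset.ext_toLeft_toRight {α β : Type*} {A B : Finset (α ⊕ β)} (h1 : A.toLeft = B.toLeft)
    (h2 : A.toRight = B.toRight) : A = B := by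
  rw [← Finset.toLeft_disjSum_toRight (u := A), h1, h2, Finset.toLeft_disjSum_toRight]

lemma Finset.toLeft_nonempty_or_toRight_nonempty {α β : Type*} {B : Finset (α ⊕ β)}
    (h : B.Nonempty) : B.toLeft.Nonempty ∨ B.toRight.Nonempty := by
  obtain ⟨x | x, hx⟩ := h
  · exact Or.inl ⟨x, by simpa using hx⟩
  · exact Or.inr ⟨x, by simpa using hx⟩

/-- The set `{1, …, n} ∪ {1', …, n'}`. -/
def primedPair (n : ℕ) : Finset (ℕ ⊕ ℕ) := (Finset.Icc 1 n).disjSum (Finset.Icc 1 n)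

lemma mem_Cp_iff {n : ℕ} {p : Finset (Finset (ℕ ⊕ ℕ))} :
    p ∈ Cp n ↔ IsSetPartition (primedPair n) p := exists_finpartition_iff

lemma mem_propagatingParts {p : Finset (Finset (ℕ ⊕ ℕ))} {B : Finset (ℕ ⊕ ℕ)} :
    B ∈ propagatingParts p ↔ B ∈ p ∧ B.toLeft.Nonempty ∧ B.toRight.Nonempty := by
  simp only [propagatingParts, Finset.mem_filter, Finset.nonempty_iff_ne_empty, Ne]

/-- The traces of the parts on one of the two copies of `{1, …, n}`, embedded by `e`, form a
half-partition. -/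
lemma IsSetPartition.isHalfPartition_image {n : ℕ} {p q₁ q₂ : Finset (Finset (ℕ ⊕ ℕ))}
    (h : IsSetPartition (primedPair n) p) {f : Finset (ℕ ⊕ ℕ) → Finset ℕ} {e : ℕ → ℕ ⊕ ℕ}
    (hf : ∀ B x, x ∈ f B ↔ e x ∈ B) (he : ∀ x, e x ∈ primedPair n ↔ x ∈ Finset.Icc 1 n)
    (hq : ∀ B, B ∈ q₁ ∨ B ∈ q₂ ↔ B ∈ p ∧ (f B).Nonempty) (hd : ∀ B ∈ q₁, B ∉ q₂) :
    IsHalfPartition n ⟨q₁.image f, q₂.image f⟩ := by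
  have heq : ∀ A B x, A ∈ p → B ∈ p → x ∈ f A → x ∈ f B → A = B := fun A B x hA hB hxA hxB =>
    h.eq_of_mem A hA B hB (e x) ((hf A x).1 hxA) ((hf B x).1 hxB)
  have hmem : ∀ A, A ∈ q₁.image f ∪ q₂.image f ↔ ∃ B ∈ p, f B = A ∧ A.Nonempty := by
    intro A
    simp only [Finset.mem_union, Finset.mem_image]
    constructor
    · rintro (⟨B, hB, rfl⟩ | ⟨B, hB, rfl⟩)
      · exact ⟨B, ((hq B).1 (Or.inl hB)).1, rfl, ((hq B).1 (Or.inl hB)).2⟩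
      · exact ⟨B, ((hq B).1 (Or.inr hB)).1, rfl, ((hq B).1 (Or.inr hB)).2⟩
    · rintro ⟨B, hB, rfl, hne⟩
      rcases (hq B).2 ⟨hB, hne⟩ with hB | hB
      · exact Or.inl ⟨B, hB, rfl⟩
      · exact Or.inr ⟨B, hB, rfl⟩
  rw [isHalfPartition_iff]
  refine ⟨Finset.disjoint_left.2 fun A hA hA' => ?_, ?_, ?_, ?_, ?_⟩
  · obtain ⟨B, hB, rfl⟩ := Finset.mem_image.1 hA
    obtain ⟨B', hB', hBB⟩ := Finset.mem_image.1 hA'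
    obtain ⟨hBp, x, hx⟩ := (hq B).1 (Or.inl hB)
    obtain rfl := heq B B' x hBp ((hq B').1 (Or.inr hB')).1 hx (hBB ▸ hx)
    exact hd B hB hB'
  · intro A hA
    obtain ⟨B, hB, rfl, hne⟩ := (hmem A).1 hA
    exact hne
  · intro A hA x hx
    obtain ⟨B, hB, rfl, hne⟩ := (hmem A).1 hA
    exact (he x).1 (h.subset B hB ((hf B x).1 hx))
  · intro A hA A' hA' x hx hx'
    obtain ⟨B, hB, rfl, -⟩ := (hmem A).1 hA
    obtain ⟨B', hB', rfl, -⟩ := (hmem A').1 hA'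
    rw [heq B B' x hB hB' hx hx']
  · intro x hx
    obtain ⟨B, hB, hxB⟩ := h.exists_mem (e x) ((he x).2 hx)
    have hxf := (hf B x).2 hxB
    exact ⟨f B, (hmem _).2 ⟨B, hB, rfl, x, hxf⟩, hxf⟩

section

variable {n : ℕ} {p : Finset (Finset (ℕ ⊕ ℕ))}

lemma IsSetPartition.isHalfPartition_leftHalf (h : IsSetPartition (primedPair n) p) :
    IsHalfPartition n (leftHalf p) := by
  refine h.isHalfPartition_image (e := Sum.inl) (by simp) (by simp [primedPair]) (fun B => ?_)
    fun B hB hB' => ?_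
  · rw [mem_propagatingParts, Finset.mem_filter]
    constructor
    · rintro (⟨h1, h2⟩ | ⟨h1, h2, -⟩)
      · refine ⟨h1, (Finset.toLeft_nonempty_or_toRight_nonempty (h.nonempty B h1)).resolve_right ?_⟩
        simp [h2]
      · exact ⟨h1, h2⟩
    · rintro ⟨h1, h2⟩
      by_cases h3 : B.toRight = ∅
      · exact Or.inl ⟨h1, h3⟩
      · exact Or.inr ⟨h1, h2, Finset.nonempty_iff_ne_empty.2 h3⟩
  · exact (mem_propagatingParts.1 hB').2.2.ne_empty (Finset.mem_filter.1 hB).2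

lemma IsSetPartition.isHalfPartition_rightHalf (h : IsSetPartition (primedPair n) p) :
    IsHalfPartition n (rightHalf p) := by
  refine h.isHalfPartition_image (e := Sum.inr) (by simp) (by simp [primedPair]) (fun B => ?_)
    fun B hB hB' => ?_
  · rw [mem_propagatingParts, Finset.mem_filter]
    constructor
    · rintro (⟨h1, h2⟩ | ⟨h1, -, h2⟩)
      · refine ⟨h1, (Finset.toLeft_nonempty_or_toRight_nonempty (h.nonempty B h1)).resolve_left ?_⟩
        simp [h2]
      · exact ⟨h1, h2⟩
    · rintro ⟨h1, h2⟩
      by_cases h3 : B.toLeft = ∅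
      · exact Or.inl ⟨h1, h3⟩
      · exact Or.inr ⟨h1, Finset.nonempty_iff_ne_empty.2 h3, h2⟩
  · exact (mem_propagatingParts.1 hB').2.1.ne_empty (Finset.mem_filter.1 hB).2

lemma IsSetPartition.isMatching (h : IsSetPartition (primedPair n) p)
    {s : Finset (Finset (ℕ ⊕ ℕ))} (hs : s ⊆ propagatingParts p) : IsMatching s := by
  constructor
  · intro A hA B hB hAB
    obtain ⟨hA1, hA2, -⟩ := mem_propagatingParts.1 (hs hA)
    obtain ⟨hB1, -, -⟩ := mem_propagatingParts.1 (hs hB)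
    obtain ⟨x, hx⟩ := Finset.min_of_nonempty hA2
    exact h.eq_of_mem A hA1 B hB1 (Sum.inl x) (Finset.mem_toLeft.1 (Finset.mem_of_min hx))
      (Finset.mem_toLeft.1 (Finset.mem_of_min (hAB.symm.trans hx)))
  · intro A hA B hB hAB
    obtain ⟨hA1, -, hA2⟩ := mem_propagatingParts.1 (hs hA)
    obtain ⟨hB1, -, -⟩ := mem_propagatingParts.1 (hs hB)
    obtain ⟨x, hx⟩ := Finset.min_of_nonempty hA2
    exact h.eq_of_mem A hA1 B hB1 (Sum.inr x) (Finset.mem_toRight.1 (Finset.mem_of_min hx))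
      (Finset.mem_toRight.1 (Finset.mem_of_min (hAB.symm.trans hx)))

end

lemma IsMatching.injOn_toLeft {s : Finset (Finset (ℕ ⊕ ℕ))} (h : IsMatching s) :
    Set.InjOn Finset.toLeft (s : Set (Finset (ℕ ⊕ ℕ))) :=
  fun _ hA _ hB hAB => h.1 hA hB (congrArg Finset.min hAB)

lemma IsMatching.injOn_toRight {s : Finset (Finset (ℕ ⊕ ℕ))} (h : IsMatching s) :
    Set.InjOn Finset.toRight (s : Set (Finset (ℕ ⊕ ℕ))) :=
  fun _ hA _ hB hAB => h.2 hA hB (congrArg Finset.min hAB)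

/-! ### Gluing half-partitions -/

/-- The set of parts of the set partition with the given half-partitions, and with the parts in
`s` as its propagating parts. -/
def gluedParts (σ σ' : HalfPartition) (s : Finset (Finset (ℕ ⊕ ℕ))) : Finset (Finset (ℕ ⊕ ℕ)) :=
  σ.nonprop.image (fun A => A.disjSum ∅) ∪ σ'.nonprop.image (fun A => (∅ : Finset ℕ).disjSum A) ∪ s

lemma mem_gluedParts {σ σ' : HalfPartition} {s : Finset (Finset (ℕ ⊕ ℕ))} {B : Finset (ℕ ⊕ ℕ)} :
    B ∈ gluedParts σ σ' s ↔ (B.toLeft ∈ σ.nonprop ∧ B.toRight = ∅) ∨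
      (B.toLeft = ∅ ∧ B.toRight ∈ σ'.nonprop) ∨ B ∈ s := by
  rw [gluedParts, Finset.mem_union, Finset.mem_union, Finset.mem_image, Finset.mem_image, or_assoc]
  refine or_congr ⟨?_, ?_⟩ (or_congr_left ⟨?_, ?_⟩)
  · rintro ⟨A, hA, rfl⟩
    rw [Finset.toLeft_disjSum, Finset.toRight_disjSum]
    exact ⟨hA, rfl⟩
  · rintro ⟨h1, h2⟩
    exact ⟨_, h1, by rw [← h2, Finset.toLeft_disjSum_toRight]⟩
  · rintro ⟨A, hA, rfl⟩
    rw [Finset.toLeft_disjSum, Finset.toRight_disjSum]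
    exact ⟨rfl, hA⟩
  · rintro ⟨h1, h2⟩
    exact ⟨_, h2, by rw [← h1, Finset.toLeft_disjSum_toRight]⟩

/-- A set partition is determined by its halves and its propagating parts. -/
lemma gluedParts_halves (p : Finset (Finset (ℕ ⊕ ℕ))) :
    gluedParts (leftHalf p) (rightHalf p) (propagatingParts p) = p := by
  ext B
  rw [mem_gluedParts, mem_propagatingParts]
  simp only [leftHalf, rightHalf, Finset.mem_image, Finset.mem_filter]
  constructor
  · rintro (⟨⟨A, ⟨hA, hA'⟩, he⟩, hB⟩ | ⟨hB, A, ⟨hA, hA'⟩, he⟩ | hB)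
    · rwa [← Finset.ext_toLeft_toRight he (hA'.trans hB.symm)]
    · rwa [← Finset.ext_toLeft_toRight (hA'.trans hB.symm) he]
    · exact hB.1
  · intro hB
    by_cases h1 : B.toRight = ∅
    · exact Or.inl ⟨⟨B, ⟨hB, h1⟩, rfl⟩, h1⟩
    by_cases h2 : B.toLeft = ∅
    · exact Or.inr (Or.inl ⟨h2, B, ⟨hB, h2⟩, rfl⟩)
    exact Or.inr (Or.inr
      ⟨hB, Finset.nonempty_iff_ne_empty.2 h2, Finset.nonempty_iff_ne_empty.2 h1⟩)

lemma IsHalfPartition.nonempty {n : ℕ} {s : HalfPartition} (h : IsHalfPartition n s)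
    {A : Finset ℕ} (hA : A ∈ s.nonprop ∪ s.propagating) : A.Nonempty :=
  (isHalfPartition_iff.1 h).2.nonempty A hA

lemma IsHalfPartition.subset {n : ℕ} {s : HalfPartition} (h : IsHalfPartition n s)
    {A : Finset ℕ} (hA : A ∈ s.nonprop ∪ s.propagating) : A ⊆ Finset.Icc 1 n :=
  (isHalfPartition_iff.1 h).2.subset A hA

lemma IsHalfPartition.notMem_propagating {n : ℕ} {s : HalfPartition} (h : IsHalfPartition n s)
    {A : Finset ℕ} (hA : A ∈ s.nonprop) : A ∉ s.propagating :=
  Finset.disjoint_left.1 (isHalfPartition_iff.1 h).1 hA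

section

variable {n : ℕ} {σ σ' : HalfPartition} {s : Finset (Finset (ℕ ⊕ ℕ))}

lemma isSetPartition_gluedParts (hσ : IsHalfPartition n σ) (hσ' : IsHalfPartition n σ')
    (hl : s.image Finset.toLeft = σ.propagating) (hr : s.image Finset.toRight = σ'.propagating)
    (hil : Set.InjOn Finset.toLeft (s : Set (Finset (ℕ ⊕ ℕ))))
    (hir : Set.InjOn Finset.toRight (s : Set (Finset (ℕ ⊕ ℕ)))) :
    IsSetPartition (primedPair n) (gluedParts σ σ' s) := by
  have hls : ∀ B ∈ s, B.toLeft ∈ σ.propagating := fun B hB => hl ▸ Finset.mem_image_of_mem _ hB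
  have hrs : ∀ B ∈ s, B.toRight ∈ σ'.propagating := fun B hB => hr ▸ Finset.mem_image_of_mem _ hB
  -- each part is controlled by either of its halves that is not empty
  have hleft : ∀ B ∈ gluedParts σ σ' s, ∀ x, Sum.inl x ∈ B →
      B.toLeft ∈ σ.nonprop ∧ B.toRight = ∅ ∨ B ∈ s := by
    intro B hB x hx
    rcases mem_gluedParts.1 hB with h | h | h
    · exact Or.inl h
    · rw [← Finset.mem_toLeft, h.1] at hx
      simp at hx
    · exact Or.inr h
  have hright : ∀ B ∈ gluedParts σ σ' s, ∀ x, Sum.inr x ∈ B →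
      B.toLeft = ∅ ∧ B.toRight ∈ σ'.nonprop ∨ B ∈ s := by
    intro B hB x hx
    rcases mem_gluedParts.1 hB with h | h | h
    · rw [← Finset.mem_toRight, h.2] at hx
      simp at hx
    · exact Or.inl h
    · exact Or.inr h
  refine ⟨fun B hB => ?_, fun B hB => ?_, ?_, ?_⟩
  · have hl' : B.toLeft.Nonempty → B.Nonempty := fun ⟨x, hx⟩ => ⟨_, Finset.mem_toLeft.1 hx⟩
    have hr' : B.toRight.Nonempty → B.Nonempty := fun ⟨x, hx⟩ => ⟨_, Finset.mem_toRight.1 hx⟩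
    rcases mem_gluedParts.1 hB with h | h | h
    · exact hl' (hσ.nonempty (Finset.mem_union_left _ h.1))
    · exact hr' (hσ'.nonempty (Finset.mem_union_left _ h.2))
    · exact hl' (hσ.nonempty (Finset.mem_union_right _ (hls B h)))
  · rw [primedPair, Finset.subset_disjSum]
    rcases mem_gluedParts.1 hB with h | h | h
    · exact ⟨hσ.subset (Finset.mem_union_left _ h.1), h.2 ▸ Finset.empty_subset _⟩
    · exact ⟨h.1 ▸ Finset.empty_subset _, hσ'.subset (Finset.mem_union_left _ h.2)⟩
    · exact ⟨hσ.subset (Finset.mem_union_right _ (hls B h)),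
        hσ'.subset (Finset.mem_union_right _ (hrs B h))⟩
  · rintro A hA B hB (x | x) hxA hxB
    · have hxA' := Finset.mem_toLeft.2 hxA
      have hxB' := Finset.mem_toLeft.2 hxB
      rcases hleft A hA x hxA with h | h <;> rcases hleft B hB x hxB with h' | h'
      · exact Finset.ext_toLeft_toRight (hσ.eq_of_mem (Finset.mem_union_left _ h.1)
          (Finset.mem_union_left _ h'.1) hxA' hxB') (h.2.trans h'.2.symm)
      · have := hσ.eq_of_mem (Finset.mem_union_left _ h.1)
          (Finset.mem_union_right _ (hls B h')) hxA' hxB'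
        exact absurd (this ▸ hls B h') (hσ.notMem_propagating h.1)
      · have := hσ.eq_of_mem (Finset.mem_union_left _ h'.1)
          (Finset.mem_union_right _ (hls A h)) hxB' hxA'
        exact absurd (this ▸ hls A h) (hσ.notMem_propagating h'.1)
      · exact hil h h' (hσ.eq_of_mem (Finset.mem_union_right _ (hls A h))
          (Finset.mem_union_right _ (hls B h')) hxA' hxB')
    · have hxA' := Finset.mem_toRight.2 hxA
      have hxB' := Finset.mem_toRight.2 hxB
      rcases hright A hA x hxA with h | h <;> rcases hright B hB x hxB with h' | h'
      · exact Finset.ext_toLeft_toRight (h.1.trans h'.1.symm) (hσ'.eq_of_mem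
          (Finset.mem_union_left _ h.2) (Finset.mem_union_left _ h'.2) hxA' hxB')
      · have := hσ'.eq_of_mem (Finset.mem_union_left _ h.2)
          (Finset.mem_union_right _ (hrs B h')) hxA' hxB'
        exact absurd (this ▸ hrs B h') (hσ'.notMem_propagating h.2)
      · have := hσ'.eq_of_mem (Finset.mem_union_left _ h'.2)
          (Finset.mem_union_right _ (hrs A h)) hxB' hxA'
        exact absurd (this ▸ hrs A h) (hσ'.notMem_propagating h'.2)
      · exact hir h h' (hσ'.eq_of_mem (Finset.mem_union_right _ (hrs A h))
          (Finset.mem_union_right _ (hrs B h')) hxA' hxB')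
  · rintro (x | x) hx
    · rw [primedPair, Finset.inl_mem_disjSum] at hx
      obtain ⟨A, hA, hxA⟩ := (isHalfPartition_iff.1 hσ).2.exists_mem x hx
      rcases Finset.mem_union.1 hA with hA | hA
      · refine ⟨A.disjSum ∅, mem_gluedParts.2 (Or.inl ?_), by simpa using hxA⟩
        rw [Finset.toLeft_disjSum, Finset.toRight_disjSum]
        exact ⟨hA, rfl⟩
      · rw [← hl] at hA
        obtain ⟨B, hB, rfl⟩ := Finset.mem_image.1 hA
        exact ⟨B, mem_gluedParts.2 (Or.inr (Or.inr hB)), Finset.mem_toLeft.1 hxA⟩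
    · rw [primedPair, Finset.inr_mem_disjSum] at hx
      obtain ⟨A, hA, hxA⟩ := (isHalfPartition_iff.1 hσ').2.exists_mem x hx
      rcases Finset.mem_union.1 hA with hA | hA
      · refine ⟨(∅ : Finset ℕ).disjSum A, mem_gluedParts.2 (Or.inr (Or.inl ?_)), by simpa using hxA⟩
        rw [Finset.toLeft_disjSum, Finset.toRight_disjSum]
        exact ⟨rfl, hA⟩
      · rw [← hr] at hA
        obtain ⟨B, hB, rfl⟩ := Finset.mem_image.1 hA
        exact ⟨B, mem_gluedParts.2 (Or.inr (Or.inr hB)), Finset.mem_toRight.1 hxA⟩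

lemma propagatingParts_gluedParts (hσ : IsHalfPartition n σ) (hσ' : IsHalfPartition n σ')
    (hl : s.image Finset.toLeft = σ.propagating) (hr : s.image Finset.toRight = σ'.propagating) :
    propagatingParts (gluedParts σ σ' s) = s := by
  ext B
  rw [mem_propagatingParts, mem_gluedParts]
  constructor
  · rintro ⟨h | h | h, h1, h2⟩
    · exact absurd h.2 h2.ne_empty
    · exact absurd h.1 h1.ne_empty
    · exact h
  · intro h
    exact ⟨Or.inr (Or.inr h),
      hσ.nonempty (Finset.mem_union_right _ (hl ▸ Finset.mem_image_of_mem _ h)),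
      hσ'.nonempty (Finset.mem_union_right _ (hr ▸ Finset.mem_image_of_mem _ h))⟩

lemma leftHalf_gluedParts (hσ : IsHalfPartition n σ) (hσ' : IsHalfPartition n σ')
    (hl : s.image Finset.toLeft = σ.propagating) (hr : s.image Finset.toRight = σ'.propagating) :
    leftHalf (gluedParts σ σ' s) = σ := by
  refine HalfPartition.ext' ?_ ?_
  · ext A
    simp only [leftHalf, Finset.mem_image, Finset.mem_filter, mem_gluedParts]
    constructor
    · rintro ⟨B, ⟨h | h | h, h'⟩, rfl⟩
      · exact h.1
      · exact absurd h' (hσ'.nonempty (Finset.mem_union_left _ h.2)).ne_empty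
      · exact absurd h' (hσ'.nonempty
          (Finset.mem_union_right _ (hr ▸ Finset.mem_image_of_mem _ h))).ne_empty
    · intro hA
      refine ⟨A.disjSum ∅, ?_⟩
      rw [Finset.toLeft_disjSum, Finset.toRight_disjSum]
      exact ⟨⟨Or.inl ⟨hA, rfl⟩, rfl⟩, rfl⟩
  · rw [leftHalf, propagatingParts_gluedParts hσ hσ' hl hr, hl]

lemma rightHalf_gluedParts (hσ : IsHalfPartition n σ) (hσ' : IsHalfPartition n σ')
    (hl : s.image Finset.toLeft = σ.propagating) (hr : s.image Finset.toRight = σ'.propagating) :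
    rightHalf (gluedParts σ σ' s) = σ' := by
  refine HalfPartition.ext' ?_ ?_
  · ext A
    simp only [rightHalf, Finset.mem_image, Finset.mem_filter, mem_gluedParts]
    constructor
    · rintro ⟨B, ⟨h | h | h, h'⟩, rfl⟩
      · exact absurd h' (hσ.nonempty (Finset.mem_union_left _ h.1)).ne_empty
      · exact h.2
      · exact absurd h' (hσ.nonempty
          (Finset.mem_union_right _ (hl ▸ Finset.mem_image_of_mem _ h))).ne_empty
    · intro hA
      refine ⟨(∅ : Finset ℕ).disjSum A, ?_⟩
      rw [Finset.toLeft_disjSum, Finset.toRight_disjSum]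
      exact ⟨⟨Or.inr (Or.inl ⟨rfl, hA⟩), rfl⟩, rfl⟩
  · rw [rightHalf, propagatingParts_gluedParts hσ hσ' hl hr, hr]

end

/-! ### The bra-ket decomposition -/

lemma IsMatching.robinsonSchensted {s : Finset (Finset (ℕ ⊕ ℕ))} (hs : IsMatching s) :
    (shapeOfRows (robinsonSchensted (matchingWord s)).1).card = s.card ∧
      IsStandardTableau (shapeOfRows (_root_.robinsonSchensted (matchingWord s)).1)
        (fillingOfRows (_root_.robinsonSchensted (matchingWord s)).1) ∧
      IsStandardTableau (shapeOfRows (_root_.robinsonSchensted (matchingWord s)).1)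
        (fillingOfRows (_root_.robinsonSchensted (matchingWord s)).2) := by
  obtain ⟨hw, hp⟩ := hs.isMatchingWord
  exact ⟨(card_shapeOfRows_robinsonSchensted _).trans hw.1,
    (isTableau_robinsonSchensted _).isStandardTableau
      ((robinsonSchensted_flatten_perm _).trans hp),
    isStandardTableau_recording _⟩

/-- A matching of two given families is determined by its Robinson-Schensted tableaux. -/
lemma IsMatching.ext_of_robinsonSchensted {s s' : Finset (Finset (ℕ ⊕ ℕ))} (hs : IsMatching s)
    (hs' : IsMatching s') (hl : s.image Finset.toLeft = s'.image Finset.toLeft)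
    (hr : s.image Finset.toRight = s'.image Finset.toRight)
    (hshape : shapeOfRows (_root_.robinsonSchensted (matchingWord s)).1 =
      shapeOfRows (_root_.robinsonSchensted (matchingWord s')).1)
    (hP : fillingOfRows (_root_.robinsonSchensted (matchingWord s)).1 =
      fillingOfRows (_root_.robinsonSchensted (matchingWord s')).1)
    (hQ : fillingOfRows (_root_.robinsonSchensted (matchingWord s)).2 =
      fillingOfRows (_root_.robinsonSchensted (matchingWord s')).2) : s = s' := by
  refine hs.ext hs' hl hr (robinsonSchensted_injective ?_ hQ)
  rw [← (isTableau_robinsonSchensted (matchingWord s)).rowsOfFilling_eq, hshape, hP,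
    (isTableau_robinsonSchensted (matchingWord s')).rowsOfFilling_eq]

/-- Every pair of standard tableaux of the same shape comes from a matching. -/
lemma exists_isMatching_of_isStandardTableau {F F' : Finset (Finset ℕ)} {lam : YoungDiagram}
    {T T' : Filling} (hF : Set.InjOn Finset.min (F : Set (Finset ℕ)))
    (hF' : Set.InjOn Finset.min (F' : Set (Finset ℕ)))
    (hcard : F.card = lam.card) (hcard' : F'.card = lam.card)
    (hT : IsStandardTableau lam T) (hT' : IsStandardTableau lam T') :
    ∃ s, IsMatching s ∧ s.image Finset.toLeft = F ∧ s.image Finset.toRight = F' ∧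
      shapeOfRows (robinsonSchensted (matchingWord s)).1 = lam ∧
      fillingOfRows (robinsonSchensted (matchingWord s)).1 = T ∧
      fillingOfRows (robinsonSchensted (matchingWord s)).2 = T' := by
  have ht := hT.isTableau
  have hshape := shapeOfRows_rowsOfFilling ht
  obtain ⟨w, hP, hQ⟩ := exists_robinsonSchensted_eq ht (T := T') (by rwa [hshape])
  have hlen : w.length = lam.card := by
    rw [← card_shapeOfRows_robinsonSchensted, hP, hshape]
  have hperm : w.Perm (List.range' 1 w.length) := by
    refine (robinsonSchensted_flatten_perm w).symm.trans ?_
    rw [hP, hlen]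
    exact hT.flatten_perm
  obtain ⟨s, hs, hl, hr, hw⟩ :=
    exists_isMatching hF hF' (hcard.trans hlen.symm) (hcard'.trans hlen.symm) hperm
  refine ⟨s, hs, hl, hr, ?_⟩
  rw [hw, hP, hQ]
  exact ⟨hshape, fillingOfRows_rowsOfFilling hT.zeros, rfl⟩

section

variable (n : ℕ) (p : Finset (Finset (ℕ ⊕ ℕ)))

lemma partitionSequence_even : partitionSequence (2 * n) = Cp n := by
  simp [partitionSequence]

lemma partitionSequence_odd : partitionSequence (2 * n + 1) = CpPlus n := by
  have : (2 * n + 1) / 2 = n := by omega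
  simp [partitionSequence, this]

lemma braKet_even : braKet (2 * n) p =
    (Sum.inl (shapeOfRows (robinsonSchensted (matchingWord (propagatingParts p))).1),
      (leftHalf p, fillingOfRows (robinsonSchensted (matchingWord (propagatingParts p))).1),
      (rightHalf p, fillingOfRows (robinsonSchensted (matchingWord (propagatingParts p))).2)) := by
  simp [braKet, matchedParts]

/-- The propagating parts that do not contain `n + 1`. -/
def otherParts : Finset (Finset (ℕ ⊕ ℕ)) :=
  (propagatingParts p).filter fun B => Sum.inl (n + 1) ∉ B

lemma otherParts_subset : otherParts n p ⊆ propagatingParts p := Finset.filter_subset _ _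

lemma braKet_odd : braKet (2 * n + 1) p =
    (Sum.inr (shapeOfRows (robinsonSchensted (matchingWord (otherParts n p))).1),
      (leftHalf p, fillingOfRows (robinsonSchensted (matchingWord (otherParts n p))).1),
      (rightHalf p, fillingOfRows (robinsonSchensted (matchingWord (otherParts n p))).2)) := by
  have : (2 * n + 1) / 2 = n := by omega
  simp [braKet, matchedParts, otherParts, this]

end

lemma bijOn_braKet_even (n : ℕ) : Set.BijOn (braKet (2 * n)) (Cp n)
    {x | x.2.1 ∈ Yp (2 * n) x.1 ∧ x.2.2 ∈ Yp (2 * n) x.1} := by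
  refine ⟨fun p hp => ?_, fun p hp p' hp' he => ?_, ?_⟩
  · have h := mem_Cp_iff.1 hp
    have hM := h.isMatching subset_rfl
    obtain ⟨hcard, hP, hQ⟩ := hM.robinsonSchensted
    rw [braKet_even]
    refine ⟨mem_Yp_even.2 ⟨h.isHalfPartition_leftHalf, ?_, hP⟩,
      mem_Yp_even.2 ⟨h.isHalfPartition_rightHalf, ?_, hQ⟩⟩
    · rw [hcard]
      exact Finset.card_image_of_injOn hM.injOn_toLeft
    · rw [hcard]
      exact Finset.card_image_of_injOn hM.injOn_toRight
  · have h := mem_Cp_iff.1 hp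
    have h' := mem_Cp_iff.1 hp'
    rw [braKet_even, braKet_even] at he
    simp only [Prod.mk.injEq, Sum.inl.injEq] at he
    obtain ⟨hshape, ⟨hl, hP⟩, hr, hQ⟩ := he
    have hs := (h.isMatching subset_rfl).ext_of_robinsonSchensted (h'.isMatching subset_rfl)
      (congrArg HalfPartition.propagating hl) (congrArg HalfPartition.propagating hr) hshape hP hQ
    rw [← gluedParts_halves p, ← gluedParts_halves p', hl, hr, hs]
  · rintro ⟨lam | lam, ⟨σ, T⟩, σ', T'⟩ ⟨hx, hx'⟩
    swap; · exact absurd hx (notMem_Yp_even _)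
    obtain ⟨hσ, hcard, hT⟩ := mem_Yp_even.1 hx
    obtain ⟨hσ', hcard', hT'⟩ := mem_Yp_even.1 hx'
    obtain ⟨s, hs, hl, hr, hshape, hP, hQ⟩ := exists_isMatching_of_isStandardTableau
      hσ.min_injOn hσ'.min_injOn hcard hcard' hT hT'
    refine ⟨gluedParts σ σ' s, mem_Cp_iff.2
      (isSetPartition_gluedParts hσ hσ' hl hr hs.injOn_toLeft hs.injOn_toRight), ?_⟩
    rw [braKet_even, propagatingParts_gluedParts hσ hσ' hl hr, leftHalf_gluedParts hσ hσ' hl hr,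
      rightHalf_gluedParts hσ hσ' hl hr, hshape, hP, hQ]

section

variable {n : ℕ} {p : Finset (Finset (ℕ ⊕ ℕ))}

/-- In a member of `CpPlus n`, the numbers `n + 1` and `(n + 1)'` belong to the same parts. -/
lemma inl_mem_iff_inr_mem (hp : p ∈ CpPlus n) {B : Finset (ℕ ⊕ ℕ)} (hB : B ∈ p) :
    Sum.inl (n + 1) ∈ B ↔ Sum.inr (n + 1) ∈ B := by
  obtain ⟨h, B₀, hB₀, h1, h2⟩ := hp
  rw [mem_Cp_iff] at h
  constructor
  · intro h3
    rwa [h.eq_of_mem B hB B₀ hB₀ _ h3 h1]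
  · intro h3
    rwa [h.eq_of_mem B hB B₀ hB₀ _ h3 h2]

lemma image_toLeft_otherParts :
    (otherParts n p).image Finset.toLeft =
      (leftHalf p).propagating.filter fun A => n + 1 ∉ A := by
  ext A
  simp only [otherParts, leftHalf, Finset.mem_image, Finset.mem_filter]
  constructor
  · rintro ⟨B, ⟨h1, h2⟩, rfl⟩
    exact ⟨⟨B, h1, rfl⟩, by simpa using h2⟩
  · rintro ⟨⟨B, h1, rfl⟩, h2⟩
    exact ⟨B, ⟨h1, by simpa using h2⟩, rfl⟩

lemma image_toRight_otherParts (hp : p ∈ CpPlus n) :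
    (otherParts n p).image Finset.toRight =
      (rightHalf p).propagating.filter fun A => n + 1 ∉ A := by
  ext A
  simp only [otherParts, rightHalf, Finset.mem_image, Finset.mem_filter]
  constructor
  · rintro ⟨B, ⟨h1, h2⟩, rfl⟩
    rw [inl_mem_iff_inr_mem hp (mem_propagatingParts.1 h1).1] at h2
    exact ⟨⟨B, h1, rfl⟩, by simpa using h2⟩
  · rintro ⟨⟨B, h1, rfl⟩, h2⟩
    refine ⟨B, ⟨h1, ?_⟩, rfl⟩
    rw [inl_mem_iff_inr_mem hp (mem_propagatingParts.1 h1).1]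
    simpa using h2

lemma exists_propagatingParts_eq_insert (hp : p ∈ CpPlus n) :
    ∃ B, Sum.inl (n + 1) ∈ B ∧ Sum.inr (n + 1) ∈ B ∧ B ∈ propagatingParts p ∧
      B ∉ otherParts n p ∧ propagatingParts p = insert B (otherParts n p) := by
  obtain ⟨h, B, hB, h1, h2⟩ := hp
  have hBp : B ∈ propagatingParts p :=
    mem_propagatingParts.2 ⟨hB, ⟨_, Finset.mem_toLeft.2 h1⟩, ⟨_, Finset.mem_toRight.2 h2⟩⟩
  refine ⟨B, h1, h2, hBp, fun h' => (Finset.mem_filter.1 h').2 h1, ?_⟩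
  ext C
  rw [otherParts, Finset.mem_insert, Finset.mem_filter]
  constructor
  · intro hC
    by_cases h3 : Sum.inl (n + 1) ∈ C
    · exact Or.inl ((mem_Cp_iff.1 h).eq_of_mem C (mem_propagatingParts.1 hC).1 B hB _ h3 h1)
    · exact Or.inr ⟨hC, h3⟩
  · rintro (rfl | hC)
    · exact hBp
    · exact hC.1

end

lemma bijOn_braKet_odd (n : ℕ) : Set.BijOn (braKet (2 * n + 1)) (CpPlus n)
    {x | x.2.1 ∈ Yp (2 * n + 1) x.1 ∧ x.2.2 ∈ Yp (2 * n + 1) x.1} := by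
  refine ⟨fun p hp => ?_, fun p hp p' hp' he => ?_, ?_⟩
  · have h := mem_Cp_iff.1 hp.1
    have hM := h.isMatching (otherParts_subset n p)
    have hM' := h.isMatching subset_rfl
    obtain ⟨hcard, hP, hQ⟩ := hM.robinsonSchensted
    obtain ⟨B, h1, h2, hB, hB', hins⟩ := exists_propagatingParts_eq_insert hp
    have hcard' : (propagatingParts p).card = (otherParts n p).card + 1 := by
      rw [hins, Finset.card_insert_of_notMem hB']
    rw [braKet_odd]
    refine ⟨mem_Yp_odd.2 ⟨h.isHalfPartition_leftHalf, ?_, ⟨B.toLeft, ?_, ?_⟩, hP⟩,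
      mem_Yp_odd.2 ⟨h.isHalfPartition_rightHalf, ?_, ⟨B.toRight, ?_, ?_⟩, hQ⟩⟩
    · rw [hcard, ← hcard']
      exact Finset.card_image_of_injOn hM'.injOn_toLeft
    · exact Finset.mem_image_of_mem _ hB
    · simpa using h1
    · rw [hcard, ← hcard']
      exact Finset.card_image_of_injOn hM'.injOn_toRight
    · exact Finset.mem_image_of_mem _ hB
    · simpa using h2
  · have h := mem_Cp_iff.1 hp.1
    have h' := mem_Cp_iff.1 hp'.1
    rw [braKet_odd, braKet_odd] at he
    simp only [Prod.mk.injEq, Sum.inr.injEq] at he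
    obtain ⟨hshape, ⟨hl, hP⟩, hr, hQ⟩ := he
    have hs := (h.isMatching (otherParts_subset n p)).ext_of_robinsonSchensted
      (h'.isMatching (otherParts_subset n p'))
      (by rw [image_toLeft_otherParts, image_toLeft_otherParts, hl])
      (by rw [image_toRight_otherParts hp, image_toRight_otherParts hp', hr]) hshape hP hQ
    obtain ⟨B, h1, h2, hB, -, hins⟩ := exists_propagatingParts_eq_insert hp
    obtain ⟨B', h1', h2', hB', -, hins'⟩ := exists_propagatingParts_eq_insert hp'
    -- the parts containing `n + 1` agree because both of their halves do
    have hBB : B = B' := by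
      refine Finset.ext_toLeft_toRight ?_ ?_
      · have e : B.toLeft ∈ (leftHalf p').propagating := hl ▸ Finset.mem_image_of_mem _ hB
        have e' : B'.toLeft ∈ (leftHalf p').propagating := Finset.mem_image_of_mem _ hB'
        exact h'.isHalfPartition_leftHalf.eq_of_mem (Finset.mem_union_right _ e)
          (Finset.mem_union_right _ e') (Finset.mem_toLeft.2 h1) (Finset.mem_toLeft.2 h1')
      · have e : B.toRight ∈ (rightHalf p').propagating := hr ▸ Finset.mem_image_of_mem _ hB
        have e' : B'.toRight ∈ (rightHalf p').propagating := Finset.mem_image_of_mem _ hB'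
        exact h'.isHalfPartition_rightHalf.eq_of_mem (Finset.mem_union_right _ e)
          (Finset.mem_union_right _ e') (Finset.mem_toRight.2 h2) (Finset.mem_toRight.2 h2')
    rw [← gluedParts_halves p, ← gluedParts_halves p', hl, hr, hins, hins', hBB, hs]
  · rintro ⟨lam | lam, ⟨σ, T⟩, σ', T'⟩ ⟨hx, hx'⟩
    · exact absurd hx (notMem_Yp_odd _)
    obtain ⟨hσ, hcard, ⟨A, hA, hn⟩, hT⟩ := mem_Yp_odd.1 hx
    obtain ⟨hσ', hcard', ⟨A', hA', hn'⟩, hT'⟩ := mem_Yp_odd.1 hx'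
    dsimp only at hσ hσ' hcard hcard' hA hA' hT hT'
    obtain ⟨s, hs, hl, hr, hshape, hP, hQ⟩ := exists_isMatching_of_isStandardTableau
      (F := σ.propagating.erase A) (F' := σ'.propagating.erase A')
      (hσ.min_injOn.mono (by simp)) (hσ'.min_injOn.mono (by simp))
      (by rw [Finset.card_erase_of_mem hA, hcard]; rfl)
      (by rw [Finset.card_erase_of_mem hA', hcard']; rfl) hT hT'
    have hl' : (insert (A.disjSum A') s).image Finset.toLeft = σ.propagating := by
      rw [Finset.image_insert, hl, Finset.toLeft_disjSum, Finset.insert_erase hA]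
    have hr' : (insert (A.disjSum A') s).image Finset.toRight = σ'.propagating := by
      rw [Finset.image_insert, hr, Finset.toRight_disjSum, Finset.insert_erase hA']
    have hne : ∀ B ∈ s, B.toLeft ≠ A ∧ B.toLeft ∈ σ.propagating := fun B hB =>
      Finset.mem_erase.1 (hl ▸ Finset.mem_image_of_mem _ hB)
    have hne' : ∀ B ∈ s, B.toRight ≠ A' := fun B hB =>
      Finset.ne_of_mem_erase (hr ▸ Finset.mem_image_of_mem _ hB)
    have hnew : A.disjSum A' ∉ s := fun h => (hne _ h).1 Finset.toLeft_disjSum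
    have hil : Set.InjOn Finset.toLeft (↑(insert (A.disjSum A') s) : Set (Finset (ℕ ⊕ ℕ))) := by
      rw [Finset.coe_insert, Set.injOn_insert (by simpa using hnew)]
      refine ⟨hs.injOn_toLeft, ?_⟩
      rintro ⟨B, hB, he⟩
      exact (hne B hB).1 (he.trans Finset.toLeft_disjSum)
    have hir : Set.InjOn Finset.toRight (↑(insert (A.disjSum A') s) : Set (Finset (ℕ ⊕ ℕ))) := by
      rw [Finset.coe_insert, Set.injOn_insert (by simpa using hnew)]
      refine ⟨hs.injOn_toRight, ?_⟩
      rintro ⟨B, hB, he⟩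
      exact hne' B hB (he.trans Finset.toRight_disjSum)
    have hother : otherParts n (gluedParts σ σ' (insert (A.disjSum A') s)) = s := by
      rw [otherParts, propagatingParts_gluedParts hσ hσ' hl' hr', Finset.filter_insert,
        if_neg (by simpa using hn), Finset.filter_eq_self]
      intro B hB h
      obtain ⟨h1, h2⟩ := hne B hB
      exact h1 (hσ.eq_of_mem (Finset.mem_union_right _ h2) (Finset.mem_union_right _ hA)
        (Finset.mem_toLeft.2 h) hn)
    refine ⟨gluedParts σ σ' (insert (A.disjSum A') s), ⟨mem_Cp_iff.2
      (isSetPartition_gluedParts hσ hσ' hl' hr' hil hir), A.disjSum A',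
        mem_gluedParts.2 (Or.inr (Or.inr (Finset.mem_insert_self _ _))), by simpa using hn,
        by simpa using hn'⟩, ?_⟩
    rw [braKet_odd, hother, leftHalf_gluedParts hσ hσ' hl' hr',
      rightHalf_gluedParts hσ hσ' hl' hr', hshape, hP, hQ]

/-! ### The inclusions between the sets of set partitions -/

lemma mem_primedPair_succ {n : ℕ} {x : ℕ ⊕ ℕ} : x ∈ primedPair (n + 1) ↔
    x ∈ primedPair n ∨ x ∈ ({Sum.inl (n + 1), Sum.inr (n + 1)} : Finset (ℕ ⊕ ℕ)) := by
  rw [primedPair, primedPair, Icc_one_succ]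
  rcases x with x | x <;> simp [or_comm]

lemma notMem_primedPair {n : ℕ} {x : ℕ ⊕ ℕ}
    (hx : x ∈ ({Sum.inl (n + 1), Sum.inr (n + 1)} : Finset (ℕ ⊕ ℕ))) : x ∉ primedPair n := by
  rw [Finset.mem_insert, Finset.mem_singleton] at hx
  rcases hx with rfl | rfl <;> simp [primedPair]

lemma addPair_mem {n : ℕ} {p : Finset (Finset (ℕ ⊕ ℕ))} (hp : p ∈ Cp n) :
    addPair n p ∈ CpPlus n := by
  have h := mem_Cp_iff.1 hp
  have hmem : ∀ B, B ∈ addPair n p ↔ B ∈ p ∨ B = {Sum.inl (n + 1), Sum.inr (n + 1)} := by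
    intro B
    rw [addPair, Finset.mem_union, Finset.mem_singleton]
  refine ⟨mem_Cp_iff.2 ⟨fun B hB => ?_, fun B hB x hx => ?_, fun B hB C hC x hxB hxC => ?_,
    fun x hx => ?_⟩, _, (hmem _).2 (Or.inr rfl), by simp, by simp⟩
  · rcases (hmem B).1 hB with hB | rfl
    · exact h.nonempty B hB
    · simp
  · rw [mem_primedPair_succ]
    rcases (hmem B).1 hB with hB | rfl
    · exact Or.inl (h.subset B hB hx)
    · exact Or.inr hx
  · rcases (hmem B).1 hB with hB | rfl <;> rcases (hmem C).1 hC with hC | rfl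
    · exact h.eq_of_mem B hB C hC x hxB hxC
    · exact absurd (h.subset B hB hxB) (notMem_primedPair hxC)
    · exact absurd (h.subset C hC hxC) (notMem_primedPair hxB)
    · rfl
  · rcases mem_primedPair_succ.1 hx with hx | hx
    · obtain ⟨B, hB, hxB⟩ := h.exists_mem x hx
      exact ⟨B, (hmem B).2 (Or.inl hB), hxB⟩
    · exact ⟨_, (hmem _).2 (Or.inr rfl), hx⟩

lemma addPair_injOn (n : ℕ) : Set.InjOn (addPair n) (Cp n) := by
  have hnot : ∀ p ∈ Cp n, ({Sum.inl (n + 1), Sum.inr (n + 1)} : Finset (ℕ ⊕ ℕ)) ∉ p :=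
    fun p hp h => notMem_primedPair (by simp : Sum.inl (n + 1) ∈ _)
      ((mem_Cp_iff.1 hp).subset _ h (Finset.mem_insert_self _ _))
  have herase : ∀ p ∈ Cp n, (addPair n p).erase {Sum.inl (n + 1), Sum.inr (n + 1)} = p := by
    intro p hp
    rw [addPair, Finset.union_comm, ← Finset.insert_eq, Finset.erase_insert (hnot p hp)]
  intro p hp p' hp' he
  rw [← herase p hp, he, herase p' hp']

theorem mainTheorem5 :
    -- the choices on which the edge maps depend exist
    (∀ nu : YoungDiagram, ∃ b, IsInductionBijection nu b) ∧
    -- `C_p(n)` is included in `C_p(n+)`, and `C_p(n+)` is included in `C_p(n + 1)`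
    (∀ n : ℕ, Set.InjOn (addPair n) (Cp n) ∧ Set.MapsTo (addPair n) (Cp n) (CpPlus n) ∧
      CpPlus n ⊆ Cp (n + 1)) ∧
    -- for all choices, `Yp` is a Pascal array underlying `C_p(0), C_p(0+), C_p(1), …`
    (∀ b : YoungDiagram → YoungDiagram × Filling → ℕ × Filling,
      (∀ nu, IsInductionBijection nu (b nu)) →
      IsPascalArray doubleYoungGraph emptyVertex Yp (edgeMap b) ∧
      IsCatalanSequenceVia doubleYoungGraph emptyVertex Yp (edgeMap b) Yp (edgeMap b)
        partitionSequence braKet) ∧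
    -- the closed walks of length `2n` are counted by the Bell numbers
    (∀ n : ℕ, Nat.card {p : doubleYoungGraph.Walk emptyVertex emptyVertex // p.length = 2 * n} =
      bellNumber n) := by
  refine ⟨exists_isInductionBijection,
    fun n => ⟨addPair_injOn n, fun p hp => addPair_mem hp, fun p hp => hp.1⟩,
    fun b hb => ⟨isPascalArray_Yp hb, isPascalArray_Yp hb, isPascalArray_Yp hb, fun m => ?_⟩,
    card_closedWalks⟩
  obtain ⟨n, rfl | rfl⟩ := Nat.even_or_odd' m
  · rw [partitionSequence_even]
    exact bijOn_braKet_even n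
  · rw [partitionSequence_odd]
    exact bijOn_braKet_odd n
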